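/- **Notation.** For $\nu\in\mathbb R$ and $p\ge 1$ let $L_{\nu,p}(\mathbb R_+)$ be the space of (classes of) measurable functions $f:(0,\infty)\to\mathbb C$ with finite norm $$\|f\|_{\nu,p}=\Big(\int_0^\infty |f(x)|^p x^{\nu p-1}\,dx\Big)^{1/p},$$ let $C_b(\mathbb R)$ be the space of bounded continuous functions $\mathbb R\to\mathbb C$ with the supremum norm, and let $f^*(s)=\int_0^\infty f(x)x^{s-1}\,dx$ be the Mellin transform of $f$. Let $\Gamma$ and $B$ be Euler's gamma- and beta-functions, $I_\alpha$, $K_\alpha$ the modified Bessel functions of the first and the third kind (the latter is also called of the second kind), and for $z>1$ let $$P^\mu_\lambda(z)=\frac1{\Gamma(1-\mu)}\Big(\frac{z+1}{z-1}\Big)^{\mu/2}{}_2F_1\Big(-\lambda,\lambda+1;1-\mu;\frac{1-z}2\Big)$$ be the associated Legendre function of the first kind (${}_2F_1$ analytically continued to the negative half-line). Put $$(F_\mu f)(\tau)=\sqrt\pi\,\Gamma\big(\tfrac12+i\tau-\mu\big)\Gamma\big(\tfrac12-i\tau-\mu\big)\int_0^\infty\Big[P^\mu_{-1/2+i\tau}\Big(\sqrt{\tfrac{1+y}{y}}\Big)\Big]^2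 f(y)\,dy,\qquad \tau\in\mathbb R.$$ **Theorem.** Let $\mu\in\mathbb C$ with $\operatorname{Re}\mu<1/2$ and let $\nu\in(-1/2,-\operatorname{Re}\mu)$. 1. For every $f\in L_{1-\nu,1}(\mathbb R_+)$ and $\tau\in\mathbb R$ the integral defining $(F_\mu f)(\tau)$ converges absolutely, $F_\mu$ is a bounded linear operator from $L_{1-\nu,1}(\mathbb R_+)$ to $C_b(\mathbb R)$, and $$\|F_\mu f\|_{C_b(\mathbb R)}=\sup_{\tau\in\mathbb R}|(F_\mu f)(\tau)|\le C_{\mu,\nu}\,\|f\|_{1-\nu,1},$$ where $$C_{\mu,\nu}=\frac{2^{2\nu-1}}{\pi\sqrt\pi}\,B\big(\nu+\tfrac12,\nu+\tfrac12\big)\int_{\nu-i\infty}^{\nu+i\infty}\left|\frac{[\Gamma(s+1/2)]^2\,\Gamma(-\mu-s)}{\Gamma(1+s-\mu)}\,ds\right|<\infty.$$ Moreover, $(F_\mu f)(\tau)\to0$ as $|\tau|\to\infty$. 2. Let $1<p\le2$, $q=p/(p-1)$, and suppose in addition that $\nu\in\big(-\tfrac1{2q},\min(0,-\operatorname{Re}\mu)\big)$.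 Then for every $f\in L_{1-\nu,1}(\mathbb R_+)\cap L_{1-\nu,p}(\mathbb R_+)$ and every $\tau\in\mathbb R$ $$(F_\mu f)(\tau)=\frac{\sqrt\pi}{\cosh(\pi\tau)}\int_0^\infty K_{i\tau}\Big(\frac1{\sqrt x}\Big)\Big[I_{i\tau}\Big(\frac1{\sqrt x}\Big)+I_{-i\tau}\Big(\frac1{\sqrt x}\Big)\Big]\varphi(x)\,\frac{dx}{x},$$ where, for $x>0$, $$\varphi(x)=\frac1{2\pi i}\int_{\nu+1/2-i\infty}^{\nu+1/2+i\infty}\frac{\Gamma(1/2-\mu-s)\,\Gamma(s)\,\Gamma(1-s)}{\Gamma(s+1/2)\,\Gamma(1/2-s)\,\Gamma(1/2+s-\mu)}\,f^*\big(\tfrac32-s\big)\,x^{-s}\,ds,$$ and both integrals converge absolutely. -/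

import Mathlib

noncomputable section

namespace IndexTransform

open MeasureTheory Set

/-- The measure `x ^ (ν p - 1) dx` on `(0, ∞)`. The space `L_{ν,p}(ℝ₊)` is the space `L_p` of this
measure. -/
def weightedMeasure (ν p : ℝ) : Measure ℝ :=
  (volume.restrict (Ioi 0)).withDensity fun x => ENNReal.ofReal (x ^ (ν * p - 1))

/-- The norm `‖f‖_{ν,p} = (∫₀^∞ |f(x)|^p x^{νp-1} dx)^{1/p}` of `L_{ν,p}(ℝ₊)`. -/
def weightedNorm (ν p : ℝ) (f : ℝ → ℂ) : ℝ :=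
  (∫ x in Ioi (0 : ℝ), ‖f x‖ ^ p * x ^ (ν * p - 1)) ^ (1 / p)

/-- The function `₂F₁(a, b; c; w) / Γ(c)` on the half-plane `Re w < 1/2`. The Gauss series in `w`
converges for `|w| < 1` only; its analytic continuation to `Re w < 1/2` is
`(1 - w)^{-a} ₂F₁(a, c - b; c; w / (w - 1)) / Γ(c)` (Pfaff), where `|w / (w - 1)| < 1`. -/
def regularizedGauss (a b c w : ℂ) : ℂ :=
  (1 - w) ^ (-a) * Complex.regularizedGaussHGFun a (c - b) c (w / (w - 1))

/-- The associated Legendre function of the first kind for real `z > 1`,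
`P^μ_ν(z) = ((z + 1) / (z - 1))^{μ/2} ₂F₁(-ν, ν + 1; 1 - μ; (1 - z) / 2) / Γ(1 - μ)`. -/
def legendreP (μ ν : ℂ) (z : ℝ) : ℂ :=
  (((z + 1) / (z - 1) : ℝ) : ℂ) ^ (μ / 2) *
    regularizedGauss (-ν) (ν + 1) (1 - μ) (((1 - z) / 2 : ℝ) : ℂ)

/-- The factor `[P^μ_{-1/2+iτ}(√((1+y)/y))]²`. -/
def legendreSq (μ : ℂ) (τ y : ℝ) : ℂ :=
  legendreP μ (-1 / 2 + Complex.I * τ) (Real.sqrt ((1 + y) / y)) ^ 2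

/-- The index transform `(F_μ f)(τ)`. -/
def transform (μ : ℂ) (f : ℝ → ℂ) (τ : ℝ) : ℂ :=
  (Real.sqrt Real.pi : ℂ) * Complex.Gamma (1 / 2 + Complex.I * τ - μ) *
    Complex.Gamma (1 / 2 - Complex.I * τ - μ) *
      ∫ y in Ioi (0 : ℝ), legendreSq μ τ y * f y

/-- The function `Γ(s + 1/2)² Γ(-μ - s) / Γ(1 + s - μ)`. -/
def boundIntegrand (μ s : ℂ) : ℂ :=
  Complex.Gamma (s + 1 / 2) ^ 2 * Complex.Gamma (-μ - s) / Complex.Gamma (1 + s - μ)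

/-- The constant `C_{μ,ν}`. -/
def boundConst (μ : ℂ) (ν : ℝ) : ℝ :=
  2 ^ (2 * ν - 1) / (Real.pi * Real.sqrt Real.pi) *
    ProbabilityTheory.beta (ν + 1 / 2) (ν + 1 / 2) *
      ∫ t : ℝ, ‖boundIntegrand μ (ν + t * Complex.I)‖

/-- The modified Bessel function `I_α(x)`, `x > 0`. Where `n + α + 1` is a pole of `Γ`, the term
is zero. -/
def besselI (α : ℂ) (x : ℝ) : ℂ :=
  ∑' n : ℕ, ((x / 2 : ℝ) : ℂ) ^ (2 * n + α) / (n.factorial * Complex.Gamma (n + α + 1))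

/-- The modified Bessel function of the third kind `K_α(x)`, `x > 0`,
`K_α(x) = ∫₀^∞ e^{-x cosh t} cosh(α t) dt`. -/
def besselK (α : ℂ) (x : ℝ) : ℂ :=
  ∫ t in Ioi (0 : ℝ), (Real.exp (-x * Real.cosh t) : ℂ) * Complex.cosh (α * t)

/-- `K_{iτ}(1/√x) [I_{iτ}(1/√x) + I_{-iτ}(1/√x)]`. -/
def lebedevKernel (τ x : ℝ) : ℂ :=
  besselK (Complex.I * τ) (1 / Real.sqrt x) *
    (besselI (Complex.I * τ) (1 / Real.sqrt x) + besselI (-(Complex.I * τ)) (1 / Real.sqrt x))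

/-- The factor of the Mellin–Barnes integrand, multiplied by `f^*(3/2 - s)`, where `f^*` is the
Mellin transform. -/
def phiMellin (μ : ℂ) (f : ℝ → ℂ) (s : ℂ) : ℂ :=
  Complex.Gamma (1 / 2 - μ - s) * Complex.Gamma s * Complex.Gamma (1 - s) /
    (Complex.Gamma (s + 1 / 2) * Complex.Gamma (1 / 2 - s) * Complex.Gamma (1 / 2 + s - μ)) *
      mellin f (3 / 2 - s)

/-- `φ(x) = (1 / 2πi) ∫ phiMellin(s) x^{-s} ds` over the line `Re s = ν + 1/2`. -/
def phi (μ : ℂ) (ν : ℝ) (f : ℝ → ℂ) (x : ℝ) : ℂ :=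
  mellinInv (ν + 1 / 2) (phiMellin μ f) x

end IndexTransform

end

noncomputable section

namespace IndexTransform

open MeasureTheory Set Filter Topology

/-! ### Change of variables -/

/-! The squared Legendre function with its two Gamma factors, `kernel μ τ y`, is an inverse Mellin
transform of `barnes μ τ` on the line `Re s = ν` (`kernel_eq_mellinInv`), and `τ` enters `barnes`
only through the beta function `B(s + 1/2 + iτ, s + 1/2 - iτ)`. Fubini then gives the Parseval
formula `transform_eq_integral_barnes`: the transform is `1/(2π)` times the integral of `barnes μ τ
s * mellin f (1 - s)` along the line. Since `|B(p, q)| ≤ B(Re p, Re q)` and `|f^*|` on its line is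
at most the norm of `f`, the bound with the stated constant and, by domination, continuity in `τ`
follow. For fixed `s` the beta function is a Fourier transform in `τ`, so Riemann–Lebesgue and
dominated convergence give the limit `0`.

The Mellin–Barnes formula comes from squaring Laplace's integral. With `z = (R + R⁻¹)/2`, the
Legendre function is an Euler-type integral `A` over a segment (`legendreP_eq_integral`); by the
symmetry of `₂F₁` in its upper parameters the same integral, times the Gamma factors, is also a
Mellin transform `M` (`integral_segment_cpow_eq_mellin`). The product `A * M` is the Mellin
transform of a superposition of dilations, which a Möbius substitution identifies as a Legendre
function of the second kind, `legendreQ` (`kernel_eq_integral`). The Mellin transform of `legendreQ`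
is a product of two beta integrals, namely `boundIntegrand` (`mellin_legendreQ`); inverting it and
integrating first in the other variable leaves the beta function of `τ`.

For the second half, the Mellin transform of the Lebedev kernel has a closed form: expand `I` in its
power series, integrate term by term against `K`, and sum by Gauss's theorem
(`mellin_lebedevKernel`). The function `phiMellin` is what remains when this transform is divided
out of the Parseval integrand (`barnes_mul_mellin_eq`), so a second use of Fubini gives the formula.

The remaining point is that `phiMellin` is integrable on its line. With `σ = ν + 1/2` and `b = 1/2 -
μ` it equals `cot(πs) Γ(b - s)/Γ(b + s)` times a Mellin transform of `f`; the cotangent is bounded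
and the Gamma quotient is `O((1 + |t|)^{-2σ})` (`exists_norm_Gamma_quotient_le`). The condition `ν >
-1/(2q)` says exactly `2σ > 1/p`, and for such exponents the weighted Fourier transform of a
function in `L_1 ∩ L_p` is integrable (`integrable_fourier_mul_rpow`). That estimate uses
truncation, Plancherel and dyadic summation in place of the Hausdorff–Young inequality. -/

theorem image_eq_of_inverse {φ ψ : ℝ → ℝ} {s t : Set ℝ} (hφ : MapsTo φ s t) (hψ : MapsTo ψ t s)
    (h : ∀ y ∈ t, φ (ψ y) = y) : φ '' s = t :=
  Subset.antisymm hφ.image_subset fun y hy => ⟨ψ y, hψ hy, h y hy⟩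

/-- Each substitution is supplied with an explicit inverse `ψ`, from which both injectivity and
surjectivity onto `t` are read off; no monotonicity argument is needed. -/
theorem setIntegral_change {φ φ' ψ : ℝ → ℝ} {s t : Set ℝ} (hs : MeasurableSet s)
    (hφ' : ∀ x ∈ s, HasDerivAt φ (φ' x) x) (hφ : MapsTo φ s t) (hψ : MapsTo ψ t s)
    (hl : ∀ x ∈ s, ψ (φ x) = x) (hr : ∀ y ∈ t, φ (ψ y) = y) (g : ℝ → ℂ) :
    ∫ y in t, g y = ∫ x in s, ((|φ' x| : ℝ) : ℂ) * g (φ x) := by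
  rw [← image_eq_of_inverse hφ hψ hr, integral_image_eq_integral_abs_deriv_smul hs
    (fun x hx => (hφ' x hx).hasDerivWithinAt) (LeftInvOn.injOn (f₁' := ψ) hl)]
  simp

theorem integrableOn_change {φ φ' ψ : ℝ → ℝ} {s t : Set ℝ} (hs : MeasurableSet s)
    (hφ' : ∀ x ∈ s, HasDerivAt φ (φ' x) x) (hφ : MapsTo φ s t) (hψ : MapsTo ψ t s)
    (hl : ∀ x ∈ s, ψ (φ x) = x) (hr : ∀ y ∈ t, φ (ψ y) = y) (g : ℝ → ℂ) :
    IntegrableOn g t ↔ IntegrableOn (fun x => ((|φ' x| : ℝ) : ℂ) * g (φ x)) s := by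
  rw [← image_eq_of_inverse hφ hψ hr, integrableOn_image_iff_integrableOn_abs_deriv_smul hs
    (fun x hx => (hφ' x hx).hasDerivWithinAt) (LeftInvOn.injOn (f₁' := ψ) hl)]
  simp

/-! ### Superpositions of dilations and the Mellin transform -/

section Superposition

variable {S : Set ℝ} {h G : ℝ → ℂ} {l : ℝ → ℝ} {a : ℂ}

/-- The scaling rule of the Mellin transform, for absolute values: this is the marginal integral
that Tonelli needs in `integrable_mellin_superposition`. -/
theorem integral_norm_mellin_comp_mul (G : ℝ → ℂ) (a : ℂ) {c : ℝ} (hc : 0 < c) :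
    ∫ x in Ioi (0 : ℝ), ‖(x : ℂ) ^ (a - 1) * G (x * c)‖ =
      c ^ (-a.re) * ∫ x in Ioi (0 : ℝ), ‖(x : ℂ) ^ (a - 1) * G x‖ := by
  have h := integral_comp_mul_right_Ioi (fun x : ℝ => ‖(x : ℂ) ^ (a - 1) * G x‖) 0 hc
  simp only [zero_mul, smul_eq_mul] at h
  rw [Real.rpow_neg hc.le, show c ^ a.re = c ^ (a.re - 1) * c by
    rw [← Real.rpow_add_one hc.ne']; simp, mul_inv, mul_assoc, ← h, ← integral_const_mul]
  refine setIntegral_congr_fun measurableSet_Ioi fun x (hx : 0 < x) => ?_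
  simp only [norm_mul]
  rw [Complex.norm_cpow_eq_rpow_re_of_pos hx, Complex.norm_cpow_eq_rpow_re_of_pos (by positivity),
    Real.mul_rpow hx.le hc.le]
  simp only [Complex.sub_re, Complex.one_re]
  have : c ^ (a.re - 1) ≠ 0 := (Real.rpow_pos_of_pos hc _).ne'
  field_simp

theorem integrable_mellin_superposition (hS : MeasurableSet S)
    (hh : AEStronglyMeasurable h (volume.restrict S)) (hlm : Measurable l)
    (hl : ∀ s ∈ S, 0 < l s) (hG : MellinConvergent G a) (hGm : Measurable G)
    (hint : IntegrableOn (fun s => h s * (l s : ℂ) ^ (-a)) S) :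
    Integrable (fun z : ℝ × ℝ => (z.1 : ℂ) ^ (a - 1) * (h z.2 * G (z.1 * l z.2)))
      ((volume.restrict (Ioi 0)).prod (volume.restrict S)) := by
  have hm : AEStronglyMeasurable
      (fun z : ℝ × ℝ => (z.1 : ℂ) ^ (a - 1) * (h z.2 * G (z.1 * l z.2)))
      ((volume.restrict (Ioi 0)).prod (volume.restrict S)) := by
    refine AEStronglyMeasurable.mul ?_ (AEStronglyMeasurable.mul hh.comp_snd ?_)
    · exact Measurable.aestronglyMeasurable (by fun_prop)
    · exact Measurable.aestronglyMeasurable (by fun_prop)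
  refine (integrable_prod_iff' hm).2 ⟨?_, ?_⟩
  · filter_upwards [ae_restrict_mem hS] with s hs
    have := (MellinConvergent.comp_mul_left (f := G) (s := a) (hl s hs)).2 hG
    have := Integrable.const_mul this (h s)
    refine this.congr (Eventually.of_forall fun x => ?_)
    simp only [smul_eq_mul, mul_comm x]
    ring
  · have := (hint.norm).mul_const (∫ x in Ioi (0 : ℝ), ‖(x : ℂ) ^ (a - 1) * G x‖)
    refine this.congr ?_
    filter_upwards [ae_restrict_mem hS] with s hs
    have h1 := integral_norm_mellin_comp_mul G a (hl s hs)
    simp only [norm_mul] at h1 ⊢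
    rw [Complex.norm_cpow_eq_rpow_re_of_pos (hl s hs), Complex.neg_re, mul_assoc, ← h1,
      ← integral_const_mul]
    congr 1 with x
    ring

theorem mellinConvergent_superposition (hS : MeasurableSet S)
    (hh : AEStronglyMeasurable h (volume.restrict S)) (hlm : Measurable l)
    (hl : ∀ s ∈ S, 0 < l s) (hG : MellinConvergent G a) (hGm : Measurable G)
    (hint : IntegrableOn (fun s => h s * (l s : ℂ) ^ (-a)) S) :
    MellinConvergent (fun x => ∫ s in S, h s * G (x * l s)) a := by
  have := (integrable_mellin_superposition hS hh hlm hl hG hGm hint).integral_prod_left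
  refine this.congr (Eventually.of_forall fun x => ?_)
  simp [integral_const_mul]

/-- The dilation `x ↦ G (x * l s)` has Mellin transform `(l s)^{-a}` times that of `G`; the rest is
Fubini. This is the common tool for Laplace's integral, the square of the Legendre function,
`legendreQ` and `besselK`. The weight `h` need only be integrable after multiplication by `l^{-a}`.
-/
theorem mellin_superposition (hS : MeasurableSet S)
    (hh : AEStronglyMeasurable h (volume.restrict S)) (hlm : Measurable l)
    (hl : ∀ s ∈ S, 0 < l s) (hG : MellinConvergent G a) (hGm : Measurable G)
    (hint : IntegrableOn (fun s => h s * (l s : ℂ) ^ (-a)) S) :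
    mellin (fun x => ∫ s in S, h s * G (x * l s)) a =
      (∫ s in S, h s * (l s : ℂ) ^ (-a)) * mellin G a := by
  have := integral_integral_swap
    (f := fun (x s : ℝ) => (x : ℂ) ^ (a - 1) * (h s * G (x * l s)))
    (integrable_mellin_superposition hS hh hlm hl hG hGm hint)
  simp only [integral_const_mul] at this
  simp only [mellin, smul_eq_mul] at this ⊢
  rw [this, ← integral_mul_const]
  refine setIntegral_congr_fun hS fun s hs => ?_
  have h2 := mellin_comp_mul_right G a (hl s hs)
  simp only [mellin, smul_eq_mul] at h2
  rw [mul_assoc, ← h2, ← integral_const_mul]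
  congr 1 with x
  ring

end Superposition

/-! ### Beta integrals -/

theorem integrableOn_beta {p q : ℂ} (hp : 0 < p.re) (hq : 0 < q.re) :
    IntegrableOn (fun t : ℝ => (t : ℂ) ^ (p - 1) * (1 - (t : ℂ)) ^ (q - 1)) (Ioo 0 1) := by
  have := Complex.betaIntegral_convergent hp hq
  rwa [intervalIntegrable_iff_integrableOn_Ioo_of_le zero_le_one] at this

theorem integral_beta {p q : ℂ} (hp : 0 < p.re) (hq : 0 < q.re) :
    ∫ t in Ioo (0 : ℝ) 1, (t : ℂ) ^ (p - 1) * (1 - (t : ℂ)) ^ (q - 1) =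
      Complex.Gamma p * Complex.Gamma q / Complex.Gamma (p + q) := by
  rw [← Complex.betaIntegral_eq_Gamma_mul_div p q hp hq, Complex.betaIntegral,
    intervalIntegral.integral_of_le zero_le_one, integral_Ioc_eq_integral_Ioo]

theorem ofReal_cpow_eq_exp {x : ℝ} (hx : 0 < x) (r : ℂ) :
    (x : ℂ) ^ r = Complex.exp (Real.log x * r) := by
  rw [Complex.cpow_def_of_ne_zero (by exact_mod_cast hx.ne'), Complex.ofReal_log hx.le]

theorem ofReal_eq_exp {x : ℝ} (hx : 0 < x) : (x : ℂ) = Complex.exp (Real.log x) := by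
  rw [← Complex.ofReal_exp, Real.exp_log hx]

theorem ofReal_div_cpow {x y : ℝ} (hx : 0 ≤ x) (hy : 0 ≤ y) (r : ℂ) :
    ((x / y : ℝ) : ℂ) ^ r = (x : ℂ) ^ r / (y : ℂ) ^ r := by
  rw [div_eq_mul_inv, Complex.ofReal_mul, Complex.mul_cpow_ofReal_nonneg hx (inv_nonneg.2 hy),
    Complex.ofReal_inv, Complex.inv_cpow, div_eq_mul_inv]
  rw [Complex.arg_ofReal_of_nonneg hy]
  exact Real.pi_pos.ne

theorem integrableOn_beta_Ioi_and_integral {p q : ℂ} (hp : 0 < p.re) (hq : 0 < q.re) :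
    IntegrableOn (fun w : ℝ => (w : ℂ) ^ (p - 1) * ((1 + w : ℝ) : ℂ) ^ (-(p + q))) (Ioi 0) ∧
    ∫ w in Ioi (0 : ℝ), (w : ℂ) ^ (p - 1) * ((1 + w : ℝ) : ℂ) ^ (-(p + q)) =
      Complex.Gamma p * Complex.Gamma q / Complex.Gamma (p + q) := by
  have hφ' : ∀ t ∈ Ioo (0 : ℝ) 1,
      HasDerivAt (fun t : ℝ => t / (1 - t)) (1 / (1 - t) ^ 2) t := fun t ht => by
    have h1 : (1 - t) ≠ 0 := by linarith [ht.2]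
    convert! (hasDerivAt_id t).div ((hasDerivAt_id t).const_sub 1) h1 using 1
    simp
  have hφ : MapsTo (fun t : ℝ => t / (1 - t)) (Ioo 0 1) (Ioi 0) := fun t ht =>
    div_pos ht.1 (by linarith [ht.2])
  have hψ : MapsTo (fun w : ℝ => w / (1 + w)) (Ioi 0) (Ioo 0 1) := fun w (hw : 0 < w) =>
    ⟨by positivity, by rw [div_lt_one (by positivity)]; linarith⟩
  have hl : ∀ t ∈ Ioo (0 : ℝ) 1, t / (1 - t) / (1 + t / (1 - t)) = t := fun t ht => by
    have h1 : (1 - t) ≠ 0 := by linarith [ht.2]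
    field_simp
    ring
  have hr : ∀ w ∈ Ioi (0 : ℝ), w / (1 + w) / (1 - w / (1 + w)) = w := fun w (hw : 0 < w) => by
    have h1 : (1 + w) ≠ 0 := by positivity
    field_simp
    ring
  have key : EqOn (fun t : ℝ => ((|1 / (1 - t) ^ 2| : ℝ) : ℂ) *
      (((t / (1 - t) : ℝ) : ℂ) ^ (p - 1) * ((1 + t / (1 - t) : ℝ) : ℂ) ^ (-(p + q))))
      -- Under `w = t / (1 - t)` one has `1 + w = (1 - t)⁻¹` and `dw = (1 - t)^{-2} dt`, so the
      -- powers of `1 - t` collect to `q - 1`.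
      (fun t : ℝ => (t : ℂ) ^ (p - 1) * (1 - (t : ℂ)) ^ (q - 1)) (Ioo 0 1) := fun t ht => by
    have h1 : 0 < 1 - t := by linarith [ht.2]
    have h2 : (1 : ℝ) + t / (1 - t) = (1 - t)⁻¹ := by field_simp; ring
    have h3 : ((1 - t : ℝ) : ℂ) ≠ 0 := by exact_mod_cast h1.ne'
    simp only
    rw [h2, ofReal_div_cpow ht.1.le h1.le, abs_of_pos (by positivity), Complex.ofReal_inv,
      Complex.inv_cpow _ _ (by rw [Complex.arg_ofReal_of_nonneg h1.le]; exact Real.pi_pos.ne),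
      Complex.cpow_neg, inv_inv, Complex.cpow_add _ _ h3, Complex.cpow_sub _ _ h3,
      show (1 : ℂ) - (t : ℂ) = ((1 - t : ℝ) : ℂ) by push_cast; rfl, Complex.cpow_sub _ _ h3]
    have h4 : ((1 - t : ℝ) : ℂ) ^ p ≠ 0 := fun h => h3 ((Complex.cpow_eq_zero_iff _ _).1 h).1
    simp only [Complex.cpow_one]
    push_cast at h3 h4 ⊢
    field_simp
  constructor
  · rw [integrableOn_change measurableSet_Ioo hφ' hφ hψ hl hr,
      integrableOn_congr_fun key measurableSet_Ioo]
    exact integrableOn_beta hp hq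
  · rw [setIntegral_change measurableSet_Ioo hφ' hφ hψ hl hr,
      setIntegral_congr_fun measurableSet_Ioo key, integral_beta hp hq]

/-- The Mellin transform of `(1 + w)^{-(p + q)}` converges at `p`. -/
theorem mellinConvergent_one_add_cpow {p q : ℂ} (hp : 0 < p.re) (hq : 0 < q.re) :
    MellinConvergent (fun w : ℝ => ((1 + w : ℝ) : ℂ) ^ (-(p + q))) p :=
  (integrableOn_beta_Ioi_and_integral hp hq).1

theorem mellin_one_add_cpow {p q : ℂ} (hp : 0 < p.re) (hq : 0 < q.re) :
    mellin (fun w : ℝ => ((1 + w : ℝ) : ℂ) ^ (-(p + q))) p =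
      Complex.Gamma p * Complex.Gamma q / Complex.Gamma (p + q) :=
  (integrableOn_beta_Ioi_and_integral hp hq).2

/-! ### The Euler integral of the hypergeometric function -/

theorem hasSum_one_sub_cpow_neg (a : ℂ) {x : ℝ} (hx0 : 0 ≤ x) (hx : x < 1) :
    HasSum (fun n : ℕ => (ascPochhammer ℂ n).eval a / n.factorial * (x : ℂ) ^ n)
      (((1 - x : ℝ) : ℂ) ^ (-a)) := by
  have h := (Complex.one_div_one_sub_cpow_hasFPowerSeriesOnBall_zero a).hasSum (y := (x : ℂ))
    (by
      rw [Metric.mem_eball, edist_zero_right, ← ofReal_norm, ENNReal.ofReal_lt_one,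
        Complex.norm_of_nonneg hx0]
      exact hx)
  simp only [FormalMultilinearSeries.ofScalars_apply_eq, zero_add] at h
  convert! h using 1
  · ext n
    rw [smul_eq_mul, ← Ring.multichoose_eq, ← Polynomial.ascPochhammer_smeval_eq_eval,
      ← Ring.factorial_nsmul_multichoose_eq_ascPochhammer, nsmul_eq_mul,
      mul_div_cancel_left₀ _ (by exact_mod_cast n.factorial_ne_zero)]
  · rw [Complex.cpow_neg, one_div]
    push_cast
    rfl

/-- Termwise integration of the binomial series. Summability is kept as a hypothesis so that the
endpoint `z = 1`, needed for Gauss's summation, is covered along with `z < 1`. -/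
theorem hasSum_euler_integral {a b c : ℂ} {z : ℝ} (hb : 0 < b.re) (hcb : 0 < (c - b).re)
    (hz0 : 0 ≤ z) (hz1 : z ≤ 1)
    (hsum : Summable fun n : ℕ => ‖(ascPochhammer ℂ n).eval a / n.factorial * (z : ℂ) ^ n‖ *
      ∫ t in Ioo (0 : ℝ) 1, ‖(t : ℂ) ^ (b + n - 1) * (1 - (t : ℂ)) ^ (c - b - 1)‖) :
    HasSum (fun n : ℕ => (ascPochhammer ℂ n).eval a / n.factorial * (z : ℂ) ^ n *
        (Complex.Gamma (b + n) * Complex.Gamma (c - b) / Complex.Gamma (c + n)))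
      (∫ t in Ioo (0 : ℝ) 1, (t : ℂ) ^ (b - 1) * (1 - (t : ℂ)) ^ (c - b - 1) *
        ((1 - z * t : ℝ) : ℂ) ^ (-a)) := by
  have hbn : ∀ n : ℕ, 0 < (b + n).re := fun n => by simp; positivity
  have h := hasSum_integral_of_summable_integral_norm (μ := volume.restrict (Ioo (0 : ℝ) 1))
    (F := fun (n : ℕ) (t : ℝ) => ((ascPochhammer ℂ n).eval a / n.factorial * (z : ℂ) ^ n) *
      ((t : ℂ) ^ (b + n - 1) * (1 - (t : ℂ)) ^ (c - b - 1)))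
    (fun n => (integrableOn_beta (hbn n) hcb).const_mul _)
    (by simpa only [norm_mul, integral_const_mul] using hsum)
  convert! h using 1
  · ext n
    rw [integral_const_mul, integral_beta (hbn n) hcb]
    congr 3
    ring
  · refine setIntegral_congr_fun measurableSet_Ioo fun t ht => ?_
    have ht0 : (t : ℂ) ≠ 0 := by exact_mod_cast ht.1.ne'
    have hzt : z * t < 1 := lt_of_le_of_lt (mul_le_of_le_one_left ht.1.le hz1) ht.2
    have := (hasSum_one_sub_cpow_neg a (mul_nonneg hz0 ht.1.le) hzt).mul_left
      ((t : ℂ) ^ (b - 1) * (1 - (t : ℂ)) ^ (c - b - 1))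
    rw [← this.tsum_eq]
    refine tsum_congr fun n => ?_
    rw [show b + n - 1 = (b - 1) + n by ring, Complex.cpow_add _ _ ht0, Complex.cpow_natCast]
    push_cast
    ring

theorem Gamma_add_natCast {b : ℂ} (hb : 0 < b.re) (n : ℕ) :
    Complex.Gamma (b + n) = (ascPochhammer ℂ n).eval b * Complex.Gamma b := by
  rw [← Complex.Gamma_add_nat_div_Gamma_eq b, div_mul_cancel₀]
  · exact Complex.Gamma_ne_zero_of_re_pos hb
  · intro k hk
    rw [hk] at hb
    simp at hb
    linarith [(Nat.cast_nonneg k : (0 : ℝ) ≤ k)]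

/-- For `z < 1` the absolute moments of the beta weight decrease in `n`, so the binomial series
itself dominates. -/
theorem integral_euler {a b c : ℂ} {z : ℝ} (hb : 0 < b.re) (hcb : 0 < (c - b).re)
    (hz0 : 0 ≤ z) (hz1 : z < 1) :
    ∫ t in Ioo (0 : ℝ) 1, (t : ℂ) ^ (b - 1) * (1 - (t : ℂ)) ^ (c - b - 1) *
        ((1 - z * t : ℝ) : ℂ) ^ (-a) =
      Complex.Gamma b * Complex.Gamma (c - b) * Complex.regularizedGaussHGFun a b c z := by
  have hbn : ∀ n : ℕ, 0 < (b + n).re := fun n => by simp; positivity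
  have hsum : Summable fun n : ℕ => ‖(ascPochhammer ℂ n).eval a / n.factorial * (z : ℂ) ^ n‖ *
      ∫ t in Ioo (0 : ℝ) 1, ‖(t : ℂ) ^ (b + n - 1) * (1 - (t : ℂ)) ^ (c - b - 1)‖ := by
    refine Summable.of_nonneg_of_le (fun n => mul_nonneg (norm_nonneg _)
      (integral_nonneg fun t => norm_nonneg _)) (fun n => mul_le_mul_of_nonneg_left ?_
      (norm_nonneg _)) ((hasSum_one_sub_cpow_neg a hz0 hz1).summable.norm.mul_right
        (∫ t in Ioo (0 : ℝ) 1, ‖(t : ℂ) ^ (b - 1) * (1 - (t : ℂ)) ^ (c - b - 1)‖))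
    refine setIntegral_mono_on (integrableOn_beta (hbn n) hcb).norm
      (integrableOn_beta hb hcb).norm measurableSet_Ioo fun t ht => ?_
    simp only [norm_mul]
    refine mul_le_mul_of_nonneg_right ?_ (norm_nonneg _)
    rw [Complex.norm_cpow_eq_rpow_re_of_pos ht.1, Complex.norm_cpow_eq_rpow_re_of_pos ht.1]
    refine Real.rpow_le_rpow_of_exponent_ge ht.1 ht.2.le ?_
    simp
  rw [← (hasSum_euler_integral hb hcb hz0 hz1.le hsum).tsum_eq, Complex.regularizedGaussHGFun,
    FormalMultilinearSeries.sum, ← tsum_mul_left]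
  refine tsum_congr fun n => ?_
  rw [FormalMultilinearSeries.apply_eq_pow_smul_coeff, Complex.coeff_regularizedGaussHGFunSeries,
    Gamma_add_natCast hb, smul_eq_mul]
  ring

/-! ### An elementary hypergeometric integral -/

section Elementary

variable {b : ℂ} {α β : ℝ}

/-- The substitution `t = α e^w / (β + α e^w)` makes the base of the non-beta power even in `w`;
only the last factor on the right has an odd part. -/
theorem elementary_integrand_change (b : ℂ) (hα : 0 < α) (hβ : 0 < β) (w : ℝ) :
    ((|α * β * Real.exp w / (β + α * Real.exp w) ^ 2| : ℝ) : ℂ) *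
      (((α * Real.exp w / (β + α * Real.exp w) : ℝ) : ℂ) ^ (b - 1) *
        (1 - ((α * Real.exp w / (β + α * Real.exp w) : ℝ) : ℂ)) ^ (b - 1) *
        ((α ^ 2 * (1 - α * Real.exp w / (β + α * Real.exp w)) +
          β ^ 2 * (α * Real.exp w / (β + α * Real.exp w)) : ℝ) : ℂ) ^ (-(b + 1 / 2))) =
      ((α * β : ℝ) : ℂ) ^ (-(1 / 2) : ℂ) *
        (((α + β) ^ 2 + α * β * (2 * Real.sinh (w / 2)) ^ 2 : ℝ) : ℂ) ^ (-(b + 1 / 2)) *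
        ((β * Real.exp (-(w / 2)) + α * Real.exp (w / 2) : ℝ) : ℂ) := by
  set e := Real.exp w with he
  have hE : Real.exp w = Real.exp (w / 2) * Real.exp (w / 2) := by rw [← Real.exp_add]; ring_nf
  have hE' : Real.exp (w / 2) * Real.exp (-(w / 2)) = 1 := by rw [← Real.exp_add]; simp
  have he0 : 0 < e := Real.exp_pos w
  set D := β + α * e with hD
  have hD0 : 0 < D := by positivity
  set A := α + β * e with hA
  have hA0 : 0 < A := by positivity
  have h1 : 1 - α * e / D = β / D := by field_simp; rw [hD]; ring
  have h1' : (1 : ℂ) - ((α * e / D : ℝ) : ℂ) = ((β / D : ℝ) : ℂ) := by rw [← h1]; push_cast; rfl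
  have h2 : α ^ 2 * (1 - α * e / D) + β ^ 2 * (α * e / D) = α * β * A / D := by
    rw [h1, hA]; field_simp
  have h3 : (α + β) ^ 2 + α * β * (2 * Real.sinh (w / 2)) ^ 2 = A * D / e := by
    rw [eq_div_iff he0.ne', hA, hD, he, Real.sinh_eq, hE]
    linear_combination (-2 * α * β * Real.exp (w / 2) ^ 2 + α * β *
      (Real.exp (w / 2) * Real.exp (-(w / 2)) + 1)) * hE'
  have h4 : β * Real.exp (-(w / 2)) + α * Real.exp (w / 2) = Real.exp (-(w / 2)) * D := by
    rw [hD, he, hE]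
    linear_combination (-α * Real.exp (w / 2)) * hE'
  have hab : 0 < α * β := by positivity
  -- Every factor is a complex power of a positive real. Written as exponentials, both sides have
  -- exponents linear in the logarithms of `α`, `β`, `A`, `D` and in `w`, so the identity reduces to
  -- `ring`. The same device serves in the later substitutions.
  rw [h1', h2, h3, h4, abs_of_pos (by positivity), ofReal_cpow_eq_exp (x := α * e / D) (by positivity),
    ofReal_cpow_eq_exp (x := β / D) (by positivity),
    ofReal_cpow_eq_exp (x := α * β * A / D) (by positivity),
    ofReal_cpow_eq_exp (x := A * D / e) (by positivity),
    ofReal_cpow_eq_exp hab, ofReal_eq_exp (x := α * β * e / D ^ 2) (by positivity),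
    ofReal_eq_exp (x := Real.exp (-(w / 2)) * D) (by positivity)]
  simp only [← Complex.exp_add]
  rw [Real.log_div (by positivity) (by positivity), Real.log_div (by positivity) (by positivity),
    Real.log_div (by positivity) (by positivity), Real.log_div (by positivity) (by positivity),
    Real.log_div (by positivity) (by positivity), Real.log_mul (by positivity) (by positivity),
    Real.log_mul (by positivity) (by positivity), Real.log_mul (by positivity) (by positivity),
    Real.log_mul (by positivity) (by positivity), Real.log_mul (by positivity) (by positivity),
    Real.log_mul (by positivity) (by positivity), Real.log_mul (by positivity) (by positivity), Real.log_pow, Real.log_exp, Real.log_exp]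
  congr 1
  push_cast
  ring

/-- Averaging over `w` and `-w` replaces the last factor by `(α + β) cosh(w/2)`, which is a multiple
of the derivative of `sinh(w/2)`. The integral thereby becomes one in `p` that does not depend on
`α` and `β`. -/
theorem integral_elementary_eq (hb : 0 < b.re) (hα : 0 < α) (hβ : 0 < β) :
    ∫ t in Ioo (0 : ℝ) 1, (t : ℂ) ^ (b - 1) * (1 - (t : ℂ)) ^ (b - 1) *
        ((α ^ 2 * (1 - t) + β ^ 2 * t : ℝ) : ℂ) ^ (-(b + 1 / 2)) =
      ((α * β : ℝ) : ℂ)⁻¹ * ((α + β : ℝ) : ℂ) ^ (1 - 2 * b) *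
        ∫ p : ℝ, ((1 + p ^ 2 : ℝ) : ℂ) ^ (-(b + 1 / 2)) := by
  have hab : 0 < α * β := by positivity
  set h : ℝ → ℂ := fun w => ((α * β : ℝ) : ℂ) ^ (-(1 / 2) : ℂ) *
        (((α + β) ^ 2 + α * β * (2 * Real.sinh (w / 2)) ^ 2 : ℝ) : ℂ) ^ (-(b + 1 / 2)) *
        ((β * Real.exp (-(w / 2)) + α * Real.exp (w / 2) : ℝ) : ℂ) with hh
  have hD : ∀ w : ℝ, 0 < β + α * Real.exp w := fun w => by positivity
  have hφ' : ∀ w ∈ (univ : Set ℝ), HasDerivAt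
      (fun w : ℝ => α * Real.exp w / (β + α * Real.exp w))
      (α * β * Real.exp w / (β + α * Real.exp w) ^ 2) w := fun w _ => by
    have h1 := (Real.hasDerivAt_exp w).const_mul α
    convert! h1.div (h1.const_add β) (hD w).ne' using 1
    ring
  have hφ : MapsTo (fun w : ℝ => α * Real.exp w / (β + α * Real.exp w)) univ (Ioo 0 1) :=
    fun w _ => ⟨by positivity, by rw [div_lt_one (hD w)]; linarith⟩
  have hψ : MapsTo (fun t : ℝ => Real.log (β * t / (α * (1 - t)))) (Ioo 0 1) univ :=
    fun _ _ => mem_univ _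
  have hl : ∀ w ∈ (univ : Set ℝ), Real.log (β * (α * Real.exp w / (β + α * Real.exp w)) /
      (α * (1 - α * Real.exp w / (β + α * Real.exp w)))) = w := fun w _ => by
    have : β * (α * Real.exp w / (β + α * Real.exp w)) /
      (α * (1 - α * Real.exp w / (β + α * Real.exp w))) = Real.exp w := by
      have := (hD w).ne'
      rw [show 1 - α * Real.exp w / (β + α * Real.exp w) = β / (β + α * Real.exp w) by
        field_simp; ring]
      field_simp
    rw [this, Real.log_exp]
  have hr : ∀ t ∈ Ioo (0 : ℝ) 1, α * Real.exp (Real.log (β * t / (α * (1 - t)))) /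
      (β + α * Real.exp (Real.log (β * t / (α * (1 - t))))) = t := fun t ht => by
    have h1 : 0 < 1 - t := by linarith [ht.2]
    have h0 := ht.1
    rw [Real.exp_log (by positivity)]
    field_simp
    ring
  have hcont : Continuous fun t : ℝ => ((α ^ 2 * (1 - t) + β ^ 2 * t : ℝ) : ℂ) := by fun_prop
  have hint0 : IntegrableOn (fun t : ℝ => (t : ℂ) ^ (b - 1) * (1 - (t : ℂ)) ^ (b - 1) *
        ((α ^ 2 * (1 - t) + β ^ 2 * t : ℝ) : ℂ) ^ (-(b + 1 / 2))) (Ioo 0 1) := by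
    have h1 := integrableOn_beta hb hb
    have h2 : ContinuousOn (fun t : ℝ => ((α ^ 2 * (1 - t) + β ^ 2 * t : ℝ) : ℂ) ^ (-(b + 1 / 2)))
        (Icc 0 1) := by
      refine hcont.continuousOn.cpow_const fun t ht => ?_
      refine Complex.ofReal_mem_slitPlane.2 ?_
      rcases ht.1.eq_or_lt with h | h
      · rw [← h]; simp; positivity
      · have : 0 ≤ 1 - t := by linarith [ht.2]
        positivity
    rw [← integrableOn_Icc_iff_integrableOn_Ioo] at h1 ⊢
    exact h1.mul_continuousOn h2 isCompact_Icc
  have hpt := elementary_integrand_change b hα hβ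
  have hI : Integrable h := by
    have := (integrableOn_change MeasurableSet.univ hφ' hφ hψ hl hr _).1 hint0
    simp only [hpt] at this
    rwa [integrableOn_univ] at this
  rw [setIntegral_change MeasurableSet.univ hφ' hφ hψ hl hr]
  simp only [hpt, Measure.restrict_univ]
  -- Chosen so that `(α + β)² + αβ (2 sinh(w/2))² = (α + β)² (1 + p²)` with `p = 2κ sinh(w/2)`.
  set κ := Real.sqrt (α * β) / (α + β) with hκ
  have hκ0 : 0 < κ := by positivity
  have hJ : ∫ p : ℝ, ((1 + p ^ 2 : ℝ) : ℂ) ^ (-(b + 1 / 2)) =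
      ∫ w : ℝ, ((|κ * Real.cosh (w / 2)| : ℝ) : ℂ) *
        ((1 + (2 * κ * Real.sinh (w / 2)) ^ 2 : ℝ) : ℂ) ^ (-(b + 1 / 2)) := by
    have := setIntegral_change (s := univ) (t := univ) (φ := fun w => 2 * κ * Real.sinh (w / 2))
      (φ' := fun w => κ * Real.cosh (w / 2)) (ψ := fun p => 2 * Real.arsinh (p / (2 * κ)))
      MeasurableSet.univ (fun w _ => ?_) (fun _ _ => mem_univ _) (fun _ _ => mem_univ _)
      (fun w _ => ?_) (fun p _ => ?_) (fun p : ℝ => ((1 + p ^ 2 : ℝ) : ℂ) ^ (-(b + 1 / 2)))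
    · simpa using this
    · have := (((hasDerivAt_id w).div_const 2).sinh).const_mul (2 * κ)
      convert! this using 1
      simp
      ring
    · rw [mul_div_cancel_left₀ _ (by positivity), Real.arsinh_sinh]
      ring
    · rw [mul_div_cancel_left₀ _ two_ne_zero, Real.sinh_arsinh]
      field_simp
  have h2 : ∫ w, h w = ∫ w, h (-w) := (integral_neg_eq_self h volume).symm
  have h3 : 2 * ∫ w, h w = ∫ w, (h w + h (-w)) := by
    rw [integral_add hI hI.comp_neg, ← h2]; ring
  have h4 : ∀ w, h w + h (-w) = 2 * (((α * β : ℝ) : ℂ)⁻¹ * ((α + β : ℝ) : ℂ) ^ (1 - 2 * b)) *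
      (((|κ * Real.cosh (w / 2)| : ℝ) : ℂ) *
        ((1 + (2 * κ * Real.sinh (w / 2)) ^ 2 : ℝ) : ℂ) ^ (-(b + 1 / 2))) := fun w => by
    have h5 : (α + β) ^ 2 + α * β * (2 * Real.sinh (w / 2)) ^ 2 =
        (α + β) ^ 2 * (1 + (2 * κ * Real.sinh (w / 2)) ^ 2) := by
      rw [hκ]
      have := Real.sq_sqrt hab.le
      field_simp
      linear_combination (-4 * Real.sinh (w / 2) ^ 2) * this
    have h6 : h w + h (-w) = ((α * β : ℝ) : ℂ) ^ (-(1 / 2) : ℂ) *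
        (((α + β) ^ 2 * (1 + (2 * κ * Real.sinh (w / 2)) ^ 2) : ℝ) : ℂ) ^ (-(b + 1 / 2)) *
        (2 * (((α + β) * Real.cosh (w / 2) : ℝ) : ℂ)) := by
      rw [← h5]
      simp only [hh, neg_div, Real.sinh_neg, neg_neg, mul_neg, neg_sq]
      rw [← mul_add]
      congr 1
      norm_cast
      rw [Real.cosh_eq]
      ring
    have hN : 0 < 1 + (2 * κ * Real.sinh (w / 2)) ^ 2 := by positivity
    have hc := Real.cosh_pos (w / 2)
    rw [h6, abs_of_pos (by positivity), ofReal_cpow_eq_exp hab, ofReal_cpow_eq_exp (by positivity),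
      ofReal_cpow_eq_exp (x := α + β) (by positivity), ofReal_cpow_eq_exp hN,
      ofReal_eq_exp (x := (α + β) * Real.cosh (w / 2)) (by positivity),
      ofReal_eq_exp (x := α * β) hab, ofReal_eq_exp (x := κ * Real.cosh (w / 2)) (by positivity),
      ← Complex.exp_neg]
    rw [show ∀ x y z : ℂ, x * y * (2 * z) = 2 * (x * y * z) by intros; ring,
      show ∀ x y z v : ℂ, 2 * (x * y) * (z * v) = 2 * (x * y * z * v) by intros; ring]
    simp only [← Complex.exp_add]
    rw [hκ, Real.log_mul (by positivity) hN.ne', Real.log_mul (by positivity) hc.ne',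
      Real.log_mul (by positivity) hc.ne', Real.log_div (by positivity) (by positivity),
      Real.log_sqrt hab.le, Real.log_pow]
    congr 2
    push_cast
    ring
  have h7 : (2 : ℂ) ≠ 0 := two_ne_zero
  refine mul_left_cancel₀ h7 ?_
  rw [h3, hJ]
  simp only [h4]
  rw [integral_const_mul]
  ring

/-- `∫₀¹ (t(1-t))^{b-1} (α²(1-t) + β²t)^{-b-1/2} dt`, normalized by its value at `α = β = 1`. -/
theorem integral_elementary (hb : 0 < b.re) (hα : 0 < α) (hβ : 0 < β) :
    (2 : ℂ) ^ (1 - 2 * b) * ∫ t in Ioo (0 : ℝ) 1, (t : ℂ) ^ (b - 1) * (1 - (t : ℂ)) ^ (b - 1) *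
        ((α ^ 2 * (1 - t) + β ^ 2 * t : ℝ) : ℂ) ^ (-(b + 1 / 2)) =
      ((α * β : ℝ) : ℂ)⁻¹ * ((α + β : ℝ) : ℂ) ^ (1 - 2 * b) *
        (Complex.Gamma b * Complex.Gamma b / Complex.Gamma (b + b)) := by
  -- At `α = β = 1` the left-hand integral is a beta integral, which evaluates the integral in `p`.
  have h1 := integral_elementary_eq hb one_pos one_pos
  rw [integral_elementary_eq hb hα hβ, ← integral_beta hb hb]
  norm_num at h1
  rw [h1]
  push_cast
  ring_nf

end Elementary

/-! ### Laplace's integral for the Legendre function -/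

theorem integrableOn_beta_mul_cpow {b c : ℂ} (hb : 0 < b.re) (hc : 0 < c.re) (r : ℂ) {Q : ℝ → ℝ}
    (hQ : Continuous Q) (hQ0 : ∀ s ∈ Icc (0 : ℝ) 1, 0 < Q s) :
    IntegrableOn (fun s : ℝ => (s : ℂ) ^ (b - 1) * (1 - (s : ℂ)) ^ (c - 1) * (Q s : ℂ) ^ r)
      (Ioo 0 1) := by
  have h1 := integrableOn_beta hb hc
  have h2 : ContinuousOn (fun s : ℝ => (Q s : ℂ) ^ r) (Icc 0 1) :=
    (Complex.continuous_ofReal.comp hQ).continuousOn.cpow_const fun s hs =>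
      Complex.ofReal_mem_slitPlane.2 (hQ0 s hs)
  rw [← integrableOn_Icc_iff_integrableOn_Ioo] at h1 ⊢
  exact h1.mul_continuousOn h2 isCompact_Icc

theorem one_add_sq_sub_pos {x : ℝ} (hx0 : 0 < x) (hx1 : x < 1) {s : ℝ} (hs : s ∈ Icc (0 : ℝ) 1) :
    0 < (1 + x) ^ 2 - 4 * x * s := by
  have : 0 < (1 - x) ^ 2 := by have : 0 < 1 - x := by linarith
                               positivity
  nlinarith [hs.2, mul_nonneg hx0.le (sub_nonneg.2 hs.2)]

theorem laplace_integrand_change {a b : ℂ} {x t : ℝ} (hx0 : 0 < x) (hx1 : x < 1)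
    (ht : t ∈ Ioo (0 : ℝ) 1) :
    ((|-((1 - x ^ 2 * t ^ 2) / t ^ 2)| : ℝ) : ℂ) *
      (((((1 - t) * (1 - x ^ 2 * t) / t : ℝ)) : ℂ) ^ (b + 1 / 2 - a - 1) *
        (((((1 + x * t) / √t * ((1 - x * t) / √t)) : ℝ) : ℂ)⁻¹ *
          (((1 + x * t) / √t + (1 - x * t) / √t : ℝ) : ℂ) ^ (1 - 2 * b))) =
      (2 : ℂ) ^ (1 - 2 * b) * ((t : ℂ) ^ (a - 1) * (1 - (t : ℂ)) ^ (b + 1 / 2 - a - 1) *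
        ((1 - x ^ 2 * t : ℝ) : ℂ) ^ (-(a - b + 1 / 2))) := by
  have h0 := ht.1
  have h1 : 0 < 1 - t := by linarith [ht.2]
  have hxt : x * t < 1 := by nlinarith [ht.2]
  have h2 : 0 < 1 - x * t := by linarith
  have h3 : 0 < 1 + x * t := by positivity
  have h4 : 0 < 1 - x ^ 2 * t := by nlinarith [mul_pos hx0 h0]
  have h5 : 1 - x ^ 2 * t ^ 2 = (1 - x * t) * (1 + x * t) := by ring
  have h6 : (1 + x * t) / √t + (1 - x * t) / √t = 2 / √t := by ring
  have h7 : (1 : ℂ) - (t : ℂ) = ((1 - t : ℝ) : ℂ) := by push_cast; rfl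
  rw [abs_neg, h5, abs_of_pos (by positivity), h6, h7, show (2 : ℂ) = ((2 : ℝ) : ℂ) by simp]
  rw [ofReal_cpow_eq_exp h0, ofReal_cpow_eq_exp h1, ofReal_cpow_eq_exp h4,
    ofReal_cpow_eq_exp (x := 2) two_pos, ofReal_cpow_eq_exp (x := 2 / √t) (by positivity),
    ofReal_cpow_eq_exp (x := (1 - t) * (1 - x ^ 2 * t) / t) (by positivity),
    ofReal_eq_exp (x := (1 + x * t) / √t * ((1 - x * t) / √t)) (by positivity),
    ofReal_eq_exp (x := (1 - x * t) * (1 + x * t) / t ^ 2) (by positivity), ← Complex.exp_neg]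
  simp only [← Complex.exp_add]
  have hs : √t ≠ 0 := by positivity
  rw [Real.log_div (mul_pos h2 h3).ne' (by positivity), Real.log_mul h2.ne' h3.ne',
    Real.log_div (mul_pos h1 h4).ne' (by positivity), Real.log_mul h1.ne' h4.ne',
    Real.log_mul (div_ne_zero h3.ne' hs) (div_ne_zero h2.ne' hs),
    Real.log_div h3.ne' hs, Real.log_div h2.ne' hs, Real.log_div two_ne_zero hs,
    Real.log_sqrt h0.le, Real.log_pow]
  congr 1
  push_cast
  ring

/-- With `w = (1 - t)(1 - x² t)/t` both square roots become rational up to `√t`: `√(w + (1 ± x)²) =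
(1 ± x t)/√t`. Their sum is `2/√t`, which gives the inverse substitution. -/
theorem integral_laplace_change {a b : ℂ} {x : ℝ} (hx0 : 0 < x) (hx1 : x < 1) :
    ∫ w in Ioi (0 : ℝ), (w : ℂ) ^ (b + 1 / 2 - a - 1) *
        (((√(w + (1 + x) ^ 2) * √(w + (1 - x) ^ 2) : ℝ) : ℂ)⁻¹ *
          ((√(w + (1 + x) ^ 2) + √(w + (1 - x) ^ 2) : ℝ) : ℂ) ^ (1 - 2 * b)) =
      (2 : ℂ) ^ (1 - 2 * b) * ∫ t in Ioo (0 : ℝ) 1, (t : ℂ) ^ (a - 1) *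
        (1 - (t : ℂ)) ^ (b + 1 / 2 - a - 1) * ((1 - x ^ 2 * t : ℝ) : ℂ) ^ (-(a - b + 1 / 2)) := by
  have hφ' : ∀ t ∈ Ioo (0 : ℝ) 1, HasDerivAt (fun t : ℝ => (1 - t) * (1 - x ^ 2 * t) / t)
      (-((1 - x ^ 2 * t ^ 2) / t ^ 2)) t := fun t ht => by
    have h1 := (hasDerivAt_id t).const_sub 1
    have h2 := ((hasDerivAt_id t).const_mul (x ^ 2)).const_sub 1
    have h3 := (h1.mul h2).div (hasDerivAt_id t) ht.1.ne'
    convert! h3 using 1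
    simp
    ring
  have hxt : ∀ t ∈ Ioo (0 : ℝ) 1, 0 < 1 - x * t := fun t ht => by
    nlinarith [ht.1, ht.2]
  have hα : ∀ t ∈ Ioo (0 : ℝ) 1, √((1 - t) * (1 - x ^ 2 * t) / t + (1 + x) ^ 2) =
      (1 + x * t) / √t := fun t ht => by
    have h0 := ht.1
    rw [Real.sqrt_eq_iff_eq_sq (by
      have : 0 < 1 - t := by linarith [ht.2]
      have : 0 < 1 - x ^ 2 * t := by nlinarith [mul_pos hx0 h0, ht.2]
      positivity) (by positivity), div_pow, Real.sq_sqrt h0.le]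
    field_simp
    ring
  have hβ : ∀ t ∈ Ioo (0 : ℝ) 1, √((1 - t) * (1 - x ^ 2 * t) / t + (1 - x) ^ 2) =
      (1 - x * t) / √t := fun t ht => by
    have h0 := ht.1
    rw [Real.sqrt_eq_iff_eq_sq (by
      have : 0 < 1 - t := by linarith [ht.2]
      have : 0 < 1 - x ^ 2 * t := by nlinarith [mul_pos hx0 h0, ht.2]
      positivity) (div_nonneg (hxt t ht).le (Real.sqrt_nonneg _)), div_pow, Real.sq_sqrt h0.le]
    field_simp
    ring
  have hw : ∀ w ∈ Ioi (0 : ℝ), 2 < √(w + (1 + x) ^ 2) + √(w + (1 - x) ^ 2) := fun w hw => by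
    have hw : 0 < w := hw
    have h1 : 1 + x < √(w + (1 + x) ^ 2) := Real.lt_sqrt_of_sq_lt (by linarith)
    have h2 : 1 - x < √(w + (1 - x) ^ 2) := Real.lt_sqrt_of_sq_lt (by linarith)
    linarith
  rw [setIntegral_change measurableSet_Ioo hφ' (t := Ioi 0)
    (ψ := fun w => 4 / (√(w + (1 + x) ^ 2) + √(w + (1 - x) ^ 2)) ^ 2), ← integral_const_mul]
  · refine setIntegral_congr_fun measurableSet_Ioo fun t ht => ?_
    rw [hα t ht, hβ t ht]
    exact laplace_integrand_change hx0 hx1 ht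
  · intro t ht
    have : 0 < 1 - t := by linarith [ht.2]
    have : 0 < 1 - x ^ 2 * t := by nlinarith [mul_pos hx0 ht.1, ht.1, ht.2]
    have := ht.1
    exact mem_Ioi.2 (by positivity)
  · intro w hw'
    have := hw w hw'
    refine ⟨by positivity, ?_⟩
    rw [div_lt_one (by positivity)]
    nlinarith
  · intro t ht
    rw [hα t ht, hβ t ht, ← add_div, show 1 + x * t + (1 - x * t) = 2 by ring, div_pow,
      Real.sq_sqrt ht.1.le]
    have := ht.1.ne'
    field_simp
    norm_num
  · intro w hw'
    have h2 := hw w hw'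
    have hw0 : 0 < w := hw'
    have ha := Real.sq_sqrt (show 0 ≤ w + (1 + x) ^ 2 by positivity)
    have hb := Real.sq_sqrt (show 0 ≤ w + (1 - x) ^ 2 by positivity)
    set A := √(w + (1 + x) ^ 2)
    set B := √(w + (1 - x) ^ 2)
    have h3 : 0 < A + B := by linarith
    have hx : x = (A + B) * (A - B) / 4 := by linear_combination (-1 / 4) * (ha - hb)
    have hw : w = (A ^ 2 + B ^ 2) / 2 - 1 - x ^ 2 := by linear_combination (-1 / 2) * (ha + hb)
    have h4 : (1 - 4 / (A + B) ^ 2) * (1 - x ^ 2 * (4 / (A + B) ^ 2)) / (4 / (A + B) ^ 2) =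
        (A + B) ^ 2 / 4 + 4 * x ^ 2 / (A + B) ^ 2 - 1 - x ^ 2 := by
      field_simp
      ring
    have h5 : 4 * x ^ 2 / (A + B) ^ 2 = (A - B) ^ 2 / 4 := by
      rw [hx]
      field_simp
    rw [h4, h5]
    linear_combination -hw

/-- Laplace's integral, in the form of a quadratic transformation of the hypergeometric
function. -/
theorem integral_laplace {a b : ℂ} (hb : 0 < b.re) (ha : 0 < a.re) (hab : 0 < (b + 1 / 2 - a).re)
    {x : ℝ} (hx0 : 0 < x) (hx1 : x < 1) :
    ∫ s in Ioo (0 : ℝ) 1, (s : ℂ) ^ (b - 1) * (1 - (s : ℂ)) ^ (b - 1) *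
        (((1 + x) ^ 2 - 4 * x * s : ℝ) : ℂ) ^ (-a) =
      Complex.Gamma b * Complex.Gamma b / Complex.Gamma (b + b) * Complex.Gamma (b + 1 / 2) *
        Complex.regularizedGaussHGFun (a - b + 1 / 2) a (b + 1 / 2) ((x ^ 2 : ℝ) : ℂ) := by
  set Q : ℝ → ℝ := fun s => (1 + x) ^ 2 - 4 * x * s with hQ
  have hQ0 : ∀ s ∈ Icc (0 : ℝ) 1, 0 < Q s := fun s hs => one_add_sq_sub_pos hx0 hx1 hs
  have hQc : Continuous Q := by fun_prop
  have hQ0' : ∀ s ∈ Ioo (0 : ℝ) 1, 0 < Q s := fun s hs => hQ0 s (Ioo_subset_Icc_self hs)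
  have hpq : b + 1 / 2 - a + a = b + 1 / 2 := by ring
  have hG := mellinConvergent_one_add_cpow hab ha
  have hGi := mellin_one_add_cpow hab ha
  rw [hpq] at hG hGi
  have hcomb : EqOn (fun s : ℝ => (s : ℂ) ^ (b - 1) * (1 - (s : ℂ)) ^ (b - 1) *
      (Q s : ℂ) ^ (-(b + 1 / 2)) * (((Q s)⁻¹ : ℝ) : ℂ) ^ (-(b + 1 / 2 - a)))
      (fun s : ℝ => (s : ℂ) ^ (b - 1) * (1 - (s : ℂ)) ^ (b - 1) * (Q s : ℂ) ^ (-a)) (Ioo 0 1) := by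
    intro s hs
    have := hQ0' s hs
    simp only
    rw [mul_assoc, ofReal_cpow_eq_exp this, ofReal_cpow_eq_exp (inv_pos.2 this),
      ofReal_cpow_eq_exp this, ← Complex.exp_add, Real.log_inv]
    congr 2
    push_cast
    ring
  have hint : IntegrableOn (fun s : ℝ => (s : ℂ) ^ (b - 1) * (1 - (s : ℂ)) ^ (b - 1) *
      (Q s : ℂ) ^ (-(b + 1 / 2)) * (((Q s)⁻¹ : ℝ) : ℂ) ^ (-(b + 1 / 2 - a))) (Ioo 0 1) := by
    rw [integrableOn_congr_fun hcomb measurableSet_Ioo]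
    exact integrableOn_beta_mul_cpow hb hb _ hQc hQ0
  -- Up to Gamma factors, `Q^{-a}` is `Q^{-(b+1/2)}` times the Mellin transform in `w` of `(1 +
  -- w/Q)^{-(b+1/2)}` at `b + 1/2 - a`. Interchanging the two integrations leaves an elementary
  -- inner integral.
  have key := mellin_superposition measurableSet_Ioo
    (integrableOn_beta_mul_cpow hb hb (-(b + 1 / 2)) hQc hQ0).aestronglyMeasurable
    (l := fun s => (Q s)⁻¹) (by fun_prop) (fun s hs => inv_pos.2 (hQ0' s hs)) hG
    (by fun_prop) hint
  rw [setIntegral_congr_fun measurableSet_Ioo hcomb, hGi] at key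
  -- Since `Q s = (1 + x)²(1 - s) + (1 - x)² s`, the sum `w + Q s` is of the form `α²(1 - s) + β² s`
  -- with `α`, `β` the two square roots, and `integral_elementary` applies.
  have hinner : ∀ w ∈ Ioi (0 : ℝ), (2 : ℂ) ^ (1 - 2 * b) *
      ∫ s in Ioo (0 : ℝ) 1, (s : ℂ) ^ (b - 1) * (1 - (s : ℂ)) ^ (b - 1) *
      (Q s : ℂ) ^ (-(b + 1 / 2)) * ((1 + w * (Q s)⁻¹ : ℝ) : ℂ) ^ (-(b + 1 / 2)) =
      ((√(w + (1 + x) ^ 2) * √(w + (1 - x) ^ 2) : ℝ) : ℂ)⁻¹ *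
          ((√(w + (1 + x) ^ 2) + √(w + (1 - x) ^ 2) : ℝ) : ℂ) ^ (1 - 2 * b) *
        (Complex.Gamma b * Complex.Gamma b / Complex.Gamma (b + b)) := fun w hw => by
    have hw0 : 0 < w := hw
    rw [← integral_elementary hb (by positivity) (by positivity)]
    congr 1
    refine setIntegral_congr_fun measurableSet_Ioo fun s hs => ?_
    have := hQ0' s hs
    rw [mul_assoc, ← Complex.mul_cpow_ofReal_nonneg this.le (by positivity),
      ← Complex.ofReal_mul]
    congr 3
    rw [Real.sq_sqrt (by positivity), Real.sq_sqrt (by positivity), mul_add, mul_one,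
      mul_comm w, mul_inv_cancel_left₀ this.ne', hQ]
    ring
  have hL : (2 : ℂ) ^ (1 - 2 * b) * mellin (fun w : ℝ => ∫ s in Ioo (0 : ℝ) 1,
      (s : ℂ) ^ (b - 1) * (1 - (s : ℂ)) ^ (b - 1) *
      (Q s : ℂ) ^ (-(b + 1 / 2)) * ((1 + w * (Q s)⁻¹ : ℝ) : ℂ) ^ (-(b + 1 / 2))) (b + 1 / 2 - a) =
      (Complex.Gamma b * Complex.Gamma b / Complex.Gamma (b + b)) *
      ((2 : ℂ) ^ (1 - 2 * b) * (Complex.Gamma a * Complex.Gamma (b + 1 / 2 - a) *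
        Complex.regularizedGaussHGFun (a - b + 1 / 2) a (b + 1 / 2) ((x ^ 2 : ℝ) : ℂ))) := by
    rw [← integral_euler ha hab (by positivity) (by nlinarith), ← integral_laplace_change hx0 hx1,
      mellin, ← integral_const_mul, ← integral_const_mul]
    refine setIntegral_congr_fun measurableSet_Ioi fun w hw => ?_
    simp only [smul_eq_mul]
    rw [mul_left_comm, hinner w hw]
    ring
  rw [key] at hL
  have h2 : (2 : ℂ) ^ (1 - 2 * b) ≠ 0 := fun h => two_ne_zero ((Complex.cpow_eq_zero_iff _ _).1 h).1
  have g1 := Complex.Gamma_ne_zero_of_re_pos ha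
  have g2 := Complex.Gamma_ne_zero_of_re_pos hab
  have g3 : Complex.Gamma (b + 1 / 2) ≠ 0 := Complex.Gamma_ne_zero_of_re_pos (by
    simp; positivity)
  have := mul_left_cancel₀ h2 (hL.trans (by ring :
    _ = (2 : ℂ) ^ (1 - 2 * b) * ((Complex.Gamma b * Complex.Gamma b / Complex.Gamma (b + b)) *
      (Complex.Gamma a * Complex.Gamma (b + 1 / 2 - a) *
        Complex.regularizedGaussHGFun (a - b + 1 / 2) a (b + 1 / 2) ((x ^ 2 : ℝ) : ℂ)))))
  rw [← mul_div_assoc, div_eq_iff g3] at this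
  refine mul_right_cancel₀ (mul_ne_zero g2 g1) ?_
  rw [this]
  ring

/-! ### Integral representations of the Legendre function -/

section Representation

variable {a b : ℂ} {R : ℝ}

theorem one_sub_inv_sq_mem (hR : 1 < R) : 0 ≤ 1 - (R ^ 2)⁻¹ ∧ 1 - (R ^ 2)⁻¹ < 1 := by
  have h : (R ^ 2)⁻¹ < 1 := inv_lt_one_of_one_lt₀ (by nlinarith)
  have h' : 0 < (R ^ 2)⁻¹ := by positivity
  constructor <;> linarith

theorem one_sub_mul_pos (hR : 1 < R) {s : ℝ} (hs : s ∈ Icc (0 : ℝ) 1) :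
    0 < 1 - (1 - (R ^ 2)⁻¹) * s := by
  obtain ⟨h1, h2⟩ := one_sub_inv_sq_mem hR
  nlinarith [hs.1, hs.2]

theorem segment_pos (hR : 1 < R) {s : ℝ} (hs : s ∈ Icc (0 : ℝ) 1) :
    0 < R * (1 - s) + R⁻¹ * s := by
  have h := one_sub_mul_pos hR hs
  have h0 : 0 < R := by linarith
  have : R * (1 - s) + R⁻¹ * s = R * (1 - (1 - (R ^ 2)⁻¹) * s) := by field_simp; ring
  rw [this]; positivity

theorem integral_segment_cpow (hb : 0 < b.re) (hR : 1 < R) :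
    ∫ s in Ioo (0 : ℝ) 1, (s : ℂ) ^ (b - 1) * (1 - (s : ℂ)) ^ (b - 1) *
        ((R * (1 - s) + R⁻¹ * s : ℝ) : ℂ) ^ (-a) =
      (R : ℂ) ^ (-a) * (Complex.Gamma b * Complex.Gamma b *
        Complex.regularizedGaussHGFun a b (b + b) ((1 - (R ^ 2)⁻¹ : ℝ) : ℂ)) := by
  have h0 : 0 < R := by linarith
  obtain ⟨h1, h2⟩ := one_sub_inv_sq_mem hR
  have := integral_euler (a := a) (b := b) (c := b + b) hb (by simpa using hb) h1 h2
  simp only [add_sub_cancel_right] at this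
  rw [← this, ← integral_const_mul]
  refine setIntegral_congr_fun measurableSet_Ioo fun s hs => ?_
  have h3 := one_sub_mul_pos hR (Ioo_subset_Icc_self hs)
  have h4 : R * (1 - s) + R⁻¹ * s = R * (1 - (1 - (R ^ 2)⁻¹) * s) := by field_simp; ring
  rw [h4, Complex.ofReal_mul, Complex.mul_cpow_ofReal_nonneg h0.le h3.le]
  ring

/-- The substitution `X = R⁻¹ t/(1 - t)` turns `(X + R)(X + R⁻¹)` into `(1 - (1 - R⁻²) t)/(1 - t)²`,
which leads to Euler's integral. -/
theorem mellin_quadratic_cpow (ha : 0 < a.re) (hab : 0 < (b + b - a).re) (hR : 1 < R) :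
    MellinConvergent (fun X : ℝ => (((X + R) * (X + R⁻¹) : ℝ) : ℂ) ^ (-b)) a ∧
    mellin (fun X : ℝ => (((X + R) * (X + R⁻¹) : ℝ) : ℂ) ^ (-b)) a =
      (R : ℂ) ^ (-a) * (Complex.Gamma a * Complex.Gamma (b + b - a) *
        Complex.regularizedGaussHGFun b a (b + b) ((1 - (R ^ 2)⁻¹ : ℝ) : ℂ)) := by
  have h0 : 0 < R := by linarith
  have hφ' : ∀ t ∈ Ioo (0 : ℝ) 1,
      HasDerivAt (fun t : ℝ => R⁻¹ * (t / (1 - t))) (R⁻¹ * (1 / (1 - t) ^ 2)) t := fun t ht => by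
    have h1 : (1 - t) ≠ 0 := by linarith [ht.2]
    refine HasDerivAt.const_mul _ ?_
    convert! (hasDerivAt_id t).div ((hasDerivAt_id t).const_sub 1) h1 using 1
    simp
  have hφ : MapsTo (fun t : ℝ => R⁻¹ * (t / (1 - t))) (Ioo 0 1) (Ioi 0) := fun t ht =>
    mul_pos (by positivity) (div_pos ht.1 (by linarith [ht.2]))
  have hψ : MapsTo (fun w : ℝ => R * w / (1 + R * w)) (Ioi 0) (Ioo 0 1) := fun w (hw : 0 < w) =>
    ⟨by positivity, by rw [div_lt_one (by positivity)]; linarith⟩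
  have hl : ∀ t ∈ Ioo (0 : ℝ) 1,
      R * (R⁻¹ * (t / (1 - t))) / (1 + R * (R⁻¹ * (t / (1 - t)))) = t := fun t ht => by
    have h1 : (1 - t) ≠ 0 := by linarith [ht.2]
    field_simp
    ring
  have hr : ∀ w ∈ Ioi (0 : ℝ), R⁻¹ * (R * w / (1 + R * w) / (1 - R * w / (1 + R * w))) = w :=
    fun w (hw : 0 < w) => by
    have h1 : (1 + R * w) ≠ 0 := by positivity
    field_simp
    ring
  have key : EqOn (fun t : ℝ => ((|R⁻¹ * (1 / (1 - t) ^ 2)| : ℝ) : ℂ) *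
      (((R⁻¹ * (t / (1 - t)) : ℝ) : ℂ) ^ (a - 1) •
        (((R⁻¹ * (t / (1 - t)) + R) * (R⁻¹ * (t / (1 - t)) + R⁻¹) : ℝ) : ℂ) ^ (-b)))
      (fun t : ℝ => (R : ℂ) ^ (-a) * ((t : ℂ) ^ (a - 1) * (1 - (t : ℂ)) ^ (b + b - a - 1) *
        ((1 - (1 - (R ^ 2)⁻¹) * t : ℝ) : ℂ) ^ (-b))) (Ioo 0 1) := fun t ht => by
    have h1 : 0 < 1 - t := by linarith [ht.2]
    have ht0 := ht.1
    have h2 := one_sub_mul_pos hR (Ioo_subset_Icc_self ht)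
    have h3 : (R⁻¹ * (t / (1 - t)) + R) * (R⁻¹ * (t / (1 - t)) + R⁻¹) =
        (1 - (1 - (R ^ 2)⁻¹) * t) / (1 - t) ^ 2 := by
      field_simp
      ring
    simp only [smul_eq_mul]
    rw [h3, abs_of_pos (by positivity), show (1 : ℂ) - (t : ℂ) = ((1 - t : ℝ) : ℂ) by simp,
      ofReal_cpow_eq_exp h0, ofReal_cpow_eq_exp ht0, ofReal_cpow_eq_exp h1,
      ofReal_cpow_eq_exp h2, ofReal_cpow_eq_exp (x := R⁻¹ * (t / (1 - t))) (by positivity),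
      ofReal_cpow_eq_exp (x := (1 - (1 - (R ^ 2)⁻¹) * t) / (1 - t) ^ 2) (by positivity),
      ofReal_eq_exp (x := R⁻¹ * (1 / (1 - t) ^ 2)) (by positivity)]
    simp only [← Complex.exp_add]
    rw [Real.log_mul (by positivity) (by positivity), Real.log_mul (by positivity) (by positivity),
      Real.log_div (by positivity) (by positivity), Real.log_div (by positivity) (by positivity),
      Real.log_div h2.ne' (by positivity), Real.log_inv, Real.log_pow, Real.log_one]
    congr 1
    push_cast
    ring
  obtain ⟨h1, h2⟩ := one_sub_inv_sq_mem hR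
  constructor
  · rw [MellinConvergent, integrableOn_change measurableSet_Ioo hφ' hφ hψ hl hr,
      integrableOn_congr_fun key measurableSet_Ioo]
    exact (integrableOn_beta_mul_cpow ha hab (-b) (Q := fun t => 1 - (1 - (R ^ 2)⁻¹) * t)
      (by fun_prop) fun s hs => one_sub_mul_pos hR hs).const_mul _
  · rw [mellin, setIntegral_change measurableSet_Ioo hφ' hφ hψ hl hr,
      setIntegral_congr_fun measurableSet_Ioo key, integral_const_mul, integral_euler ha hab h1 h2]

/-- Both sides are the same `₂F₁` at `1 - R⁻²`, with the upper parameters `a` and `b` interchanged.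
This lets one of the two Legendre factors be read as a Mellin transform. -/
theorem integral_segment_cpow_eq_mellin (hb : 0 < b.re) (ha : 0 < a.re)
    (hab : 0 < (b + b - a).re) (hR : 1 < R) :
    Complex.Gamma a * Complex.Gamma (b + b - a) *
      ∫ s in Ioo (0 : ℝ) 1, (s : ℂ) ^ (b - 1) * (1 - (s : ℂ)) ^ (b - 1) *
        ((R * (1 - s) + R⁻¹ * s : ℝ) : ℂ) ^ (-a) =
      Complex.Gamma b * Complex.Gamma b *
        mellin (fun X : ℝ => (((X + R) * (X + R⁻¹) : ℝ) : ℂ) ^ (-b)) a := by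
  rw [integral_segment_cpow hb hR, (mellin_quadratic_cpow ha hab hR).2,
    Complex.regularizedGaussHGFun_symm (a := a)]
  ring

/-- A Möbius change of variables. -/
theorem integral_quadratic_segment (hR : 1 < R) {X : ℝ} (hX : 0 < X) :
    ∫ t in Ioo (0 : ℝ) 1, (t : ℂ) ^ (b - 1) * (1 - (t : ℂ)) ^ (b - 1) *
        (((X * (R * (1 - t) + R⁻¹ * t) + R) * (X * (R * (1 - t) + R⁻¹ * t) + R⁻¹) : ℝ) : ℂ) ^ (-b) =
      ∫ s in Ioo (0 : ℝ) 1, (s : ℂ) ^ (b - 1) * (1 - (s : ℂ)) ^ (b - 1) *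
        (((X + 1) ^ 2 + X * (R - R⁻¹) ^ 2 * (1 - s) : ℝ) : ℂ) ^ (-b) := by
  have h0 : 0 < R := by linarith
  have hRi : R * R⁻¹ = 1 := mul_inv_cancel₀ h0.ne'
  have hRi0 : 0 < R⁻¹ := by positivity
  -- `P` and `P'` are the values at `t = 0` and `t = 1` of the linear factor `X (R(1 - t) + R⁻¹ t) +
  -- R`, which becomes the denominator of the Möbius map fixing `0` and `1`.
  set P := R * (X + 1) with hP
  set P' := X * R⁻¹ + R with hP'
  have hP0 : 0 < P := by positivity
  have hP'0 : 0 < P' := by positivity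
  have hden : ∀ t ∈ Ioo (0 : ℝ) 1, 0 < P * (1 - t) + P' * t := fun t ht => by
    have h1 : 0 < 1 - t := by linarith [ht.2]
    have := ht.1
    positivity
  have hden' : ∀ t ∈ Ioo (0 : ℝ) 1, 0 < P' * (1 - t) + P * t := fun t ht => by
    have h1 : 0 < 1 - t := by linarith [ht.2]
    have := ht.1
    positivity
  rw [setIntegral_change (s := Ioo 0 1) (t := Ioo 0 1)
    (φ := fun t => P' * t / (P * (1 - t) + P' * t))
    (φ' := fun t => P * P' / (P * (1 - t) + P' * t) ^ 2)
    (ψ := fun t => P * t / (P' * (1 - t) + P * t)) measurableSet_Ioo (fun t ht => ?_)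
    (fun t ht => ?_) (fun t ht => ?_) (fun t ht => ?_) (fun t ht => ?_)
    (fun s : ℝ => (s : ℂ) ^ (b - 1) * (1 - (s : ℂ)) ^ (b - 1) *
        (((X + 1) ^ 2 + X * (R - R⁻¹) ^ 2 * (1 - s) : ℝ) : ℂ) ^ (-b))]
  · refine setIntegral_congr_fun measurableSet_Ioo fun t ht => ?_
    have h1 : 0 < 1 - t := by linarith [ht.2]
    have ht0 := ht.1
    have hD := hden t ht
    have e1 : X * (R * (1 - t) + R⁻¹ * t) + R = P * (1 - t) + P' * t := by rw [hP, hP']; ring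
    set D := P * (1 - t) + P' * t with hDdef
    set E := X * (R * (1 - t) + R⁻¹ * t) + R⁻¹ with hE
    have hE0 : 0 < E := by positivity
    have e2 : (X + 1) ^ 2 + X * (R - R⁻¹) ^ 2 * (1 - P' * t / D) = P * P' * E / D := by
      field_simp
      rw [hDdef, hE, hP, hP']
      field_simp
      ring
    have e3 : (1 : ℂ) - ((P' * t / D : ℝ) : ℂ) = ((P * (1 - t) / D : ℝ) : ℂ) := by
      rw [← Complex.ofReal_one, ← Complex.ofReal_sub]
      congr 1
      field_simp
      rw [hDdef]; ring
    rw [e1, e2, e3, abs_of_pos (by positivity),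
      show (1 : ℂ) - (t : ℂ) = ((1 - t : ℝ) : ℂ) by simp, ofReal_cpow_eq_exp ht0,
      ofReal_cpow_eq_exp h1, ofReal_cpow_eq_exp (x := D * E) (by positivity),
      ofReal_cpow_eq_exp (x := P' * t / D) (by positivity),
      ofReal_cpow_eq_exp (x := P * (1 - t) / D) (by positivity),
      ofReal_cpow_eq_exp (x := P * P' * E / D) (by positivity),
      ofReal_eq_exp (x := P * P' / D ^ 2) (by positivity)]
    simp only [← Complex.exp_add]
    rw [Real.log_mul hD.ne' hE0.ne', Real.log_div (by positivity) (by positivity),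
      Real.log_div (by positivity) (by positivity), Real.log_div (by positivity) (by positivity),
      Real.log_div (by positivity) (by positivity), Real.log_mul (by positivity) hE0.ne',
      Real.log_mul hP0.ne' hP'0.ne', Real.log_mul hP'0.ne' ht0.ne', Real.log_mul hP0.ne' h1.ne',
      Real.log_pow]
    congr 1
    push_cast
    ring
  · have h1 := (hasDerivAt_id t).const_mul P'
    have h2 := (((hasDerivAt_id t).const_sub 1).const_mul P).add h1
    convert! h1.div h2 (hden t ht).ne' using 1
    simp
    ring
  · have h1 : 0 < 1 - t := by linarith [ht.2]
    have ht0 := ht.1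
    refine ⟨div_pos (by positivity) (hden t ht), ?_⟩
    rw [div_lt_one (hden t ht)]
    nlinarith [mul_pos hP0 h1]
  · have h1 : 0 < 1 - t := by linarith [ht.2]
    have ht0 := ht.1
    refine ⟨div_pos (by positivity) (hden' t ht), ?_⟩
    rw [div_lt_one (hden' t ht)]
    nlinarith [mul_pos hP'0 h1]
  · have hD := hden t ht
    have e3 : 1 - P' * t / (P * (1 - t) + P' * t) = P * (1 - t) / (P * (1 - t) + P' * t) := by
      field_simp; ring
    rw [e3]
    field_simp
    ring
  · have hD := hden' t ht
    have e3 : 1 - P * t / (P' * (1 - t) + P * t) = P' * (1 - t) / (P' * (1 - t) + P * t) := by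
      field_simp; ring
    rw [e3]
    field_simp
    ring

theorem beta_mul_Gamma_add_half (hb : 0 < b.re) :
    Complex.Gamma b * Complex.Gamma b / Complex.Gamma (b + b) * Complex.Gamma (b + 1 / 2) =
      Complex.Gamma b * (2 : ℂ) ^ (1 - 2 * b) * (Real.sqrt Real.pi : ℂ) := by
  have h := Complex.Gamma_mul_Gamma_add_half b
  have g : Complex.Gamma (2 * b) ≠ 0 := Complex.Gamma_ne_zero_of_re_pos (by simpa using hb)
  rw [← two_mul, div_mul_eq_mul_div, div_eq_iff g, mul_assoc, h]
  ring

/-- With `z = (R + R⁻¹)/2` and `x = (R - 1)/(R + 1)`, the Pfaff variable is `x² = (z - 1)/(z + 1)`,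
and `(1 + x)² - 4xs` is `1 - x²` times `R(1 - s) + R⁻¹ s`. So this is `integral_laplace` with `b =
1/2 - μ` and `a = b - iτ`. -/
theorem legendreP_eq_integral {μ : ℂ} (hμ : μ.re < 1 / 2) (τ : ℝ) (hR : 1 < R) :
    legendreP μ (-1 / 2 + Complex.I * τ) ((R + R⁻¹) / 2) *
      (Complex.Gamma (1 / 2 - μ) * (2 : ℂ) ^ (2 * μ) * (Real.sqrt Real.pi : ℂ)) =
    (((R - R⁻¹) / 4 : ℝ) : ℂ) ^ (-μ) *
      ∫ s in Ioo (0 : ℝ) 1, (s : ℂ) ^ ((1 / 2 - μ) - 1) * (1 - (s : ℂ)) ^ ((1 / 2 - μ) - 1) *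
        ((R * (1 - s) + R⁻¹ * s : ℝ) : ℂ) ^ (-(1 / 2 - μ - Complex.I * τ)) := by
  have h0 : 0 < R := by linarith
  set b := 1 / 2 - μ with hb'
  have hb : 0 < b.re := by rw [hb']; simp; linarith
  set x := (R - 1) / (R + 1) with hx
  have hR1 : 0 < R - 1 := by linarith
  have hx0 : 0 < x := div_pos hR1 (by linarith)
  have hx1 : x < 1 := by rw [hx, div_lt_one (by linarith)]; linarith
  have hc := beta_mul_Gamma_add_half hb
  rw [show 1 - 2 * b = 2 * μ by rw [hb']; ring] at hc
  have hL := integral_laplace (a := b - Complex.I * τ) hb (by simpa using hb) (by simp) hx0 hx1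
  have hRR : 0 < R - R⁻¹ := by have := inv_lt_one_of_one_lt₀ hR; linarith
  have e1 : ((R + R⁻¹) / 2 + 1) / ((R + R⁻¹) / 2 - 1) = (x ^ 2)⁻¹ := by
    have h3 : R + R⁻¹ - 2 ≠ 0 := by
      rw [show R + R⁻¹ - 2 = (R - 1) ^ 2 / R by field_simp; ring]; positivity
    rw [hx, div_pow, inv_div, div_eq_div_iff (by intro h; apply h3; linarith) (by positivity)]
    field_simp
    ring
  have e2 : (1 : ℂ) - (((1 - (R + R⁻¹) / 2) / 2 : ℝ) : ℂ) = ((1 / (1 - x ^ 2) : ℝ) : ℂ) := by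
    rw [← Complex.ofReal_one, ← Complex.ofReal_sub]
    congr 1
    rw [hx, show 1 - ((R - 1) / (R + 1)) ^ 2 = 4 * R / (R + 1) ^ 2 by field_simp; ring]
    field_simp
    ring
  have e3 : (((1 - (R + R⁻¹) / 2) / 2 : ℝ) : ℂ) / ((((1 - (R + R⁻¹) / 2) / 2 : ℝ) : ℂ) - 1) =
      ((x ^ 2 : ℝ) : ℂ) := by
    rw [← Complex.ofReal_one, ← Complex.ofReal_sub, ← Complex.ofReal_div]
    congr 1
    have : (1 - (R + R⁻¹) / 2) / 2 - 1 = - ((R + 1) ^ 2 / (4 * R)) := by field_simp; ring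
    rw [this, hx]
    field_simp
    ring
  have hx2 : 0 < 1 - x ^ 2 := by nlinarith
  rw [legendreP, regularizedGauss, e1, e2, e3, show -(-1 / 2 + Complex.I * τ) = b - Complex.I * τ - b + 1 / 2 by ring,
    show (1 : ℂ) - μ - (-1 / 2 + Complex.I * τ + 1) = b - Complex.I * τ by rw [hb']; ring,
    show (1 : ℂ) - μ = b + 1 / 2 by rw [hb']; ring, ← hc, mul_assoc,
    mul_assoc _ (Complex.regularizedGaussHGFun _ _ _ _), mul_comm (Complex.regularizedGaussHGFun _ _ _ _),
    ← hL, ← integral_const_mul, ← integral_const_mul, ← integral_const_mul]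
  refine setIntegral_congr_fun measurableSet_Ioo fun s hs => ?_
  have hl := segment_pos hR (Ioo_subset_Icc_self hs)
  have e4 : (1 + x) ^ 2 - 4 * x * s = (1 - x ^ 2) * (R * (1 - s) + R⁻¹ * s) := by
    rw [hx]; field_simp; ring
  have e5 : (R - R⁻¹) / 4 = x / (1 - x ^ 2) := by
    rw [hx, show 1 - ((R - 1) / (R + 1)) ^ 2 = 4 * R / (R + 1) ^ 2 by field_simp; ring]
    field_simp
    ring
  rw [e4, e5, ofReal_cpow_eq_exp hl, ofReal_cpow_eq_exp (x := (1 - x ^ 2) * _) (by positivity),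
    ofReal_cpow_eq_exp (x := x / (1 - x ^ 2)) (by positivity),
    ofReal_cpow_eq_exp (x := (x ^ 2)⁻¹) (by positivity),
    ofReal_cpow_eq_exp (x := 1 / (1 - x ^ 2)) (by positivity)]
  conv_lhs => rw [show ∀ p q r u v : ℂ, p * (q * (r * u * v)) = r * u * (p * q * v) by
    intros; ring]
  conv_rhs => rw [show ∀ p r u v : ℂ, p * (r * u * v) = r * u * (p * v) by intros; ring]
  simp only [← Complex.exp_add]
  rw [Real.log_mul hx2.ne' hl.ne', Real.log_div hx0.ne' hx2.ne', Real.log_div one_ne_zero hx2.ne',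
    Real.log_inv, Real.log_pow, Real.log_one]
  congr 2
  push_cast
  rw [hb']
  ring

end Representation

/-! ### The kernel as a Fourier integral of a Legendre function of the second kind -/

/-- The kernel `√π Γ(1/2 + iτ - μ) Γ(1/2 - iτ - μ) [P^μ_{-1/2+iτ}(√((1+y)/y))]²`. -/
def kernel (μ : ℂ) (τ y : ℝ) : ℂ :=
  (Real.sqrt Real.pi : ℂ) * Complex.Gamma (1 / 2 + Complex.I * τ - μ) *
    Complex.Gamma (1 / 2 - Complex.I * τ - μ) * legendreSq μ τ y

/-- `Y^{1/2} ∫₀¹ (s(1-s))^{b-1} (Y + 1 - s)^{-b} ds`. -/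
def legendreQ (b : ℂ) (Y : ℝ) : ℂ :=
  (Y : ℂ) ^ (1 / 2 : ℂ) * ∫ s in Ioo (0 : ℝ) 1, (s : ℂ) ^ (b - 1) * (1 - (s : ℂ)) ^ (b - 1) *
    ((Y + (1 - s) : ℝ) : ℂ) ^ (-b)

theorem integral_quadratic_eq_legendreQ (b : ℂ) {X Δ : ℝ} (hX : 0 < X) (hΔ : 0 < Δ) :
    ∫ s in Ioo (0 : ℝ) 1, (s : ℂ) ^ (b - 1) * (1 - (s : ℂ)) ^ (b - 1) *
        (((X + 1) ^ 2 + X * Δ ^ 2 * (1 - s) : ℝ) : ℂ) ^ (-b) =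
      (X : ℂ) ^ (1 / 2 - b) * (Δ : ℂ) ^ (1 - 2 * b) * ((1 + X : ℝ) : ℂ)⁻¹ *
        legendreQ b ((1 + X) ^ 2 / (X * Δ ^ 2)) := by
  rw [legendreQ, ← mul_assoc, ← integral_const_mul]
  refine setIntegral_congr_fun measurableSet_Ioo fun s hs => ?_
  have h1 : 0 < 1 - s := by linarith [hs.2]
  have h2 : (X + 1) ^ 2 + X * Δ ^ 2 * (1 - s) =
      X * Δ ^ 2 * ((1 + X) ^ 2 / (X * Δ ^ 2) + (1 - s)) := by
    field_simp
    ring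
  rw [h2, Complex.ofReal_mul, Complex.mul_cpow_ofReal_nonneg (by positivity) (by positivity),
    ofReal_cpow_eq_exp (x := X * Δ ^ 2) (by positivity), ofReal_cpow_eq_exp hX,
    ofReal_cpow_eq_exp hΔ, ofReal_cpow_eq_exp (x := (1 + X) ^ 2 / (X * Δ ^ 2)) (by positivity),
    ofReal_eq_exp (x := 1 + X) (by positivity), ← Complex.exp_neg]
  simp only [← Complex.exp_add]
  rw [show ∀ p q r : ℂ, p * (q * r) = q * (p * r) by intros; ring]
  congr 3
  rw [Real.log_div (by positivity) (by positivity), Real.log_mul (by positivity) (by positivity),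
    Real.log_pow, Real.log_pow]
  push_cast
  ring

/-- One Legendre factor is kept as the segment integral `A`; the other absorbs the two Gamma factors
and becomes the Mellin transform `M`. Then `A * M` is the Mellin transform of a superposition, whose
inner integral is `legendreQ`. Putting `X = e^u` shows a Fourier integral in `τ`. -/
theorem kernel_eq_integral {μ : ℂ} (hμ : μ.re < 1 / 2) (τ : ℝ) {y : ℝ} (hy : 0 < y) :
    kernel μ τ y = (Real.sqrt Real.pi : ℂ)⁻¹ *
      ∫ X in Ioi (0 : ℝ), (X : ℂ) ^ (-(Complex.I * τ) - 1 / 2) * ((1 + X : ℝ) : ℂ)⁻¹ *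
        legendreQ (1 / 2 - μ) (y * (1 + X) ^ 2 / (4 * X)) := by
  set b := 1 / 2 - μ with hb'
  have hb : 0 < b.re := by rw [hb']; simp; linarith
  set a := b - Complex.I * τ with ha'
  have ha : 0 < a.re := by rw [ha']; simpa using hb
  have hab : 0 < (b + b - a).re := by rw [ha']; simpa using hb
  set z := Real.sqrt ((1 + y) / y) with hz
  set v := Real.sqrt (1 / y) with hv
  have hv0 : 0 < v := by positivity
  have hz2 : z ^ 2 = 1 + v ^ 2 := by
    rw [hz, hv, Real.sq_sqrt (by positivity), Real.sq_sqrt (by positivity)]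
    field_simp
    ring
  have hv2 : v ^ 2 = 1 / y := Real.sq_sqrt (by positivity)
  have hz1 : 1 < z := by
    have : 0 ≤ z := Real.sqrt_nonneg _
    nlinarith [sq_nonneg v, pow_pos hv0 2]
  -- Here `z² - v² = 1`, so `R⁻¹ = z - v`; hence `z = (R + R⁻¹)/2` and `R - R⁻¹ = 2v = 2/√y`.
  set R := z + v with hR'
  have hR : 1 < R := by linarith
  have hRi : R⁻¹ = z - v := by
    refine inv_eq_of_mul_eq_one_right ?_
    rw [hR']; linear_combination hz2
  have hzR : z = (R + R⁻¹) / 2 := by rw [hRi, hR']; ring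
  have hΔ : R - R⁻¹ = 2 * v := by rw [hRi, hR']; ring
  have hP := legendreP_eq_integral hμ τ hR
  rw [← hzR] at hP
  have hM := integral_segment_cpow_eq_mellin hb ha hab hR
  set P := legendreP μ (-1 / 2 + Complex.I * τ) z with hPdef
  set A := ∫ s in Ioo (0 : ℝ) 1, (s : ℂ) ^ (b - 1) * (1 - (s : ℂ)) ^ (b - 1) *
        ((R * (1 - s) + R⁻¹ * s : ℝ) : ℂ) ^ (-a) with hA
  have hS := mellin_superposition measurableSet_Ioo (integrableOn_beta hb hb).aestronglyMeasurable
    (l := fun s => R * (1 - s) + R⁻¹ * s) (a := a) (by fun_prop)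
    (fun s hs => segment_pos hR (Ioo_subset_Icc_self hs)) (mellin_quadratic_cpow ha hab hR).1
    (by fun_prop) (integrableOn_beta_mul_cpow hb hb (-a) (by fun_prop)
      (fun s hs => segment_pos hR hs))
  rw [← hA] at hS
  set M := mellin (fun X : ℝ => (((X + R) * (X + R⁻¹) : ℝ) : ℂ) ^ (-b)) a with hMdef
  set J := ∫ X in Ioi (0 : ℝ), (X : ℂ) ^ (-(Complex.I * τ) - 1 / 2) * ((1 + X : ℝ) : ℂ)⁻¹ *
        legendreQ b (y * (1 + X) ^ 2 / (4 * X)) with hJ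
  have hS' : A * M = ((2 * v : ℝ) : ℂ) ^ (1 - 2 * b) * J := by
    rw [← hS, mellin, hJ, ← integral_const_mul]
    refine setIntegral_congr_fun measurableSet_Ioi fun X (hX : 0 < X) => ?_
    simp only [smul_eq_mul]
    rw [integral_quadratic_segment hR hX, hΔ, integral_quadratic_eq_legendreQ b hX (by positivity),
      show (1 + X) ^ 2 / (X * (2 * v) ^ 2) = y * (1 + X) ^ 2 / (4 * X) by
        rw [mul_pow, hv2]; field_simp; ring]
    rw [show -(Complex.I * τ) - 1 / 2 = (a - 1) + (1 / 2 - b) by rw [ha']; ring,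
      Complex.cpow_add _ _ (by exact_mod_cast hX.ne')]
    ring
  have hΔ' : ((R - R⁻¹) / 4 : ℝ) = v / 2 := by rw [hΔ]; ring
  rw [hΔ'] at hP
  have hpi : (Real.sqrt Real.pi : ℂ) ≠ 0 := by
    exact_mod_cast (Real.sqrt_pos.2 Real.pi_pos).ne'
  have hg : Complex.Gamma b ≠ 0 := Complex.Gamma_ne_zero_of_re_pos hb
  have h2 : (2 : ℂ) ^ (2 * μ) ≠ 0 := fun h => two_ne_zero ((Complex.cpow_eq_zero_iff _ _).1 h).1
  have hvv : (((v / 2 : ℝ) : ℂ) ^ (-μ)) ^ 2 * ((2 * v : ℝ) : ℂ) ^ (1 - 2 * b) =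
      ((2 : ℂ) ^ (2 * μ)) ^ 2 := by
    rw [show (2 : ℂ) = ((2 : ℝ) : ℂ) by simp, ofReal_cpow_eq_exp (x := v / 2) (by positivity),
      ofReal_cpow_eq_exp (x := 2 * v) (by positivity), ofReal_cpow_eq_exp (x := 2) (by positivity),
      ← Complex.exp_nat_mul, ← Complex.exp_nat_mul, ← Complex.exp_add,
      Real.log_div hv0.ne' two_ne_zero, Real.log_mul two_ne_zero hv0.ne']
    congr 1
    push_cast
    rw [hb']
    ring
  have e1 : (1 / 2 + Complex.I * τ - μ) = b + b - a := by rw [ha', hb']; ring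
  have e2 : (1 / 2 - Complex.I * τ - μ) = a := by rw [ha', hb']; ring
  rw [kernel, legendreSq, ← hPdef, e1, e2]
  have hfin : (Complex.Gamma a * Complex.Gamma (b + b - a) * P ^ 2) *
      (Complex.Gamma b * 2 ^ (2 * μ) * (Real.sqrt Real.pi : ℂ)) ^ 2 =
      (Complex.Gamma b * 2 ^ (2 * μ)) ^ 2 * J := by
    calc _ = Complex.Gamma a * Complex.Gamma (b + b - a) *
        (P * (Complex.Gamma b * 2 ^ (2 * μ) * (Real.sqrt Real.pi : ℂ))) ^ 2 := by ring
      _ = (((v / 2 : ℝ) : ℂ) ^ (-μ)) ^ 2 * A *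
          (Complex.Gamma a * Complex.Gamma (b + b - a) * A) := by rw [hP]; ring
      _ = (((v / 2 : ℝ) : ℂ) ^ (-μ)) ^ 2 * Complex.Gamma b ^ 2 * (A * M) := by rw [hM]; ring
      _ = Complex.Gamma b ^ 2 * J * ((((v / 2 : ℝ) : ℂ) ^ (-μ)) ^ 2 *
          ((2 * v : ℝ) : ℂ) ^ (1 - 2 * b)) := by rw [hS']; ring
      _ = _ := by rw [hvv]; ring
  have hne : (Complex.Gamma b * 2 ^ (2 * μ)) ^ 2 * (Real.sqrt Real.pi : ℂ) ≠ 0 := by positivity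
  refine mul_right_cancel₀ hne ?_
  have : (Real.sqrt Real.pi : ℂ) * Complex.Gamma (b + b - a) * Complex.Gamma a * P ^ 2 *
      ((Complex.Gamma b * 2 ^ (2 * μ)) ^ 2 * (Real.sqrt Real.pi : ℂ)) =
      (Complex.Gamma a * Complex.Gamma (b + b - a) * P ^ 2) *
      (Complex.Gamma b * 2 ^ (2 * μ) * (Real.sqrt Real.pi : ℂ)) ^ 2 := by ring
  rw [this, hfin]
  field_simp

/-! ### The Mellin–Barnes representation of the kernel -/

/-- Taking `1 - u` out of `Y + (1 - u)` exhibits dilates of `(1 + w)^{-b}`. The weight `(1 -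
u)^{-1}` becomes integrable only together with the factor `(1 - u)^{s + 1/2}` that the Mellin
transform supplies. -/
theorem legendreQ_eq_superposition (b : ℂ) {Y : ℝ} (hY : 0 < Y) :
    legendreQ b Y = (Y : ℂ) ^ (1 / 2 : ℂ) • ∫ u in Ioo (0 : ℝ) 1,
      ((u : ℂ) ^ (b - 1) * (1 - (u : ℂ)) ^ (-1 : ℂ)) * ((1 + Y * (1 - u)⁻¹ : ℝ) : ℂ) ^ (-b) := by
  rw [legendreQ, smul_eq_mul]
  congr 1
  refine setIntegral_congr_fun measurableSet_Ioo fun u hu => ?_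
  have h1 : 0 < 1 - u := by linarith [hu.2]
  have h2 : Y + (1 - u) = (1 - u) * (1 + Y * (1 - u)⁻¹) := by field_simp; ring
  have h3 : 0 < 1 + Y * (1 - u)⁻¹ := by positivity
  rw [h2, Complex.ofReal_mul, Complex.mul_cpow_ofReal_nonneg h1.le h3.le,
    show (1 : ℂ) - (u : ℂ) = ((1 - u : ℝ) : ℂ) by simp, ← mul_assoc, mul_assoc _ _ (((1 - u : ℝ) : ℂ) ^ (-b)),
    ← Complex.cpow_add _ _ (by exact_mod_cast h1.ne')]
  congr 3
  ring

/-- The `w`-integral is `Γ(s + 1/2) Γ(-μ - s)/Γ(b)` and the `u`-integral is `Γ(b) Γ(s + 1/2)/Γ(1 + s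
- μ)`. The strip is where both beta integrals converge. -/
theorem mellin_legendreQ {μ s : ℂ} (hs : -1 / 2 < s.re)
    (hs' : s.re < -μ.re) :
    MellinConvergent (legendreQ (1 / 2 - μ)) s ∧
      mellin (legendreQ (1 / 2 - μ)) s = boundIntegrand μ s := by
  set b := 1 / 2 - μ with hb'
  have hb : 0 < b.re := by rw [hb']; simp; linarith
  have hp : 0 < (s + 1 / 2).re := by simp; linarith
  have hq : 0 < (-μ - s).re := by simp; linarith
  have hpq : s + 1 / 2 + (-μ - s) = b := by rw [hb']; ring
  have hG := mellinConvergent_one_add_cpow hp hq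
  have hGi := mellin_one_add_cpow hp hq
  rw [hpq] at hG hGi
  have hm : AEStronglyMeasurable (fun u : ℝ => (u : ℂ) ^ (b - 1) * (1 - (u : ℂ)) ^ (-1 : ℂ))
      (volume.restrict (Ioo (0 : ℝ) 1)) := Measurable.aestronglyMeasurable (by fun_prop)
  have hcomb : EqOn (fun u : ℝ => (u : ℂ) ^ (b - 1) * (1 - (u : ℂ)) ^ (-1 : ℂ) *
      (((1 - u)⁻¹ : ℝ) : ℂ) ^ (-(s + 1 / 2)))
      (fun u : ℝ => (u : ℂ) ^ (b - 1) * (1 - (u : ℂ)) ^ (s + 1 / 2 - 1)) (Ioo 0 1) := by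
    intro u hu
    have h1 : 0 < 1 - u := by linarith [hu.2]
    simp only
    rw [show (1 : ℂ) - (u : ℂ) = ((1 - u : ℝ) : ℂ) by simp, mul_assoc,
      ofReal_cpow_eq_exp h1, ofReal_cpow_eq_exp h1, ofReal_cpow_eq_exp (inv_pos.2 h1),
      ← Complex.exp_add, Real.log_inv]
    congr 2
    push_cast
    ring
  have hint : IntegrableOn (fun u : ℝ => (u : ℂ) ^ (b - 1) * (1 - (u : ℂ)) ^ (-1 : ℂ) *
      (((1 - u)⁻¹ : ℝ) : ℂ) ^ (-(s + 1 / 2))) (Ioo 0 1) := by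
    rw [integrableOn_congr_fun hcomb measurableSet_Ioo]
    exact integrableOn_beta hb hp
  have hl : ∀ u ∈ Ioo (0 : ℝ) 1, 0 < (1 - u)⁻¹ := fun u hu => inv_pos.2 (by linarith [hu.2])
  have hlm : Measurable fun u : ℝ => (1 - u)⁻¹ := by fun_prop
  have hGm : Measurable fun w : ℝ => ((1 + w : ℝ) : ℂ) ^ (-b) := by fun_prop
  have hconv := mellinConvergent_superposition measurableSet_Ioo hm hlm hl hG hGm hint
  have hval := mellin_superposition measurableSet_Ioo hm hlm hl hG hGm hint
  rw [← MellinConvergent.cpow_smul] at hconv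
  rw [← mellin_cpow_smul] at hval
  constructor
  · refine IntegrableOn.congr_fun hconv (fun Y hY => ?_) measurableSet_Ioi
    simp only
    rw [legendreQ_eq_superposition b hY]
  · have : mellin (legendreQ b) s = mellin (fun Y : ℝ => (Y : ℂ) ^ (1 / 2 : ℂ) •
      ∫ u in Ioo (0 : ℝ) 1, ((u : ℂ) ^ (b - 1) * (1 - (u : ℂ)) ^ (-1 : ℂ)) *
        ((1 + Y * (1 - u)⁻¹ : ℝ) : ℂ) ^ (-b)) s :=
      setIntegral_congr_fun measurableSet_Ioi fun Y hY => by
        simp only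
        rw [legendreQ_eq_superposition b hY]
    rw [this, hval, setIntegral_congr_fun measurableSet_Ioo hcomb, integral_beta hb hp, hGi,
      boundIntegrand, show b + (s + 1 / 2) = 1 + s - μ by rw [hb']; ring]
    have := Complex.Gamma_ne_zero_of_re_pos hb
    field_simp

/-- Needed for Mellin inversion to hold at every point and not merely almost everywhere. -/
theorem continuousAt_legendreQ {b : ℂ} (hb : 0 < b.re) {Y : ℝ} (hY : 0 < Y) :
    ContinuousAt (legendreQ b) Y := by
  have hc : ∀ r : ℂ, ContinuousAt (fun Y : ℝ => (Y : ℂ) ^ r) Y := fun r =>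
    Complex.continuous_ofReal.continuousAt.cpow continuousAt_const
      (Complex.ofReal_mem_slitPlane.2 hY)
  refine (hc _).mul ?_
  refine continuousAt_of_dominated (bound := fun s : ℝ =>
    ‖(s : ℂ) ^ (b - 1) * (1 - (s : ℂ)) ^ (b - 1)‖ * (Y / 2) ^ (-b.re)) ?_ ?_ ?_ ?_
  · exact Eventually.of_forall fun y => Measurable.aestronglyMeasurable (by fun_prop)
  · filter_upwards [lt_mem_nhds (half_lt_self hY)] with y hy
    filter_upwards [ae_restrict_mem measurableSet_Ioo] with s hs
    have h1 : 0 < 1 - s := by linarith [hs.2]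
    have h2 : 0 < Y / 2 := by positivity
    rw [norm_mul]
    refine mul_le_mul_of_nonneg_left ?_ (norm_nonneg _)
    rw [Complex.norm_cpow_eq_rpow_re_of_pos (by linarith), Complex.neg_re]
    exact Real.rpow_le_rpow_of_nonpos h2 (by linarith) (by linarith)
  · exact (integrableOn_beta hb hb).norm.mul_const _
  · filter_upwards [ae_restrict_mem measurableSet_Ioo] with s hs
    have h1 : 0 < 1 - s := by linarith [hs.2]
    refine continuousAt_const.mul ?_
    refine ContinuousAt.cpow (by fun_prop) continuousAt_const
      (Complex.ofReal_mem_slitPlane.2 (by linarith))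

/-! ### Bounds for the beta function and continuity of Gamma factors -/

theorem integral_norm_beta {p q : ℂ} (hp : 0 < p.re) (hq : 0 < q.re) :
    ∫ t in Ioo (0 : ℝ) 1, ‖(t : ℂ) ^ (p - 1) * (1 - (t : ℂ)) ^ (q - 1)‖ =
      ProbabilityTheory.beta p.re q.re := by
  have h := integral_beta (p := (p.re : ℂ)) (q := (q.re : ℂ)) (by simpa) (by simpa)
  rw [← Complex.ofReal_add, Complex.Gamma_ofReal, Complex.Gamma_ofReal, Complex.Gamma_ofReal,
    ← Complex.ofReal_mul, ← Complex.ofReal_div] at h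
  rw [← Complex.ofReal_inj, ProbabilityTheory.beta, ← h, ← integral_complex_ofReal]
  refine setIntegral_congr_fun measurableSet_Ioo fun t ht => ?_
  have h1 : 0 < 1 - t := by linarith [ht.2]
  rw [norm_mul, show (1 : ℂ) - (t : ℂ) = ((1 - t : ℝ) : ℂ) by simp,
    Complex.norm_cpow_eq_rpow_re_of_pos ht.1, Complex.norm_cpow_eq_rpow_re_of_pos h1,
    Complex.ofReal_mul, Complex.ofReal_cpow ht.1.le, Complex.ofReal_cpow h1.le]
  simp

/-- The bound ignores imaginary parts. This is the source of its uniformity in `τ` and of the factor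
`B(ν + 1/2, ν + 1/2)` in the constant. -/
theorem norm_beta_le {p q : ℂ} (hp : 0 < p.re) (hq : 0 < q.re) :
    ‖Complex.Gamma p * Complex.Gamma q / Complex.Gamma (p + q)‖ ≤
      ProbabilityTheory.beta p.re q.re := by
  rw [← integral_norm_beta hp hq, ← integral_beta hp hq]
  exact norm_integral_le_integral_norm _

theorem continuousAt_Gamma {s : ℂ} (hs : 0 < s.re) : ContinuousAt Complex.Gamma s :=
  (Complex.differentiableAt_Gamma s fun m h => by
    rw [h] at hs; simp at hs; linarith [(Nat.cast_nonneg m : (0 : ℝ) ≤ m)]).continuousAt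

theorem continuous_Gamma_comp {X : Type*} [TopologicalSpace X] {f : X → ℂ} (hf : Continuous f)
    (h : ∀ x, 0 < (f x).re) : Continuous fun x => Complex.Gamma (f x) :=
  continuous_iff_continuousAt.2 fun x => ContinuousAt.comp (continuousAt_Gamma (h x)) hf.continuousAt

theorem continuous_Gamma_inv_comp {X : Type*} [TopologicalSpace X] {f : X → ℂ} (hf : Continuous f) :
    Continuous fun x => (Complex.Gamma (f x))⁻¹ :=
  Complex.differentiable_one_div_Gamma.continuous.comp hf

/-! ### The integrand on the line `Re s = ν` and Mellin inversion -/

section Line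

variable {μ : ℂ} {ν : ℝ}

theorem continuous_boundIntegrand (hν : -1 / 2 < ν) (hν' : ν < -μ.re) :
    Continuous fun t : ℝ => boundIntegrand μ (ν + t * Complex.I) := by
  simp only [boundIntegrand, div_eq_mul_inv]
  refine (((continuous_Gamma_comp (by fun_prop) fun t => ?_).pow 2).mul
    (continuous_Gamma_comp (by fun_prop) fun t => ?_)).mul
    (continuous_Gamma_inv_comp (by fun_prop))
  · simp; linarith
  · simp; linarith

/-- No Stirling formula is needed: raising one argument `s + 1/2` by `2` writes the integrand as a
product of two beta functions, bounded on the line, divided by `(s + 1/2)(s + 3/2)`, which gives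
quadratic decay. -/
theorem integrable_boundIntegrand (hν : -1 / 2 < ν) (hν' : ν < -μ.re) :
    Integrable fun t : ℝ => boundIntegrand μ (ν + t * Complex.I) := by
  set b := 1 / 2 - μ with hb'
  have hb : 0 < b.re := by rw [hb']; simp; linarith
  set σ := ν + 1 / 2 with hσ
  have hσ0 : 0 < σ := by rw [hσ]; linarith
  -- Makes `c (1 + t²) ≤ σ² + t²`.
  set c := min (σ ^ 2) 1 with hc
  have hc0 : 0 < c := lt_min (by positivity) one_pos
  set K := ProbabilityTheory.beta σ b.re * (ProbabilityTheory.beta (σ + 2) (-μ.re - ν) *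
    ‖Complex.Gamma (b + 2) / Complex.Gamma b‖) / c with hK
  refine (integrable_inv_one_add_sq.const_mul K).mono'
    (continuous_boundIntegrand hν hν').aestronglyMeasurable (Eventually.of_forall fun t => ?_)
  set s : ℂ := ν + t * Complex.I with hs
  have hsre : s.re = ν := by simp [hs]
  have hp : (s + 1 / 2).re = σ := by simp [hs, hσ]
  have hp2 : (s + 1 / 2 + 2).re = σ + 2 := by rw [Complex.add_re, hp]; simp
  have hq : (-μ - s).re = -μ.re - ν := by simp [hs]
  have h1 := norm_beta_le (p := s + 1 / 2) (q := b) (by rw [hp]; exact hσ0) hb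
  have h2 := norm_beta_le (p := s + 1 / 2 + 2) (q := -μ - s) (by rw [hp2]; positivity)
    (by rw [hq]; linarith)
  rw [hp] at h1
  rw [hp2, hq, show s + 1 / 2 + 2 + (-μ - s) = b + 2 by rw [hb']; ring] at h2
  have hp0 : s + 1 / 2 ≠ 0 := fun h => by rw [h] at hp; simp at hp; linarith
  have hp1 : s + 1 / 2 + 1 ≠ 0 := fun h => by
    have : (s + 1 / 2 + 1).re = σ + 1 := by rw [Complex.add_re, hp]; simp
    rw [h] at this; simp at this; linarith
  have g1 : Complex.Gamma (s + 1 / 2 + 2) =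
      (s + 1 / 2 + 1) * ((s + 1 / 2) * Complex.Gamma (s + 1 / 2)) := by
    rw [show s + 1 / 2 + 2 = s + 1 / 2 + 1 + 1 by ring, Complex.Gamma_add_one _ hp1,
      Complex.Gamma_add_one _ hp0]
  have gb : Complex.Gamma b ≠ 0 := Complex.Gamma_ne_zero_of_re_pos hb
  have gb2 : Complex.Gamma (b + 2) ≠ 0 := Complex.Gamma_ne_zero_of_re_pos (by simp; linarith)
  have key : boundIntegrand μ s =
      (Complex.Gamma (s + 1 / 2) * Complex.Gamma b / Complex.Gamma (s + 1 / 2 + b)) *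
      ((Complex.Gamma (s + 1 / 2 + 2) * Complex.Gamma (-μ - s) / Complex.Gamma (b + 2)) *
        (Complex.Gamma (b + 2) / Complex.Gamma b)) * ((s + 1 / 2) * (s + 1 / 2 + 1))⁻¹ := by
    rw [boundIntegrand, g1, show s + 1 / 2 + b = 1 + s - μ by rw [hb']; ring]
    generalize s + 1 / 2 = p at hp0 hp1 ⊢
    field_simp
  have h3 : c * (1 + t ^ 2) ≤ ‖(s + 1 / 2) * (s + 1 / 2 + 1)‖ := by
    have e1 : s + 1 / 2 = ((σ : ℝ) : ℂ) + (t : ℝ) * Complex.I := by rw [hs, hσ]; push_cast; ring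
    have e2 : s + 1 / 2 + 1 = ((σ + 1 : ℝ) : ℂ) + (t : ℝ) * Complex.I := by rw [e1]; push_cast; ring
    rw [norm_mul, e1, show (σ : ℂ) + (t : ℝ) * Complex.I + 1 =
      ((σ + 1 : ℝ) : ℂ) + (t : ℝ) * Complex.I by push_cast; ring, Complex.norm_add_mul_I,
      Complex.norm_add_mul_I]
    calc c * (1 + t ^ 2) ≤ σ ^ 2 + t ^ 2 := by
          have := min_le_left (σ ^ 2) 1
          have := mul_le_mul_of_nonneg_right (min_le_right (σ ^ 2) 1) (sq_nonneg t)
          rw [hc]; linarith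
      _ = √(σ ^ 2 + t ^ 2) * √(σ ^ 2 + t ^ 2) := (Real.mul_self_sqrt (by positivity)).symm
      _ ≤ _ := by gcongr; linarith
  rw [key, norm_mul, norm_mul, norm_mul _ (Complex.Gamma (b + 2) / Complex.Gamma b), norm_inv, hK]
  have h4 : ‖(s + 1 / 2) * (s + 1 / 2 + 1)‖⁻¹ ≤ c⁻¹ * (1 + t ^ 2)⁻¹ := by
    rw [← mul_inv]
    exact inv_anti₀ (by positivity) h3
  have hB1 := (norm_nonneg _).trans h1
  have hB2 := (norm_nonneg _).trans h2
  calc _ ≤ ProbabilityTheory.beta σ b.re * (ProbabilityTheory.beta (σ + 2) (-μ.re - ν) *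
        ‖Complex.Gamma (b + 2) / Complex.Gamma b‖) * (c⁻¹ * (1 + t ^ 2)⁻¹) := by gcongr
    _ = _ := by ring

/-- `(1/√π) 4^s B(s + 1/2 + iτ, s + 1/2 - iτ) Γ(s + 1/2)² Γ(-μ - s) / Γ(1 + s - μ)`. -/
def barnes (μ : ℂ) (τ : ℝ) (s : ℂ) : ℂ :=
  (Real.sqrt Real.pi : ℂ)⁻¹ * (4 : ℂ) ^ s * (Complex.Gamma (s + 1 / 2 - Complex.I * τ) *
    Complex.Gamma (s + 1 / 2 + Complex.I * τ) / Complex.Gamma (2 * s + 1)) * boundIntegrand μ s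

theorem legendreQ_eq_mellinInv (hν : -1 / 2 < ν) (hν' : ν < -μ.re)
    {Y : ℝ} (hY : 0 < Y) : legendreQ (1 / 2 - μ) Y = mellinInv ν (boundIntegrand μ) Y := by
  have h := fun t : ℝ => mellin_legendreQ (s := ν + t * Complex.I) (by simpa using hν)
    (by simpa using hν')
  have h0 := mellin_legendreQ (s := ν) (by simpa using hν) (by simpa using hν')
  rw [← mellinInv_mellin_eq ν (legendreQ (1 / 2 - μ)) hY h0.1 ?_
    (continuousAt_legendreQ (by simp; linarith) hY)]
  · simp only [mellinInv]
    congr 2 with t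
    rw [(h t).2]
  · refine (integrable_boundIntegrand hν hν').congr (Eventually.of_forall fun t => ?_)
    exact (h t).2.symm

/-- After Mellin inversion of `legendreQ`, the dependence on `X` is the beta integrand with
parameters `s + 1/2 - iτ` and `s + 1/2 + iτ`, whose sum `2s + 1` is free of `τ`. -/
theorem kernel_eq_mellinInv (hμ : μ.re < 1 / 2) (hν : -1 / 2 < ν) (hν' : ν < -μ.re) (τ : ℝ)
    {y : ℝ} (hy : 0 < y) : kernel μ τ y = mellinInv ν (barnes μ τ) y := by
  set F : ℝ → ℝ → ℂ := fun X t => (X : ℂ) ^ (-(Complex.I * τ) - 1 / 2) * ((1 + X : ℝ) : ℂ)⁻¹ *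
    (((y * (1 + X) ^ 2 / (4 * X) : ℝ) : ℂ) ^ (-(ν + t * Complex.I)) *
      boundIntegrand μ (ν + t * Complex.I)) with hF
  have hre : ∀ t : ℝ, 0 < ((ν : ℂ) + t * Complex.I + 1 / 2 - Complex.I * τ).re := fun t => by
    simp; linarith
  have hre' : ∀ t : ℝ, 0 < ((ν : ℂ) + t * Complex.I + 1 / 2 + Complex.I * τ).re := fun t => by
    simp; linarith
  have hsplit : ∀ X ∈ Ioi (0 : ℝ), ∀ t : ℝ, F X t =
      ((X : ℂ) ^ (((ν : ℂ) + t * Complex.I + 1 / 2 - Complex.I * τ) - 1) *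
        ((1 + X : ℝ) : ℂ) ^ (-(((ν : ℂ) + t * Complex.I + 1 / 2 - Complex.I * τ) +
          ((ν : ℂ) + t * Complex.I + 1 / 2 + Complex.I * τ)))) *
      ((y : ℂ) ^ (-(ν + t * Complex.I)) * (4 : ℂ) ^ (ν + t * Complex.I) *
        boundIntegrand μ (ν + t * Complex.I)) := fun X (hX : 0 < X) t => by
    simp only [hF]
    rw [← mul_assoc, ← mul_assoc]
    congr 1
    rw [show (4 : ℂ) = ((4 : ℝ) : ℂ) by simp, ofReal_cpow_eq_exp hX, ofReal_cpow_eq_exp hX,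
      ofReal_cpow_eq_exp hy, ofReal_cpow_eq_exp (x := 4) (by norm_num),
      ofReal_cpow_eq_exp (x := 1 + X) (by positivity),
      ofReal_cpow_eq_exp (x := y * (1 + X) ^ 2 / (4 * X)) (by positivity),
      ofReal_eq_exp (x := 1 + X) (by positivity), ← Complex.exp_neg]
    simp only [← Complex.exp_add]
    rw [Real.log_div (by positivity) (by positivity), Real.log_mul (by positivity) (by positivity),
      Real.log_mul (by positivity) (by positivity), Real.log_pow]
    congr 1
    push_cast
    ring
  have hbI := integrable_boundIntegrand hν hν'
  -- On the line the modulus of `F` separates exactly into a real beta integrand in `X` and a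
  -- constant times `|boundIntegrand|` in `t`.
  have hint : Integrable (Function.uncurry F) ((volume.restrict (Ioi 0)).prod volume) := by
    have hG := (integrableOn_beta_Ioi_and_integral (p := (ν + 1 / 2 : ℝ)) (q := (ν + 1 / 2 : ℝ))
      (by simp; linarith) (by simp; linarith)).1
    have hprod := hG.mul_prod (ν := volume) (hbI.const_mul (((y ^ (-ν) * 4 ^ ν : ℝ)) : ℂ))
    refine hprod.mono ?_ ?_
    · refine AEStronglyMeasurable.mul (Measurable.aestronglyMeasurable (by fun_prop))
        (AEStronglyMeasurable.mul (Measurable.aestronglyMeasurable (by fun_prop)) ?_)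
      exact hbI.aestronglyMeasurable.comp_snd
    · have : ∀ᵐ z ∂((volume.restrict (Ioi (0 : ℝ))).prod (volume : Measure ℝ)), z.1 ∈ Ioi (0 : ℝ) :=
        Measure.quasiMeasurePreserving_fst.ae (ae_restrict_mem measurableSet_Ioi)
      filter_upwards [this] with z hz
      have hz0 : 0 < z.1 := hz
      rw [Function.uncurry, hsplit z.1 hz z.2]
      simp only [norm_mul, Complex.norm_real]
      rw [Complex.norm_cpow_eq_rpow_re_of_pos hz0, Complex.norm_cpow_eq_rpow_re_of_pos hz0,
        Complex.norm_cpow_eq_rpow_re_of_pos (x := 1 + z.1) (by positivity),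
        Complex.norm_cpow_eq_rpow_re_of_pos (x := 1 + z.1) (by positivity),
        Complex.norm_cpow_eq_rpow_re_of_pos hy, show (4 : ℂ) = ((4 : ℝ) : ℂ) by simp,
        Complex.norm_cpow_eq_rpow_re_of_pos (by norm_num)]
      refine le_of_eq ?_
      rw [Real.norm_of_nonneg (Real.rpow_nonneg hy.le _), Real.norm_of_nonneg (by positivity)]
      simp
  have hswap := integral_integral_swap hint
  rw [kernel_eq_integral hμ τ hy, mellinInv]
  have hL : ∫ X in Ioi (0 : ℝ), (X : ℂ) ^ (-(Complex.I * τ) - 1 / 2) * ((1 + X : ℝ) : ℂ)⁻¹ *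
        legendreQ (1 / 2 - μ) (y * (1 + X) ^ 2 / (4 * X)) =
      (1 / (2 * Real.pi) : ℝ) * ∫ X in Ioi (0 : ℝ), ∫ t : ℝ, F X t := by
    rw [← integral_const_mul]
    refine setIntegral_congr_fun measurableSet_Ioi fun X (hX : 0 < X) => ?_
    rw [legendreQ_eq_mellinInv hν hν' (by positivity), mellinInv]
    simp only [hF, integral_const_mul, smul_eq_mul, Complex.real_smul]
    ring
  rw [hL, hswap, Complex.real_smul, mul_left_comm, ← integral_const_mul]
  congr 2 with t
  rw [setIntegral_congr_fun measurableSet_Ioi (fun X hX => hsplit X hX t), integral_mul_const,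
    (integrableOn_beta_Ioi_and_integral (hre t) (hre' t)).2, barnes, smul_eq_mul,
    show (ν : ℂ) + t * Complex.I + 1 / 2 - Complex.I * τ +
      ((ν : ℂ) + t * Complex.I + 1 / 2 + Complex.I * τ) = 2 * (ν + t * Complex.I) + 1 by ring]
  ring

end Line

/-! ### Weighted spaces and the Mellin transform -/

theorem memLp_one_weightedMeasure_iff {σ : ℝ} {f : ℝ → ℂ} :
    MemLp f 1 (weightedMeasure σ 1) ↔ MellinConvergent f σ := by
  rw [memLp_one_iff_integrable, weightedMeasure, integrable_withDensity_iff_integrable_smul'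
    (by fun_prop) (Eventually.of_forall fun x => ENNReal.ofReal_lt_top)]
  refine integrableOn_congr_fun (fun x (hx : 0 < x) => ?_) measurableSet_Ioi
  rw [ENNReal.toReal_ofReal (Real.rpow_nonneg hx.le _), Complex.real_smul, smul_eq_mul,
    Complex.ofReal_cpow hx.le]
  simp

theorem weightedNorm_one_eq (σ : ℝ) (f : ℝ → ℂ) :
    weightedNorm σ 1 f = ∫ x in Ioi (0 : ℝ), ‖(x : ℂ) ^ ((σ : ℂ) - 1) • f x‖ := by
  simp only [weightedNorm, div_one, Real.rpow_one, mul_one]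
  refine setIntegral_congr_fun measurableSet_Ioi fun x (hx : 0 < x) => ?_
  rw [norm_smul, Complex.norm_cpow_eq_rpow_re_of_pos hx, mul_comm]
  simp

theorem restrict_absolutelyContinuous_weightedMeasure (σ p : ℝ) :
    volume.restrict (Ioi (0 : ℝ)) ≪ weightedMeasure σ p := by
  refine withDensity_absolutelyContinuous' (by fun_prop) ?_
  filter_upwards [ae_restrict_mem measurableSet_Ioi] with x hx
  exact (ENNReal.ofReal_pos.2 (Real.rpow_pos_of_pos hx _)).ne'

theorem norm_Lp_one_eq_weightedNorm (σ : ℝ) (f : Lp ℂ 1 (weightedMeasure σ 1)) :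
    ‖f‖ = weightedNorm σ 1 f := by
  rw [L1.norm_eq_integral_norm, weightedNorm_one_eq]
  refine (integral_withDensity_eq_integral_toReal_smul (by fun_prop)
    (Eventually.of_forall fun x => ENNReal.ofReal_lt_top) _).trans ?_
  refine setIntegral_congr_fun measurableSet_Ioi fun x (hx : 0 < x) => ?_
  simp only [smul_eq_mul]
  rw [ENNReal.toReal_ofReal (Real.rpow_nonneg hx.le _), norm_mul,
    Complex.norm_cpow_eq_rpow_re_of_pos hx]
  simp

theorem continuous_mellin_line {f : ℝ → ℂ} {σ : ℝ} (hf : MellinConvergent f σ) :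
    Continuous fun t : ℝ => mellin f (σ + t * Complex.I) := by
  have hf' : IntegrableOn (fun x : ℝ => (x : ℂ) ^ ((σ : ℂ) - 1) • f x) (Ioi 0) := hf
  have hm : AEStronglyMeasurable f (volume.restrict (Ioi (0 : ℝ))) := by
    have h2 : AEStronglyMeasurable (fun x : ℝ => (x : ℂ) ^ (1 - (σ : ℂ)))
      (volume.restrict (Ioi (0 : ℝ))) := Measurable.aestronglyMeasurable (by fun_prop)
    refine (h2.mul hf'.aestronglyMeasurable).congr ?_
    filter_upwards [ae_restrict_mem measurableSet_Ioi] with x hx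
    have hx0 : (x : ℂ) ≠ 0 := by exact_mod_cast (ne_of_gt hx)
    simp only [Pi.mul_apply, smul_eq_mul]
    rw [← mul_assoc, ← Complex.cpow_add _ _ hx0]
    simp
  refine continuous_of_dominated (bound := fun x : ℝ => ‖(x : ℂ) ^ ((σ : ℂ) - 1) • f x‖)
    (fun t => ?_) (fun t => ?_) hf'.norm ?_
  · have h2 : AEStronglyMeasurable (fun x : ℝ => (x : ℂ) ^ ((σ : ℂ) + t * Complex.I - 1))
      (volume.restrict (Ioi (0 : ℝ))) := Measurable.aestronglyMeasurable (by fun_prop)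
    exact h2.smul hm
  · filter_upwards [ae_restrict_mem measurableSet_Ioi] with x hx
    rw [norm_smul, norm_smul, Complex.norm_cpow_eq_rpow_re_of_pos hx,
      Complex.norm_cpow_eq_rpow_re_of_pos hx]
    simp
  · filter_upwards [ae_restrict_mem measurableSet_Ioi] with x hx
    have hx0 : (x : ℂ) ≠ 0 := by exact_mod_cast (ne_of_gt hx)
    refine Continuous.smul (Continuous.const_cpow (by fun_prop) (Or.inl hx0)) continuous_const

theorem norm_mellin_line_le {f : ℝ → ℂ} {σ : ℝ} (t : ℝ) :
    ‖mellin f (σ + t * Complex.I)‖ ≤ weightedNorm σ 1 f := by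
  rw [weightedNorm_one_eq, mellin]
  refine (norm_integral_le_integral_norm _).trans (le_of_eq ?_)
  refine setIntegral_congr_fun measurableSet_Ioi fun x (hx : 0 < x) => ?_
  rw [norm_smul, norm_smul, Complex.norm_cpow_eq_rpow_re_of_pos hx,
    Complex.norm_cpow_eq_rpow_re_of_pos hx]
  simp

/-! ### Boundedness of the transform -/

section Bounded

variable {μ : ℂ} {ν : ℝ} {f : ℝ → ℂ}

/-- The constant `4^ν B(ν + 1/2, ν + 1/2) / √π` bounding the quotient of `barnes` by
`boundIntegrand`. -/
def barnesConst (ν : ℝ) : ℝ :=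
  (Real.sqrt Real.pi)⁻¹ * 4 ^ ν * ProbabilityTheory.beta (ν + 1 / 2) (ν + 1 / 2)

theorem barnesConst_nonneg (hν : -1 / 2 < ν) : 0 ≤ barnesConst ν := by
  have := (ProbabilityTheory.beta_pos (α := ν + 1 / 2) (β := ν + 1 / 2) (by linarith)
    (by linarith)).le
  unfold barnesConst
  positivity

theorem norm_barnes_le (hν : -1 / 2 < ν) (τ t : ℝ) :
    ‖barnes μ τ (ν + t * Complex.I)‖ ≤
      barnesConst ν * ‖boundIntegrand μ (ν + t * Complex.I)‖ := by
  have h := norm_beta_le (p := ν + t * Complex.I + 1 / 2 - Complex.I * τ)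
    (q := ν + t * Complex.I + 1 / 2 + Complex.I * τ) (by simp; linarith) (by simp; linarith)
  rw [show (ν : ℂ) + t * Complex.I + 1 / 2 - Complex.I * τ +
      ((ν : ℂ) + t * Complex.I + 1 / 2 + Complex.I * τ) = 2 * (ν + t * Complex.I) + 1 by ring,
    show ((ν : ℂ) + t * Complex.I + 1 / 2 - Complex.I * τ).re = ν + 1 / 2 by simp,
    show ((ν : ℂ) + t * Complex.I + 1 / 2 + Complex.I * τ).re = ν + 1 / 2 by simp] at h
  rw [barnes, barnesConst, norm_mul, norm_mul, norm_mul, norm_inv, Complex.norm_real,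
    Real.norm_of_nonneg (Real.sqrt_nonneg _), show (4 : ℂ) = ((4 : ℝ) : ℂ) by simp,
    Complex.norm_cpow_eq_rpow_re_of_pos (by norm_num),
    show ((ν : ℂ) + t * Complex.I).re = ν by simp]
  gcongr

theorem continuous_barnes (hν : -1 / 2 < ν) (hν' : ν < -μ.re) (τ : ℝ) :
    Continuous fun t : ℝ => barnes μ τ (ν + t * Complex.I) := by
  simp only [barnes, div_eq_mul_inv]
  refine ((continuous_const.mul (Continuous.const_cpow (by fun_prop) (Or.inl (by norm_num)))).mul
    (((continuous_Gamma_comp (by fun_prop) fun t => ?_).mul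
    (continuous_Gamma_comp (by fun_prop) fun t => ?_)).mul
    (continuous_Gamma_inv_comp (by fun_prop)))).mul (continuous_boundIntegrand hν hν')
  · simp; linarith
  · simp; linarith

theorem continuous_barnes_index (hν : -1 / 2 < ν) (t : ℝ) :
    Continuous fun τ : ℝ => barnes μ τ (ν + t * Complex.I) := by
  simp only [barnes, div_eq_mul_inv]
  refine (continuous_const.mul (((continuous_Gamma_comp (by fun_prop) fun τ => ?_).mul
    (continuous_Gamma_comp (by fun_prop) fun τ => ?_)).mul continuous_const)).mul continuous_const
  · simp; linarith
  · simp; linarith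

/-- The beta factor is the Mellin transform of the `τ`-free function `(1 + w)^{-(2s+1)}` at `s + 1/2
- iτ`, that is, the Fourier transform of a fixed function at `(t - τ)/(2π)`. Riemann–Lebesgue
applies. -/
theorem tendsto_barnes_index (hν : -1 / 2 < ν) (t : ℝ) :
    Tendsto (fun τ : ℝ => barnes μ τ (ν + t * Complex.I)) (cocompact ℝ) (𝓝 0) := by
  set s : ℂ := ν + t * Complex.I with hs
  have hbeta : Tendsto (fun τ : ℝ => Complex.Gamma (s + 1 / 2 - Complex.I * τ) *
      Complex.Gamma (s + 1 / 2 + Complex.I * τ) / Complex.Gamma (2 * s + 1)) (cocompact ℝ)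
      (𝓝 0) := by
    set g : ℝ → ℂ := fun u => Real.exp (-(ν + 1 / 2) * u) •
      ((1 + Real.exp (-u) : ℝ) : ℂ) ^ (-(2 * s + 1)) with hg
    have h1 : ∀ τ : ℝ, Complex.Gamma (s + 1 / 2 - Complex.I * τ) *
        Complex.Gamma (s + 1 / 2 + Complex.I * τ) / Complex.Gamma (2 * s + 1) =
        FourierTransform.fourier g ((t - τ) * (2 * Real.pi)⁻¹) := fun τ => by
      have := mellin_one_add_cpow (p := s + 1 / 2 - Complex.I * τ)
        (q := s + 1 / 2 + Complex.I * τ) (by simp [hs]; linarith) (by simp [hs]; linarith)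
      rw [show s + 1 / 2 - Complex.I * τ + (s + 1 / 2 + Complex.I * τ) = 2 * s + 1 by ring] at this
      rw [← this, mellin_eq_fourier]
      refine congrArg₂ (fun (h : ℝ → ℂ) x => FourierTransform.fourier h x) ?_ ?_
      · simp [hg, hs]
      · simp [hs, div_eq_mul_inv]
    simp only [h1]
    refine (Real.zero_at_infty_fourier g).comp ?_
    exact ((Homeomorph.subLeft t).trans (Homeomorph.mulRight₀ (2 * Real.pi)⁻¹
      (by positivity))).isClosedEmbedding.tendsto_cocompact
  have := (hbeta.const_mul ((Real.sqrt Real.pi : ℂ)⁻¹ * (4 : ℂ) ^ s)).mul_const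
    (boundIntegrand μ s)
  simpa [barnes] using this

theorem integrable_kernel_mul_prod (hν : -1 / 2 < ν) (hν' : ν < -μ.re)
    (τ : ℝ) (hf : MellinConvergent f ((1 - ν : ℝ) : ℂ)) :
    Integrable (fun z : ℝ × ℝ => (z.1 : ℂ) ^ (-(ν + z.2 * Complex.I)) *
      barnes μ τ (ν + z.2 * Complex.I) * f z.1) ((volume.restrict (Ioi 0)).prod volume) := by
  have hb : Integrable fun t : ℝ => barnes μ τ (ν + t * Complex.I) :=
    ((integrable_boundIntegrand hν hν').norm.const_mul (barnesConst ν)).mono'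
      (continuous_barnes hν hν' τ).aestronglyMeasurable
      (Eventually.of_forall fun t => norm_barnes_le hν τ t)
  have hf' : IntegrableOn (fun x : ℝ => (x : ℂ) ^ (((1 - ν : ℝ) : ℂ) - 1) • f x) (Ioi 0) := hf
  have hprod := hf'.mul_prod (ν := volume) hb
  have hm : AEStronglyMeasurable (fun z : ℝ × ℝ => (z.1 : ℂ) ^ (-(z.2 * Complex.I) : ℂ))
    ((volume.restrict (Ioi (0 : ℝ))).prod volume) := Measurable.aestronglyMeasurable (by fun_prop)
  have hae : ∀ᵐ z ∂((volume.restrict (Ioi (0 : ℝ))).prod (volume : Measure ℝ)),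
      z.1 ∈ Ioi (0 : ℝ) :=
    Measure.quasiMeasurePreserving_fst.ae (ae_restrict_mem measurableSet_Ioi)
  refine (hprod.bdd_mul (c := 1) hm ?_).congr ?_
  · filter_upwards [hae] with z hz
    rw [Complex.norm_cpow_eq_rpow_re_of_pos hz]
    simp
  · filter_upwards [hae] with z hz
    have hx0 : (z.1 : ℂ) ≠ 0 := by exact_mod_cast (ne_of_gt hz)
    rw [show -((ν : ℂ) + z.2 * Complex.I) = -(z.2 * Complex.I) + (((1 - ν : ℝ) : ℂ) - 1) by
      push_cast; ring, Complex.cpow_add _ _ hx0, smul_eq_mul]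
    ring

theorem integrableOn_kernel_mul (hμ : μ.re < 1 / 2) (hν : -1 / 2 < ν) (hν' : ν < -μ.re)
    (τ : ℝ) (hf : MellinConvergent f ((1 - ν : ℝ) : ℂ)) :
    IntegrableOn (fun y => kernel μ τ y * f y) (Ioi 0) := by
  have h := ((integrable_kernel_mul_prod (μ := μ) hν hν' τ hf).integral_prod_left).const_mul
    ((1 / (2 * Real.pi) : ℝ) : ℂ)
  refine h.congr ?_
  filter_upwards [ae_restrict_mem measurableSet_Ioi] with y hy
  rw [kernel_eq_mellinInv hμ hν hν' τ hy, mellinInv, integral_mul_const, Complex.real_smul]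
  simp only [smul_eq_mul]
  ring

theorem kernel_eq (μ : ℂ) (τ y : ℝ) : kernel μ τ y = ((Real.sqrt Real.pi : ℂ) *
    Complex.Gamma (1 / 2 + Complex.I * τ - μ) * Complex.Gamma (1 / 2 - Complex.I * τ - μ)) *
    legendreSq μ τ y := rfl

theorem integrableOn_legendreSq_mul (hμ : μ.re < 1 / 2) (hν : -1 / 2 < ν) (hν' : ν < -μ.re)
    (τ : ℝ) (hf : MellinConvergent f ((1 - ν : ℝ) : ℂ)) :
    IntegrableOn (fun y => legendreSq μ τ y * f y) (Ioi 0) := by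
  have h1 : (Real.sqrt Real.pi : ℂ) ≠ 0 := by
    exact_mod_cast (Real.sqrt_pos.2 Real.pi_pos).ne'
  have h2 := Complex.Gamma_ne_zero_of_re_pos (s := 1 / 2 + Complex.I * τ - μ) (by simp; linarith)
  have h3 := Complex.Gamma_ne_zero_of_re_pos (s := 1 / 2 - Complex.I * τ - μ) (by simp; linarith)
  have h := (integrableOn_kernel_mul hμ hν hν' τ hf).const_mul (((Real.sqrt Real.pi : ℂ) *
    Complex.Gamma (1 / 2 + Complex.I * τ - μ) * Complex.Gamma (1 / 2 - Complex.I * τ - μ))⁻¹)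
  refine h.congr (Eventually.of_forall fun y => ?_)
  simp only [kernel_eq]
  rw [← mul_assoc, inv_mul_cancel_left₀ (mul_ne_zero (mul_ne_zero h1 h2) h3)]

theorem transform_eq_integral_kernel (μ : ℂ) (f : ℝ → ℂ) (τ : ℝ) :
    transform μ f τ = ∫ y in Ioi (0 : ℝ), kernel μ τ y * f y := by
  simp only [transform, kernel_eq, mul_assoc, integral_const_mul]

/-- Parseval's formula for the Mellin transform. The norm bound, continuity, the decay in `τ` and
the Lebedev representation all start from it. -/
theorem transform_eq_integral_barnes (hμ : μ.re < 1 / 2) (hν : -1 / 2 < ν) (hν' : ν < -μ.re)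
    (τ : ℝ) (hf : MellinConvergent f ((1 - ν : ℝ) : ℂ)) :
    transform μ f τ = (1 / (2 * Real.pi) : ℝ) * ∫ t : ℝ, barnes μ τ (ν + t * Complex.I) *
      mellin f (1 - (ν + t * Complex.I)) := by
  have hswap := integral_integral_swap (f := fun (y t : ℝ) => (y : ℂ) ^ (-(ν + t * Complex.I)) *
      barnes μ τ (ν + t * Complex.I) * f y) (integrable_kernel_mul_prod (μ := μ) hν hν' τ hf)
  have h1 : transform μ f τ = (1 / (2 * Real.pi) : ℝ) * ∫ y in Ioi (0 : ℝ), ∫ t : ℝ,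
      (y : ℂ) ^ (-(ν + t * Complex.I)) * barnes μ τ (ν + t * Complex.I) * f y := by
    rw [transform_eq_integral_kernel, ← integral_const_mul]
    refine setIntegral_congr_fun measurableSet_Ioi fun y hy => ?_
    rw [kernel_eq_mellinInv hμ hν hν' τ hy, mellinInv, integral_mul_const, Complex.real_smul]
    simp only [smul_eq_mul]
    ring
  rw [h1, hswap]
  congr 2 with t
  rw [mellin, ← integral_const_mul]
  congr 1 with y
  rw [smul_eq_mul, show (1 : ℂ) - (ν + t * Complex.I) - 1 = -(ν + t * Complex.I) by ring]
  ring

theorem mellin_one_sub_line (f : ℝ → ℂ) (ν t : ℝ) : mellin f (1 - (ν + t * Complex.I)) =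
    mellin f (((1 - ν : ℝ) : ℂ) + ((-t : ℝ) : ℂ) * Complex.I) := by
  congr 1
  push_cast
  ring

theorem continuous_mellin_one_sub (hf : MellinConvergent f ((1 - ν : ℝ) : ℂ)) :
    Continuous fun t : ℝ => mellin f (1 - (ν + t * Complex.I)) := by
  simp only [mellin_one_sub_line]
  exact (continuous_mellin_line hf).comp continuous_neg

theorem norm_barnes_mul_mellin_le (hν : -1 / 2 < ν) (τ t : ℝ) :
    ‖barnes μ τ (ν + t * Complex.I) * mellin f (1 - (ν + t * Complex.I))‖ ≤
      barnesConst ν * ‖boundIntegrand μ (ν + t * Complex.I)‖ * weightedNorm (1 - ν) 1 f := by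
  rw [norm_mul, mellin_one_sub_line]
  have := barnesConst_nonneg hν
  gcongr
  · exact norm_barnes_le hν τ t
  · exact norm_mellin_line_le _

theorem norm_transform_le (hμ : μ.re < 1 / 2) (hν : -1 / 2 < ν) (hν' : ν < -μ.re)
    (τ : ℝ) (hf : MellinConvergent f ((1 - ν : ℝ) : ℂ)) :
    ‖transform μ f τ‖ ≤ boundConst μ ν * weightedNorm (1 - ν) 1 f := by
  rw [transform_eq_integral_barnes hμ hν hν' τ hf, norm_mul, Complex.norm_real,
    Real.norm_of_nonneg (by positivity)]
  have h1 := norm_integral_le_of_norm_le (((integrable_boundIntegrand hν hν').norm.const_mul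
    (barnesConst ν)).mul_const (weightedNorm (1 - ν) 1 f))
    (Eventually.of_forall fun t => norm_barnes_mul_mellin_le (μ := μ) (f := f) hν τ t)
  rw [integral_mul_const, integral_const_mul] at h1
  refine (mul_le_mul_of_nonneg_left h1 (by positivity)).trans (le_of_eq ?_)
  -- The prefactor `1/(2π)` and `4^ν/√π` combine to `2^{2ν-1}/(π√π)`.
  have h4 : (4 : ℝ) ^ ν = 2 ^ (2 * ν) := by
    rw [Real.rpow_mul (by norm_num)]; norm_num
  rw [boundConst, barnesConst, Real.rpow_sub_one (by norm_num), h4]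
  generalize (∫ t : ℝ, ‖boundIntegrand μ (ν + t * Complex.I)‖) = J
  field_simp

theorem continuous_transform (hμ : μ.re < 1 / 2) (hν : -1 / 2 < ν) (hν' : ν < -μ.re)
    (hf : MellinConvergent f ((1 - ν : ℝ) : ℂ)) : Continuous (transform μ f) := by
  simp only [funext fun τ => transform_eq_integral_barnes hμ hν hν' τ hf]
  refine continuous_const.mul (continuous_of_dominated (fun τ => ?_) (fun τ =>
    Eventually.of_forall fun t => norm_barnes_mul_mellin_le hν τ t)
    (((integrable_boundIntegrand hν hν').norm.const_mul _).mul_const _)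
    (Eventually.of_forall fun t => (continuous_barnes_index hν t).mul continuous_const))
  exact ((continuous_barnes hν hν' τ).mul (continuous_mellin_one_sub hf)).aestronglyMeasurable

theorem tendsto_transform (hμ : μ.re < 1 / 2) (hν : -1 / 2 < ν) (hν' : ν < -μ.re)
    (hf : MellinConvergent f ((1 - ν : ℝ) : ℂ)) :
    Tendsto (transform μ f) (cocompact ℝ) (𝓝 0) := by
  -- Dominated convergence requires a countably generated filter, so `atBot` and `atTop` are treated
  -- separately and joined at the end.
  have key : ∀ l : Filter ℝ, l.IsCountablyGenerated → l ≤ cocompact ℝ →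
      Tendsto (transform μ f) l (𝓝 0) := fun l hl hle => by
    simp only [funext fun τ => transform_eq_integral_barnes hμ hν hν' τ hf]
    have := (tendsto_integral_filter_of_dominated_convergence (l := l)
      (F := fun (τ t : ℝ) => barnes μ τ (ν + t * Complex.I) * mellin f (1 - (ν + t * Complex.I)))
      (f := fun _ => 0)
      (fun t : ℝ => barnesConst ν * ‖boundIntegrand μ (ν + t * Complex.I)‖ *
        weightedNorm (1 - ν) 1 f)
      (Eventually.of_forall fun τ => ((continuous_barnes hν hν' τ).mul
        (continuous_mellin_one_sub hf)).aestronglyMeasurable)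
      (Eventually.of_forall fun τ =>
        Eventually.of_forall fun t => norm_barnes_mul_mellin_le hν τ t)
      (((integrable_boundIntegrand hν hν').norm.const_mul _).mul_const _)
      (Eventually.of_forall fun t => by
        simpa using ((tendsto_barnes_index hν t).mono_left hle).mul_const
          (mellin f (1 - (ν + t * Complex.I))))).const_mul ((1 / (2 * Real.pi) : ℝ) : ℂ)
    simpa using this
  have hcc : cocompact ℝ = atBot ⊔ atTop := cocompact_eq_atBot_atTop
  rw [hcc, tendsto_sup]
  exact ⟨key _ inferInstance (hcc ▸ le_sup_left), key _ inferInstance (hcc ▸ le_sup_right)⟩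

theorem transform_congr_ae {f g : ℝ → ℂ} {σ : ℝ} (h : f =ᵐ[weightedMeasure σ 1] g) :
    transform μ f = transform μ g := by
  funext τ
  unfold transform
  congr 1
  refine integral_congr_ae ?_
  filter_upwards [(restrict_absolutelyContinuous_weightedMeasure σ 1).ae_le h] with y hy
  rw [hy]

/-- `F_μ` as a bounded operator from `L_{1-ν,1}(ℝ₊)` to the bounded continuous functions. -/
theorem exists_transform_operator (hμ : μ.re < 1 / 2) (hν : -1 / 2 < ν) (hν' : ν < -μ.re) :
    ∃ T : Lp ℂ 1 (weightedMeasure (1 - ν) 1) →L[ℂ] BoundedContinuousFunction ℝ ℂ,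
      ∀ (f : ℝ → ℂ) (hf : MemLp f 1 (weightedMeasure (1 - ν) 1)),
        (∀ τ, T (hf.toLp f) τ = transform μ f τ) ∧
        ‖T (hf.toLp f)‖ ≤ boundConst μ ν * weightedNorm (1 - ν) 1 f := by
  have hconv : ∀ f : Lp ℂ 1 (weightedMeasure (1 - ν) 1),
      MellinConvergent f ((1 - ν : ℝ) : ℂ) := fun f => memLp_one_weightedMeasure_iff.1 (Lp.memLp f)
  have hlin : ∀ (f : Lp ℂ 1 (weightedMeasure (1 - ν) 1)) (τ : ℝ),
      IntegrableOn (fun y => legendreSq μ τ y * f y) (Ioi 0) := fun f τ =>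
    integrableOn_legendreSq_mul hμ hν hν' τ (hconv f)
  let T₀ : Lp ℂ 1 (weightedMeasure (1 - ν) 1) →ₗ[ℂ] BoundedContinuousFunction ℝ ℂ :=
    { toFun := fun f => BoundedContinuousFunction.ofNormedAddCommGroup (transform μ f)
        (continuous_transform hμ hν hν' (hconv f)) (boundConst μ ν * weightedNorm (1 - ν) 1 f)
        (fun τ => norm_transform_le hμ hν hν' τ (hconv f))
      map_add' := fun f g => by
        ext τ
        simp only [BoundedContinuousFunction.coe_ofNormedAddCommGroup,
          BoundedContinuousFunction.coe_add, Pi.add_apply]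
        rw [transform_congr_ae (Lp.coeFn_add f g)]
        simp only [transform, Pi.add_apply, mul_add]
        rw [integral_add (hlin f τ) (hlin g τ)]
        ring
      map_smul' := fun c f => by
        ext τ
        simp only [BoundedContinuousFunction.coe_ofNormedAddCommGroup,
          BoundedContinuousFunction.coe_smul, RingHom.id_apply]
        rw [transform_congr_ae (Lp.coeFn_smul c f)]
        simp only [transform, Pi.smul_apply, smul_eq_mul, mul_left_comm _ c, integral_const_mul] }
  have hC : ∀ f : Lp ℂ 1 (weightedMeasure (1 - ν) 1), ‖T₀ f‖ ≤ boundConst μ ν * ‖f‖ := fun f => by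
    rw [norm_Lp_one_eq_weightedNorm]
    exact BoundedContinuousFunction.norm_ofNormedAddCommGroup_le _
      ((norm_nonneg _).trans (norm_transform_le hμ hν hν' 0 (hconv f)))
      (fun τ => norm_transform_le hμ hν hν' τ (hconv f))
  refine ⟨T₀.mkContinuous _ hC, fun f hf => ?_⟩
  have hT : ∀ τ, T₀ (hf.toLp f) τ = transform μ f τ := fun τ => by
    change transform μ (hf.toLp f) τ = _
    rw [transform_congr_ae hf.coeFn_toLp]
  have hf' := memLp_one_weightedMeasure_iff.1 hf
  refine ⟨hT, ?_⟩
  change ‖T₀ (hf.toLp f)‖ ≤ _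
  rw [BoundedContinuousFunction.norm_le ((norm_nonneg _).trans
    (norm_transform_le hμ hν hν' 0 hf'))]
  intro τ
  rw [hT]
  exact norm_transform_le hμ hν hν' τ hf'

end Bounded

/-! ### Quotients of Gamma functions on vertical lines -/

/-- One factor of a comparison of Gamma products, with `z = x + iy` and `w = β + ih`: `|z + w|²`
against `|z|² (|z + 1|²/|z|²)^β`. The powers telescope under `z ↦ z + 1`, and the error in the
exponent is summable over these shifts. It rests on `1 - 1/u ≤ log u` and `1 + u ≤ e^u`. -/
theorem sq_add_sq_shift_le {x y β h : ℝ} (hx : 0 < x) (hβ : 0 ≤ β) :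
    (x + β) ^ 2 + (y + h) ^ 2 ≤ (x ^ 2 + y ^ 2) *
      (((x + 1) ^ 2 + y ^ 2) / (x ^ 2 + y ^ 2)) ^ β *
      Real.exp ((β ^ 2 + 4 * β + h ^ 2 + 2 * |h|) * ((1 + |y|) / (x ^ 2 + y ^ 2))) := by
  have hD : 0 < x ^ 2 + y ^ 2 := by positivity
  have hE : 0 < (x + 1) ^ 2 + y ^ 2 := by positivity
  rw [Real.rpow_def_of_pos (by positivity), mul_assoc, ← Real.exp_add]
  have h1 : (2 * x + 1) / ((x + 1) ^ 2 + y ^ 2) ≤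
      Real.log (((x + 1) ^ 2 + y ^ 2) / (x ^ 2 + y ^ 2)) := by
    have := Real.one_sub_inv_le_log_of_pos (x := ((x + 1) ^ 2 + y ^ 2) / (x ^ 2 + y ^ 2))
      (by positivity)
    refine le_trans (le_of_eq ?_) this
    field_simp
    ring
  have h2 : (2 * β * x + β ^ 2 + 2 * h * y + h ^ 2) / (x ^ 2 + y ^ 2) ≤
      Real.log (((x + 1) ^ 2 + y ^ 2) / (x ^ 2 + y ^ 2)) * β +
      (β ^ 2 + 4 * β + h ^ 2 + 2 * |h|) * ((1 + |y|) / (x ^ 2 + y ^ 2)) := by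
    have h3 := mul_le_mul_of_nonneg_right h1 hβ
    have h4 : 2 * h * y ≤ 2 * |h| * |y| := by
      have := le_abs_self (h * y)
      rw [abs_mul] at this
      linarith
    have h5 : 2 * β * x / (x ^ 2 + y ^ 2) ≤
        (2 * x + 1) / ((x + 1) ^ 2 + y ^ 2) * β + 4 * β / (x ^ 2 + y ^ 2) := by
      rw [div_mul_eq_mul_div, div_add_div _ _ hE.ne' hD.ne', div_le_div_iff₀ hD (by positivity)]
      have h6 : 2 * x * ((x + 1) ^ 2 + y ^ 2) ≤
          (2 * x + 1) * (x ^ 2 + y ^ 2) + ((x + 1) ^ 2 + y ^ 2) * 4 := by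
        nlinarith [sq_nonneg y]
      have h7 := mul_le_mul_of_nonneg_left h6 (mul_nonneg hβ hD.le)
      linarith
    have h6 : (2 * β * x + β ^ 2 + 2 * h * y + h ^ 2) / (x ^ 2 + y ^ 2) ≤
        2 * β * x / (x ^ 2 + y ^ 2) + (β ^ 2 + 2 * |h| * |y| + h ^ 2) / (x ^ 2 + y ^ 2) := by
      rw [← add_div]
      exact div_le_div_of_nonneg_right (by linarith) hD.le
    have h7 : (β ^ 2 + 2 * |h| * |y| + h ^ 2) / (x ^ 2 + y ^ 2) + 4 * β / (x ^ 2 + y ^ 2) ≤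
        (β ^ 2 + 4 * β + h ^ 2 + 2 * |h|) * ((1 + |y|) / (x ^ 2 + y ^ 2)) := by
      rw [← add_div, ← mul_div_assoc]
      gcongr
      have : 0 ≤ (β ^ 2 + 4 * β + h ^ 2) * |y| := by positivity
      nlinarith [abs_nonneg h]
    linarith
  calc (x + β) ^ 2 + (y + h) ^ 2
      = (x ^ 2 + y ^ 2) * ((2 * β * x + β ^ 2 + 2 * h * y + h ^ 2) / (x ^ 2 + y ^ 2) + 1) := by
        field_simp; ring
    _ ≤ _ := by
        gcongr
        exact (add_le_add_left h2 1).trans (Real.add_one_le_exp _)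

/-- Replaces the error term by a telescoping difference, whose sum over `x, x + 1, …` stays bounded
uniformly in `y`. -/
theorem one_add_abs_div_sq_le {α x y : ℝ} (hα : 0 < α) (hx : α ≤ x) :
    (1 + |y|) / (x ^ 2 + y ^ 2) ≤
      2 * (1 + 1 / α) * (1 + |y|) * (1 / (x + |y|) - 1 / (x + 1 + |y|)) := by
  have hx0 : 0 < x := hα.trans_le hx
  have hy := abs_nonneg y
  have h1 : (x + |y|) ^ 2 / 2 ≤ x ^ 2 + y ^ 2 := by
    rw [← sq_abs y]; nlinarith [sq_nonneg (x - |y|)]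
  have h2 : x + 1 + |y| ≤ (1 + 1 / α) * (x + |y|) := by
    have : 1 ≤ 1 / α * (x + |y|) := by
      rw [div_mul_eq_mul_div, one_mul, le_div_iff₀ hα]; linarith
    linarith
  rw [div_sub_div _ _ (by positivity) (by positivity), div_le_iff₀ (by positivity)]
  have h3 : (x + |y|) * (x + 1 + |y|) ≤ 2 * (1 + 1 / α) * (x ^ 2 + y ^ 2) := by
    have := mul_le_mul_of_nonneg_left h2 (show 0 ≤ x + |y| by positivity)
    have h4 : 0 < 1 + 1 / α := by positivity
    nlinarith [mul_le_mul_of_nonneg_left h1 h4.le]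
  have e : 2 * (1 + 1 / α) * (1 + |y|) * ((1 * (x + 1 + |y|) - (x + |y|) * 1) /
      ((x + |y|) * (x + 1 + |y|))) * (x ^ 2 + y ^ 2) = (1 + |y|) *
      (2 * (1 + 1 / α) * (x ^ 2 + y ^ 2) / ((x + |y|) * (x + 1 + |y|))) := by
    field_simp
    ring
  rw [e]
  refine le_mul_of_one_le_right (by positivity) ?_
  rwa [one_le_div (by positivity)]

theorem prod_norm_sq_shift_le {z w : ℂ} (hz : 0 < z.re) (hw : 0 ≤ w.re) (n : ℕ) :
    ∏ j ∈ Finset.range n, ‖z + w + j‖ ^ 2 ≤ (∏ j ∈ Finset.range n, ‖z + j‖ ^ 2) *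
      ((‖z + n‖ ^ 2) / ‖z‖ ^ 2) ^ w.re *
      Real.exp ((w.re ^ 2 + 4 * w.re + w.im ^ 2 + 2 * |w.im|) * (2 * (1 + 1 / z.re) * (1 + |z.im|) *
        (1 / (z.re + |z.im|) - 1 / (z.re + n + |z.im|)))) := by
  have hns (u : ℂ) : ‖u‖ ^ 2 = u.re ^ 2 + u.im ^ 2 := by
    rw [Complex.sq_norm, Complex.normSq_apply]; ring
  have hpos (j : ℕ) : 0 < ‖z + j‖ ^ 2 := by
    have : z + j ≠ 0 := fun h => by
      have := congrArg Complex.re h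
      simp at this
      have : (0 : ℝ) ≤ j := j.cast_nonneg
      linarith
    positivity
  induction n with
  | zero =>
    have := hpos 0
    simp only [Nat.cast_zero, add_zero] at this
    simp [div_self this.ne']
  | succ n ih =>
    set K := w.re ^ 2 + 4 * w.re + w.im ^ 2 + 2 * |w.im| with hK
    have hK0 : 0 ≤ K := by positivity
    set N := 2 * (1 + 1 / z.re) * (1 + |z.im|) with hN
    have hstep : ‖z + w + n‖ ^ 2 ≤ ‖z + n‖ ^ 2 *
        (‖z + (n + 1 : ℕ)‖ ^ 2 / ‖z + n‖ ^ 2) ^ w.re *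
        Real.exp (K * (N * (1 / (z.re + n + |z.im|) - 1 / (z.re + (n + 1 : ℕ) + |z.im|)))) := by
      have hn : (0 : ℝ) ≤ n := n.cast_nonneg
      have h1 := sq_add_sq_shift_le (x := z.re + n) (y := z.im) (β := w.re) (h := w.im)
        (by positivity) hw
      have h2 := one_add_abs_div_sq_le (α := z.re) (x := z.re + n) (y := z.im) hz (by linarith)
      simp only [hns]
      simp only [Complex.add_re, Complex.add_im, Complex.natCast_re, Complex.natCast_im, add_zero]
      simp only [Nat.cast_add, Nat.cast_one]
      rw [show z.re + w.re + (n : ℝ) = z.re + n + w.re by ring,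
        show z.re + ((n : ℝ) + 1) = z.re + n + 1 by ring]
      refine h1.trans ?_
      rw [← hK]
      gcongr
    rw [Finset.prod_range_succ, Finset.prod_range_succ]
    refine (mul_le_mul ih hstep (by positivity) (by positivity)).trans (le_of_eq ?_)
    have h0 := hpos 0
    simp only [Nat.cast_zero, add_zero] at h0
    have hp : (‖z + (n + 1 : ℕ)‖ ^ 2 / ‖z‖ ^ 2) ^ w.re =
        (‖z + n‖ ^ 2 / ‖z‖ ^ 2) ^ w.re * (‖z + (n + 1 : ℕ)‖ ^ 2 / ‖z + n‖ ^ 2) ^ w.re := by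
      rw [← Real.mul_rpow (by positivity) (by positivity)]
      congr 1
      have h1 : ‖z + n‖ ≠ 0 := fun h => by simpa [h] using hpos n
      have h2 : ‖z‖ ≠ 0 := fun h => by simp [h] at h0
      field_simp
    have he : ∀ a b c : ℝ, K * (N * (a - c)) = K * (N * (a - b)) + K * (N * (b - c)) := by
      intros; ring
    rw [hp, he (1 / (z.re + |z.im|)) (1 / (z.re + n + |z.im|)) (1 / (z.re + (n + 1 : ℕ) + |z.im|)),
      Real.exp_add]
    ring

/-- `|Γ(z)| ≤ C |z|^{-Re w} |Γ(z + w)|`, with `C` depending on `Re z` and `w` only. -/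
theorem exists_norm_Gamma_le {α : ℝ} (hα : 0 < α) {w : ℂ} (hw : 0 ≤ w.re) :
    ∃ C : ℝ, 0 < C ∧ ∀ z : ℂ, z.re = α →
      ‖Complex.Gamma z‖ * ‖z‖ ^ w.re ≤ C * ‖Complex.Gamma (z + w)‖ := by
  set K := w.re ^ 2 + 4 * w.re + w.im ^ 2 + 2 * |w.im| with hK
  have hK0 : 0 ≤ K := by positivity
  refine ⟨Real.sqrt (Real.exp (K * (2 * (1 + 1 / α) * (1 + 1 / α)))), by positivity,
    fun z hz => ?_⟩
  have hz0 : 0 < z.re := by rwa [hz]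
  have hzn : z ≠ 0 := fun h => by simp [h] at hz0
  refine le_of_sq_le_sq ?_ (by positivity)
  rw [mul_pow, mul_pow, Real.sq_sqrt (by positivity)]
  have hl1 : Tendsto (fun n : ℕ => ‖Complex.GammaSeq z n‖ ^ 2 * (‖z‖ ^ w.re) ^ 2) atTop
      (𝓝 (‖Complex.Gamma z‖ ^ 2 * (‖z‖ ^ w.re) ^ 2)) :=
    ((Complex.GammaSeq_tendsto_Gamma z).norm.pow 2).mul_const _
  -- The telescoped power leaves `|z + n + 1|^{Re w}`, while `n^w` in Euler's product contributes
  -- `n^{Re w}`; their ratio disappears in the limit.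
  have hl3 : Tendsto (fun n : ℕ => ((‖z + (n + 1 : ℕ)‖ / n) ^ w.re) ^ 2) atTop (𝓝 1) := by
    have h1 : Tendsto (fun n : ℕ => ‖(z + 1) * ((n : ℝ)⁻¹ : ℝ) + 1‖) atTop (𝓝 1) := by
      have h2 : Tendsto (fun n : ℕ => ((n : ℝ)⁻¹ : ℝ)) atTop (𝓝 0) :=
        tendsto_inv_atTop_zero.comp tendsto_natCast_atTop_atTop
      have h3 := (Complex.continuous_ofReal.tendsto 0).comp h2
      have h4 := ((h3.const_mul (z + 1)).add_const 1).norm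
      simpa using h4
    have h2 : Tendsto (fun n : ℕ => ‖z + (n + 1 : ℕ)‖ / n) atTop (𝓝 1) := by
      refine h1.congr' ?_
      filter_upwards [eventually_gt_atTop 0] with n hn
      have hn' : (n : ℂ) ≠ 0 := by exact_mod_cast hn.ne'
      rw [show ((n : ℝ)) = ‖(n : ℂ)‖ by simp, ← norm_div]
      congr 1
      push_cast
      simp only [Complex.norm_natCast]
      push_cast
      field_simp
      ring
    have h3 := (h2.rpow_const (p := w.re) (Or.inl one_ne_zero)).pow 2
    simpa using h3
  have hl2 : Tendsto (fun n : ℕ => Real.exp (K * (2 * (1 + 1 / α) * (1 + 1 / α))) *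
      ‖Complex.GammaSeq (z + w) n‖ ^ 2 * ((‖z + (n + 1 : ℕ)‖ / n) ^ w.re) ^ 2) atTop
      (𝓝 (Real.exp (K * (2 * (1 + 1 / α) * (1 + 1 / α))) * ‖Complex.Gamma (z + w)‖ ^ 2)) := by
    simpa using (((Complex.GammaSeq_tendsto_Gamma (z + w)).norm.pow 2).const_mul
      (Real.exp (K * (2 * (1 + 1 / α) * (1 + 1 / α))))).mul hl3
  refine le_of_tendsto_of_tendsto hl1 hl2 ?_
  filter_upwards [eventually_gt_atTop 0] with n hn
  have hn' : (0 : ℝ) < n := by exact_mod_cast hn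
  have hpos (v : ℂ) (hv : 0 < v.re) : 0 < ∏ j ∈ Finset.range (n + 1), ‖v + j‖ ^ 2 := by
    refine Finset.prod_pos fun j _ => ?_
    have : v + j ≠ 0 := fun h => by
      have := congrArg Complex.re h
      simp at this
      have : (0 : ℝ) ≤ j := j.cast_nonneg
      linarith
    positivity
  have hG (v : ℂ) : ‖Complex.GammaSeq v n‖ ^ 2 = (n : ℝ) ^ (2 * v.re) * (n.factorial : ℝ) ^ 2 /
      ∏ j ∈ Finset.range (n + 1), ‖v + j‖ ^ 2 := by
    rw [Complex.GammaSeq, norm_div, norm_mul, norm_prod, div_pow, mul_pow, Finset.prod_pow]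
    have : ‖(n : ℂ) ^ v‖ = (n : ℝ) ^ v.re := by
      simpa using Complex.norm_cpow_eq_rpow_re_of_pos (x := (n : ℝ)) hn' v
    rw [this, ← Real.rpow_natCast, ← Real.rpow_mul hn'.le]
    simp [mul_comm]
  have hP := prod_norm_sq_shift_le hz0 hw (n + 1)
  rw [← hK] at hP
  -- The exponent no longer depends on `Im z`, because `(1 + |y|)/(α + |y|) ≤ 1 + 1/α`.
  have hexp : K * (2 * (1 + 1 / z.re) * (1 + |z.im|) *
        (1 / (z.re + |z.im|) - 1 / (z.re + (n + 1 : ℕ) + |z.im|))) ≤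
      K * (2 * (1 + 1 / α) * (1 + 1 / α)) := by
    rw [hz, mul_assoc (2 * (1 + 1 / α))]
    gcongr
    have : (1 + |z.im|) * (1 / (α + |z.im|)) ≤ 1 + 1 / α := by
      rw [mul_one_div, div_le_iff₀ (by positivity)]
      have : 0 ≤ 1 / α * |z.im| := by positivity
      have : 1 / α * α = 1 := by field_simp
      nlinarith
    have : 0 ≤ (1 + |z.im|) * (1 / (α + (n + 1 : ℕ) + |z.im|)) := by positivity
    linarith
  have hP' := hP.trans (mul_le_mul_of_nonneg_left (Real.exp_le_exp.2 hexp) (by positivity))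
  have hr (a : ℝ) (ha : 0 ≤ a) : (a ^ 2) ^ w.re = (a ^ w.re) ^ 2 := by
    rw [← Real.rpow_natCast, ← Real.rpow_natCast, ← Real.rpow_mul ha, ← Real.rpow_mul ha, mul_comm]
  rw [Real.div_rpow (by positivity) (by positivity), hr _ (norm_nonneg _), hr _ (norm_nonneg _)]
    at hP'
  have hzw : 0 < (z + w).re := by simp; linarith
  have h1 := hpos z hz0
  have h2 := hpos (z + w) hzw
  have h3 : 0 < (‖z‖ ^ w.re) ^ 2 := by positivity
  rw [hG, hG, Real.div_rpow (norm_nonneg _) hn'.le, div_pow, Complex.add_re,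
    show 2 * (z.re + w.re) = 2 * z.re + w.re * 2 by ring, Real.rpow_add hn',
    Real.rpow_mul hn'.le w.re]
  have h4 : 0 < (n : ℝ) ^ w.re := by positivity
  have h5 : ((n : ℝ) ^ w.re) ^ (2 : ℝ) = ((n : ℝ) ^ w.re) ^ 2 := by norm_cast
  rw [h5]
  have h6 : (∏ j ∈ Finset.range (n + 1), ‖z + w + j‖ ^ 2) * (‖z‖ ^ w.re) ^ 2 ≤
      Real.exp (K * (2 * (1 + 1 / α) * (1 + 1 / α))) *
      ((∏ j ∈ Finset.range (n + 1), ‖z + j‖ ^ 2) * (‖z + (n + 1 : ℕ)‖ ^ w.re) ^ 2) := by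
    refine (mul_le_mul_of_nonneg_right hP' h3.le).trans (le_of_eq ?_)
    field_simp
  rw [div_mul_eq_mul_div, div_le_iff₀ h1]
  have h7 : Real.exp (K * (2 * (1 + 1 / α) * (1 + 1 / α))) *
      ((n : ℝ) ^ (2 * z.re) * ((n : ℝ) ^ w.re) ^ 2 * (n.factorial : ℝ) ^ 2 /
        ∏ j ∈ Finset.range (n + 1), ‖z + w + j‖ ^ 2) *
      ((‖z + (n + 1 : ℕ)‖ ^ w.re) ^ 2 / ((n : ℝ) ^ w.re) ^ 2) *
      ∏ j ∈ Finset.range (n + 1), ‖z + j‖ ^ 2 =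
      (n : ℝ) ^ (2 * z.re) * (n.factorial : ℝ) ^ 2 *
      ((Real.exp (K * (2 * (1 + 1 / α) * (1 + 1 / α))) *
      ((∏ j ∈ Finset.range (n + 1), ‖z + j‖ ^ 2) * (‖z + (n + 1 : ℕ)‖ ^ w.re) ^ 2)) /
        ∏ j ∈ Finset.range (n + 1), ‖z + w + j‖ ^ 2) := by
    field_simp
  rw [h7, mul_assoc]
  rw [mul_assoc]
  gcongr
  rw [le_div_iff₀ h2, mul_comm]
  exact h6

/-! ### A weighted estimate for Fourier transforms of `L_p` functions -/

open scoped FourierTransform ENNReal ContDiff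

theorem continuous_fourier {g : ℝ → ℂ} (hg : Integrable g) : Continuous (𝓕 g) :=
  VectorFourier.fourierIntegral_continuous Real.continuous_fourierChar (L := innerₗ ℝ) continuous_inner hg

/-- The `L²` extension and the integral define the same tempered distribution: both are tested
against smooth compactly supported functions, moving the Fourier transform to the test function. -/
theorem ae_eq_fourier_toLp {g : ℝ → ℂ} (hg : Integrable g) (hg2 : MemLp g 2) :
    (𝓕 (hg2.toLp g) : Lp ℂ 2 (volume : Measure ℝ)) =ᵐ[volume] 𝓕 g := by
  refine ae_eq_of_integral_contDiff_smul_eq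
    ((Lp.memLp _).locallyIntegrable one_le_two) (continuous_fourier hg).locallyIntegrable fun φ hφ hφc => ?_
  have h1 : HasCompactSupport (Complex.ofRealCLM ∘ φ) := hφc.comp_left rfl
  have h2 : ContDiff ℝ ∞ (Complex.ofRealCLM ∘ φ) := by fun_prop
  set ψ := h1.toSchwartzMap h2 with hψ
  have hψφ (x : ℝ) : ψ x = φ x := by simp [hψ]
  calc ∫ x, φ x • (𝓕 (hg2.toLp g) : Lp ℂ 2 (volume : Measure ℝ)) x
      = Lp.toTemperedDistribution (𝓕 (hg2.toLp g) : Lp ℂ 2 (volume : Measure ℝ)) ψ := by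
        simp [hψφ]
    _ = Lp.toTemperedDistribution (hg2.toLp g) (𝓕 ψ) := by
        rw [← Lp.fourier_toTemperedDistribution_eq]; rfl
    _ = ∫ x, (𝓕 ψ) x • g x := by
        rw [Lp.toTemperedDistribution_apply]
        refine integral_congr_ae ?_
        filter_upwards [hg2.coeFn_toLp] with x hx
        rw [hx]
    _ = ∫ x, ψ x • 𝓕 g x := by
        have := VectorFourier.integral_bilin_fourierIntegral_eq_flip (ContinuousLinearMap.lsmul ℂ ℂ)
          (L := innerₗ ℝ) (μ := volume) (ν := volume) Real.continuous_fourierChar continuous_inner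
          ψ.integrable hg
        simpa using! this
    _ = _ := by simp [hψφ]

/-- Plancherel's theorem for integrable square-integrable functions. -/
theorem eLpNorm_fourier_eq {g : ℝ → ℂ} (hg : Integrable g) (hg2 : MemLp g 2) :
    eLpNorm (𝓕 g) 2 = eLpNorm g 2 := by
  rw [← eLpNorm_congr_ae (ae_eq_fourier_toLp hg hg2), ← eLpNorm_congr_ae hg2.coeFn_toLp,
    ← Lp.enorm_def, ← Lp.enorm_def, ← ofReal_norm, ← ofReal_norm, Lp.norm_fourier_eq]

theorem enorm_fourier_le (g : ℝ → ℂ) (t : ℝ) : ‖𝓕 g t‖ₑ ≤ ∫⁻ x, ‖g x‖ₑ := by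
  refine (enorm_integral_le_lintegral_enorm _).trans (le_of_eq ?_)
  refine lintegral_congr fun x => ?_
  rw [← ofReal_norm, ← ofReal_norm, Circle.norm_smul]

/-- Where `|g| ≤ c`, `|g|² ≤ c^{2-p} |g|^p`. This part of `g` is handled in `L²`; the part with `|g|
> c` is handled in `L¹` by the next lemma. -/
theorem lintegral_truncation_sq_le {g : ℝ → ℂ} {p c : ℝ} (hp : p ≤ 2) (hp0 : 0 < p) (hc : 0 < c) :
    ∫⁻ x, ‖{x | ‖g x‖ ≤ c}.indicator g x‖ₑ ^ (2 : ℝ) ≤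
      ENNReal.ofReal (c ^ (2 - p)) * ∫⁻ x, ENNReal.ofReal (‖g x‖ ^ p) := by
  rw [← lintegral_const_mul' _ _ ENNReal.ofReal_ne_top]
  refine lintegral_mono fun x => ?_
  by_cases h : ‖g x‖ ≤ c
  · rw [indicator_of_mem (by exact h), ← ofReal_norm, ENNReal.ofReal_rpow_of_nonneg (norm_nonneg _)
      (by norm_num), ← ENNReal.ofReal_mul (by positivity)]
    refine ENNReal.ofReal_le_ofReal ?_
    rcases (norm_nonneg (g x)).eq_or_lt with h0 | h0
    · rw [← h0, Real.zero_rpow (by norm_num), Real.zero_rpow hp0.ne', mul_zero]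
    · calc ‖g x‖ ^ (2 : ℝ) = ‖g x‖ ^ (2 - p) * ‖g x‖ ^ p := by
            rw [← Real.rpow_add h0]; congr 1; ring
        _ ≤ _ := by
            gcongr
  · rw [indicator_of_notMem (by exact h)]
    simp

theorem lintegral_truncation_le {g : ℝ → ℂ} {p c : ℝ} (hp : 1 ≤ p) (hc : 0 < c) :
    ∫⁻ x, ‖{x | ‖g x‖ ≤ c}ᶜ.indicator g x‖ₑ ≤
      ENNReal.ofReal (c ^ (1 - p)) * ∫⁻ x, ENNReal.ofReal (‖g x‖ ^ p) := by
  rw [← lintegral_const_mul' _ _ ENNReal.ofReal_ne_top]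
  refine lintegral_mono fun x => ?_
  by_cases h : ‖g x‖ ≤ c
  · rw [indicator_of_notMem (by simpa using h)]
    simp
  · rw [indicator_of_mem (by exact h), ← ofReal_norm, ← ENNReal.ofReal_mul (by positivity)]
    refine ENNReal.ofReal_le_ofReal ?_
    have h0 : 0 < ‖g x‖ := hc.trans (not_le.1 h)
    calc ‖g x‖ = ‖g x‖ ^ (1 - p) * ‖g x‖ ^ p := by
          rw [← Real.rpow_add h0]; simp
      _ ≤ _ := by
          gcongr ?_ * _
          exact Real.rpow_le_rpow_of_nonpos hc (not_le.1 h).le (by linarith)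

/-- The integral of `𝓕 g` over `[-R, R]` is `O(R^{1/p})` if `g` is `p`-integrable. -/
theorem exists_lintegral_fourier_le {g : ℝ → ℂ} {p : ℝ} (hp : 1 ≤ p) (hp2 : p ≤ 2)
    (hgm : StronglyMeasurable g) (hg : Integrable g) (hgp : Integrable fun x => ‖g x‖ ^ p) :
    ∃ C : ℝ≥0∞, C ≠ ⊤ ∧ ∀ R : ℝ, 0 < R →
      ∫⁻ t in Icc (-R) R, ‖𝓕 g t‖ₑ ≤ C * ENNReal.ofReal (R ^ (1 / p)) := by
  have hp0 : 0 < p := by linarith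
  set A := ∫⁻ x, ENNReal.ofReal (‖g x‖ ^ p) with hA
  have hAt : A ≠ ⊤ := by
    have := hgp.lintegral_lt_top
    exact this.ne
  refine ⟨(ENNReal.ofReal 2) ^ (1 / 2 : ℝ) * A ^ (1 / 2 : ℝ) + ENNReal.ofReal 2 * A, ?_,
    fun R hR => ?_⟩
  · finiteness
  -- The height balances the two parts: Cauchy–Schwarz and Plancherel give `c^{(2-p)/2} R^{1/2}` for
  -- the small values, the trivial bound gives `c^{1-p} R` for the large ones, and both equal
  -- `R^{1/p}`.
  set c := R ^ (1 / p) with hc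
  have hc0 : 0 < c := by positivity
  have hS : MeasurableSet {x | ‖g x‖ ≤ c} := measurableSet_le hgm.norm.measurable measurable_const
  set g1 := {x | ‖g x‖ ≤ c}.indicator g with hg1
  set g2 := {x | ‖g x‖ ≤ c}ᶜ.indicator g with hg2
  have hi1 : Integrable g1 := hg.indicator hS
  have hi2 : Integrable g2 := hg.indicator hS.compl
  have hsq := lintegral_truncation_sq_le (g := g) (c := c) hp2 hp0 hc0
  have hle := lintegral_truncation_le (g := g) (c := c) hp hc0
  have he : eLpNorm g1 2 ≤ (ENNReal.ofReal (c ^ (2 - p)) * A) ^ (1 / 2 : ℝ) := by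
    rw [eLpNorm_eq_lintegral_rpow_enorm_toReal (by norm_num) (by norm_num)]
    simp only [ENNReal.toReal_ofNat]
    exact ENNReal.rpow_le_rpow hsq (by norm_num)
  have hm1 : MemLp g1 2 := ⟨hi1.1, he.trans_lt (ENNReal.rpow_lt_top_of_nonneg (by norm_num)
    (ENNReal.mul_ne_top ENNReal.ofReal_ne_top hAt))⟩
  have hsum (t : ℝ) : 𝓕 g t = 𝓕 g1 t + 𝓕 g2 t := by
    have h0 : g = g1 + g2 := (indicator_self_add_compl _ g).symm
    have h1 := (Real.fourierIntegral_convergent_iff (f := g1) t).2 hi1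
    have h2 := (Real.fourierIntegral_convergent_iff (f := g2) t).2 hi2
    rw [Real.fourier_eq, Real.fourier_eq, Real.fourier_eq, ← integral_add h1 h2]
    conv_lhs => rw [h0]
    simp only [Pi.add_apply, smul_add]
  have hvol : (volume.restrict (Icc (-R) R)) univ = ENNReal.ofReal (2 * R) := by
    simp [two_mul]
  have b1 : ∫⁻ t in Icc (-R) R, ‖𝓕 g1 t‖ₑ ≤ (ENNReal.ofReal 2) ^ (1 / 2 : ℝ) * A ^ (1 / 2 : ℝ) *
      ENNReal.ofReal (R ^ (1 / p)) := by
    rw [← eLpNorm_one_eq_lintegral_enorm]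
    refine (eLpNorm_le_eLpNorm_mul_rpow_measure_univ one_le_two
      (continuous_fourier hi1).aestronglyMeasurable).trans ?_
    rw [hvol]
    refine (mul_le_mul_left (((eLpNorm_mono_measure _ Measure.restrict_le_self).trans
      ((eLpNorm_fourier_eq hi1 hm1).le)).trans he) _).trans (le_of_eq ?_)
    rw [ENNReal.mul_rpow_of_nonneg _ _ (by norm_num), ENNReal.ofReal_mul zero_le_two]
    have hx : 1 / (1 : ℝ≥0∞).toReal - 1 / (2 : ℝ≥0∞).toReal = 1 / 2 := by norm_num
    have hR' : R ^ (1 / p) = (c ^ (2 - p)) ^ (1 / 2 : ℝ) * R ^ (1 / 2 : ℝ) := by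
      rw [hc, ← Real.rpow_mul hR.le, ← Real.rpow_mul hR.le, ← Real.rpow_add hR]
      congr 1
      field_simp
      ring
    rw [hx, ENNReal.mul_rpow_of_nonneg _ _ (by norm_num), hR', ENNReal.ofReal_mul (by positivity),
      ENNReal.ofReal_rpow_of_pos (by positivity : 0 < c ^ (2 - p)), ENNReal.ofReal_rpow_of_pos hR]
    ring
  have b2 : ∫⁻ t in Icc (-R) R, ‖𝓕 g2 t‖ₑ ≤ ENNReal.ofReal 2 * A *
      ENNReal.ofReal (R ^ (1 / p)) := by
    refine (lintegral_mono fun t => (enorm_fourier_le g2 t).trans hle).trans ?_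
    rw [lintegral_const, hvol, ENNReal.ofReal_mul zero_le_two]
    have : R ^ (1 / p) = c ^ (1 - p) * R := by
      rw [hc, ← Real.rpow_mul hR.le, ← Real.rpow_add_one hR.ne']
      congr 1
      field_simp
      ring
    rw [this, ENNReal.ofReal_mul (by positivity)]
    refine le_of_eq ?_
    ring
  calc ∫⁻ t in Icc (-R) R, ‖𝓕 g t‖ₑ
      ≤ ∫⁻ t in Icc (-R) R, (‖𝓕 g1 t‖ₑ + ‖𝓕 g2 t‖ₑ) :=
        lintegral_mono fun t => by rw [hsum]; exact enorm_add_le _ _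
    _ = (∫⁻ t in Icc (-R) R, ‖𝓕 g1 t‖ₑ) + ∫⁻ t in Icc (-R) R, ‖𝓕 g2 t‖ₑ :=
        lintegral_add_left (continuous_fourier hi1).enorm.measurable _
    _ ≤ _ := by
        rw [add_mul]
        exact add_le_add b1 b2

/-- If `g` is integrable and `p`-integrable, `1 ≤ p ≤ 2`, then `(1 + |t|)^{-β} 𝓕 g` is integrable
for `β > 1 / p`. -/
theorem integrable_fourier_mul_rpow {g : ℝ → ℂ} {p β : ℝ} (hp : 1 ≤ p) (hp2 : p ≤ 2)
    (hβ : 1 / p < β) (hg : Integrable g) (hgp : Integrable fun x => ‖g x‖ ^ p) :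
    Integrable fun t => (((1 + |t|) ^ (-β) : ℝ) : ℂ) * 𝓕 g t := by
  have hp0 : 0 < p := by linarith
  have hβ0 : 0 < β := (by positivity : 0 < 1 / p).trans hβ
  obtain ⟨C, hC, hCR⟩ : ∃ C : ℝ≥0∞, C ≠ ⊤ ∧ ∀ R : ℝ, 0 < R →
      ∫⁻ t in Icc (-R) R, ‖𝓕 g t‖ₑ ≤ C * ENNReal.ofReal (R ^ (1 / p)) := by
    have hae := hg.1.ae_eq_mk
    have h1 := exists_lintegral_fourier_le hp hp2 hg.1.stronglyMeasurable_mk (hg.congr hae)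
      (hgp.congr (by filter_upwards [hae] with x hx; rw [hx]))
    have h2 : 𝓕 g = 𝓕 (hg.1.mk g) := by
      ext t
      rw [Real.fourier_eq, Real.fourier_eq]
      exact integral_congr_ae (by filter_upwards [hae] with x hx; rw [hx])
    rwa [h2]
  have hw : Continuous fun t : ℝ => (1 + |t|) ^ (-β) :=
    Continuous.rpow_const (by fun_prop) fun t => Or.inl (by positivity)
  refine ⟨((Complex.continuous_ofReal.comp hw).mul (continuous_fourier hg)).aestronglyMeasurable, ?_⟩
  -- Dyadic shells: the weight is at most `2^{-kβ}` on `S k` and the integral of `|𝓕 g|` there is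
  -- `O(2^{k/p})`, so `β > 1/p` makes the series geometric and convergent.
  set S : ℕ → Set ℝ := fun k => {t | 2 ^ k ≤ 1 + |t| ∧ 1 + |t| < 2 ^ (k + 1)} with hS
  have hcover : ⋃ k, S k = univ := by
    refine eq_univ_of_forall fun t => ?_
    have := exists_nat_pow_near (x := 1 + |t|) (y := 2) (by linarith [abs_nonneg t]) one_lt_two
    simpa [hS] using this
  have hbound (k : ℕ) : ∫⁻ t in S k, ‖(((1 + |t|) ^ (-β) : ℝ) : ℂ) * 𝓕 g t‖ₑ ≤
      C * ENNReal.ofReal (2 ^ (1 / p)) * ENNReal.ofReal (2 ^ (1 / p - β)) ^ k := by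
    calc ∫⁻ t in S k, ‖(((1 + |t|) ^ (-β) : ℝ) : ℂ) * 𝓕 g t‖ₑ
        ≤ ∫⁻ t in S k, ENNReal.ofReal ((2 ^ k : ℝ) ^ (-β)) * ‖𝓕 g t‖ₑ := by
          have hSk : MeasurableSet (S k) := (measurableSet_le (f := fun _ : ℝ => (2 : ℝ) ^ k)
            (g := fun t => 1 + |t|) (by fun_prop) (by fun_prop)).inter
            (measurableSet_lt (f := fun t : ℝ => 1 + |t|) (g := fun _ => (2 : ℝ) ^ (k + 1))
              (by fun_prop) (by fun_prop))
          refine setLIntegral_mono' hSk fun t ht => ?_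
          rw [enorm_mul, ← ofReal_norm (((1 + |t|) ^ (-β) : ℝ) : ℂ)]
          gcongr
          rw [Complex.norm_real, Real.norm_of_nonneg (by positivity)]
          exact Real.rpow_le_rpow_of_nonpos (by positivity) ht.1 (by linarith)
      _ ≤ ENNReal.ofReal ((2 ^ k : ℝ) ^ (-β)) *
            ∫⁻ t in Icc (-(2 ^ (k + 1))) (2 ^ (k + 1) : ℝ), ‖𝓕 g t‖ₑ := by
          rw [lintegral_const_mul' _ _ ENNReal.ofReal_ne_top]
          gcongr
          intro t ht
          exact abs_le.1 (by linarith [ht.2])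
      _ ≤ ENNReal.ofReal ((2 ^ k : ℝ) ^ (-β)) *
            (C * ENNReal.ofReal ((2 ^ (k + 1) : ℝ) ^ (1 / p))) := by
          gcongr
          exact hCR _ (by positivity)
      _ = _ := by
          rw [← ENNReal.ofReal_pow (by positivity)]
          have : (2 ^ k : ℝ) ^ (-β) * (2 ^ (k + 1) : ℝ) ^ (1 / p) =
              2 ^ (1 / p) * (2 ^ (1 / p - β)) ^ k := by
            rw [← Real.rpow_natCast, ← Real.rpow_natCast, ← Real.rpow_natCast,
              ← Real.rpow_mul zero_le_two, ← Real.rpow_mul zero_le_two, ← Real.rpow_mul zero_le_two,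
              ← Real.rpow_add two_pos, ← Real.rpow_add two_pos]
            congr 1
            push_cast
            ring
          rw [mul_left_comm, mul_assoc, ← ENNReal.ofReal_mul (by positivity), this,
            ENNReal.ofReal_mul (by positivity)]
  rw [HasFiniteIntegral, ← setLIntegral_univ, ← hcover]
  refine (lintegral_iUnion_le _ _).trans_lt ((ENNReal.tsum_le_tsum hbound).trans_lt ?_)
  rw [ENNReal.tsum_mul_left, ENNReal.tsum_geometric]
  refine ENNReal.mul_lt_top
    (ENNReal.mul_lt_top hC.lt_top ENNReal.ofReal_lt_top) (ENNReal.inv_lt_top.2 (tsub_pos_of_lt ?_))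
  rw [ENNReal.ofReal_lt_one]
  exact Real.rpow_lt_one_of_one_lt_of_neg one_lt_two (by linarith)

/-! ### Integrability of the Mellin–Barnes integrand -/

open scoped FourierTransform ENNReal

theorem hasDerivAt_exp_neg (u : ℝ) :
    HasDerivAt (fun u : ℝ => Real.exp (-u)) (-Real.exp (-u)) u := by
  simpa using (hasDerivAt_neg u).exp

theorem integrableOn_Ioi_iff_comp_exp_neg (h : ℝ → ℂ) :
    IntegrableOn h (Ioi 0) ↔ Integrable fun u : ℝ => ((Real.exp (-u) : ℝ) : ℂ) * h (Real.exp (-u)) := by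
  rw [integrableOn_change (s := univ) (t := Ioi 0) (φ := fun u => Real.exp (-u)) (φ' := fun u => -Real.exp (-u))
    (ψ := fun x => -Real.log x) MeasurableSet.univ (fun u _ => hasDerivAt_exp_neg u)
    (fun u _ => mem_Ioi.2 (Real.exp_pos _)) (fun x _ => mem_univ _) (fun u _ => by simp)
    (fun x (hx : 0 < x) => by simp [Real.exp_log hx]) h, integrableOn_univ]
  simp only [abs_neg, abs_of_pos (Real.exp_pos _)]

theorem integrable_exp_mul_comp_exp_neg {f : ℝ → ℂ} {σ : ℝ} (hf : MellinConvergent f σ) :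
    Integrable fun u : ℝ => Real.exp (-σ * u) • f (Real.exp (-u)) := by
  refine ((integrableOn_Ioi_iff_comp_exp_neg _).1 hf).congr (Eventually.of_forall fun u => ?_)
  simp only [smul_eq_mul, Complex.real_smul]
  rw [ofReal_cpow_eq_exp (Real.exp_pos _), Real.log_exp, Complex.ofReal_exp, ← mul_assoc,
    ← Complex.exp_add, Complex.ofReal_exp]
  congr 2
  push_cast
  ring

theorem integrable_norm_rpow_exp_mul {f : ℝ → ℂ} {σ p : ℝ} (hp : 0 < p)
    (hf : MemLp f (ENNReal.ofReal p) (weightedMeasure σ p)) :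
    Integrable fun u : ℝ => ‖Real.exp (-σ * u) • f (Real.exp (-u))‖ ^ p := by
  have h1 := hf.integrable_norm_rpow (by simpa using hp) ENNReal.ofReal_ne_top
  rw [ENNReal.toReal_ofReal hp.le, weightedMeasure, integrable_withDensity_iff_integrable_smul'
    (by fun_prop) (Eventually.of_forall fun x => ENNReal.ofReal_lt_top)] at h1
  -- The substitution is stated for complex functions; the real integrand is cast and its real part
  -- taken back.
  have h2 := ((integrableOn_Ioi_iff_comp_exp_neg _).1 (h1.ofReal (𝕜 := ℂ))).re
  refine h2.congr (Eventually.of_forall fun u => ?_)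
  have h3 : 0 < Real.exp (-u) := Real.exp_pos _
  simp only [smul_eq_mul]
  rw [RCLike.re_eq_complex_re, Complex.re_ofReal_mul, RCLike.ofReal_eq_complex_ofReal,
    Complex.ofReal_re, norm_smul,
    ENNReal.toReal_ofReal (by positivity), Real.mul_rpow (norm_nonneg _) (norm_nonneg _),
    Real.norm_of_nonneg (Real.exp_pos _).le, ← Real.exp_mul, ← Real.exp_mul, ← mul_assoc,
    ← Real.exp_add]
  congr 2
  ring

/-- The Mellin transform of an element of `L_{σ,1} ∩ L_{σ,p}` on the line `Re s = σ` is integrable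
with the weight `(1 + |t|)^{-β}`, if `1 ≤ p ≤ 2` and `β > 1 / p`. -/
theorem integrable_rpow_mul_mellin {f : ℝ → ℂ} {σ p β : ℝ} (hp : 1 ≤ p) (hp2 : p ≤ 2)
    (hβ : 1 / p < β) (hf : MellinConvergent f σ)
    (hfp : MemLp f (ENNReal.ofReal p) (weightedMeasure σ p)) :
    Integrable fun t : ℝ => (((1 + |t|) ^ (-β) : ℝ) : ℂ) * mellin f (σ + t * Complex.I) := by
  have hβ0 : 0 < β := (by positivity : 0 < 1 / p).trans hβ
  have h1 := (integrable_fourier_mul_rpow hp hp2 hβ (integrable_exp_mul_comp_exp_neg hf)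
    (integrable_norm_rpow_exp_mul (by linarith) hfp)).comp_div
    (show (2 * Real.pi) ≠ 0 by positivity)
  have hw : Continuous fun t : ℝ => (1 + |t|) ^ (-β) :=
    Continuous.rpow_const (by fun_prop) fun t => Or.inl (by positivity)
  refine h1.norm.mono'
    ((Complex.continuous_ofReal.comp hw).mul (continuous_mellin_line hf)).aestronglyMeasurable
    (Eventually.of_forall fun t => ?_)
  have hm : mellin f (σ + t * Complex.I) = 𝓕 (fun u : ℝ => Real.exp (-σ * u) •
      f (Real.exp (-u))) (t / (2 * Real.pi)) := by
    rw [mellin_eq_fourier]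
    simp
  rw [hm, norm_mul, norm_mul]
  gcongr
  rw [Complex.norm_real, Complex.norm_real, Real.norm_of_nonneg (by positivity),
    Real.norm_of_nonneg (by positivity)]
  -- The Fourier frequency is `t/(2π)`; as `2π ≥ 1`, the weight at `t` is at most the weight at
  -- `t/(2π)`.
  refine Real.rpow_le_rpow_of_nonpos (by positivity) ?_ (by linarith)
  rw [abs_div, abs_of_pos (by positivity : 0 < 2 * Real.pi)]
  gcongr
  exact div_le_self (abs_nonneg t) (by linarith [Real.pi_gt_three])

/-- On the line `|sin| ≥ sin(πσ) cosh(πt)` and `|cos| ≤ 2 cosh(πt)`. -/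
theorem norm_cot_pi_le {σ : ℝ} (hσ : 0 < σ) (hσ' : σ < 1) (t : ℝ) :
    ‖Complex.cos (Real.pi * (σ + t * Complex.I)) / Complex.sin (Real.pi * (σ + t * Complex.I))‖ ≤
      2 / Real.sin (Real.pi * σ) := by
  have hs : 0 < Real.sin (Real.pi * σ) :=
    Real.sin_pos_of_pos_of_lt_pi (by positivity) (by nlinarith [Real.pi_pos])
  have hc := Real.cosh_pos (Real.pi * t)
  have he : (Real.pi * (σ + t * Complex.I) : ℂ) =
      ((Real.pi * σ : ℝ) : ℂ) + ((Real.pi * t : ℝ) : ℂ) * Complex.I := by push_cast; ring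
  have h1 : Real.sin (Real.pi * σ) * Real.cosh (Real.pi * t) ≤
      ‖Complex.sin (Real.pi * (σ + t * Complex.I))‖ := by
    refine le_trans (le_of_eq ?_) (Complex.re_le_norm _)
    rw [he, Complex.sin_add_mul_I, ← Complex.ofReal_sin, ← Complex.ofReal_cosh,
      ← Complex.ofReal_cos, ← Complex.ofReal_sinh, ← Complex.ofReal_mul, ← Complex.ofReal_mul,
      Complex.add_re, Complex.re_ofReal_mul, Complex.I_re, mul_zero, add_zero, Complex.ofReal_re]
  have h2 : ‖Complex.cos (Real.pi * (σ + t * Complex.I))‖ ≤ 2 * Real.cosh (Real.pi * t) := by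
    rw [he, Complex.cos_add_mul_I, ← Complex.ofReal_sin, ← Complex.ofReal_cosh,
      ← Complex.ofReal_cos, ← Complex.ofReal_sinh]
    refine (norm_sub_le _ _).trans ?_
    rw [norm_mul, norm_mul, norm_mul, Complex.norm_real, Complex.norm_real, Complex.norm_real,
      Complex.norm_real, Complex.norm_I, mul_one, two_mul]
    have h3 : ‖Real.sinh (Real.pi * t)‖ ≤ Real.cosh (Real.pi * t) := by
      refine abs_le_of_sq_le_sq ?_ hc.le
      linarith [Real.cosh_sq (Real.pi * t)]
    have h4 := Real.abs_cos_le_one (Real.pi * σ)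
    have h5 := Real.abs_sin_le_one (Real.pi * σ)
    rw [Real.norm_of_nonneg hc.le]
    exact add_le_add (mul_le_of_le_one_left hc.le h4)
      ((mul_le_of_le_one_left (norm_nonneg _) h5).trans h3)
  rw [norm_div, div_le_div_iff₀ (lt_of_lt_of_le (by positivity) h1) hs]
  nlinarith

/-- The factor of `phiMellin` is `cot (π s) Γ(1/2 - μ - s) / Γ(1/2 - μ + s)`. -/
theorem phiMellin_eq {μ : ℂ} {f : ℝ → ℂ} {s : ℂ} (hs : 0 < s.re) (hs' : s.re < 1 / 2) :
    phiMellin μ f s = Complex.cos (Real.pi * s) / Complex.sin (Real.pi * s) *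
      (Complex.Gamma (1 / 2 - μ - s) / Complex.Gamma (1 / 2 + s - μ)) * mellin f (3 / 2 - s) := by
  have h1 := Complex.Gamma_mul_Gamma_one_sub s
  have h2 := Complex.Gamma_mul_Gamma_one_sub (s + 1 / 2)
  rw [show 1 - (s + 1 / 2) = 1 / 2 - s by ring, show (Real.pi : ℂ) * (s + 1 / 2) =
    Real.pi * s + Real.pi / 2 by ring, Complex.sin_add_pi_div_two] at h2
  rw [phiMellin, mul_assoc (Complex.Gamma (1 / 2 - μ - s)), h1, h2]
  have hpi : (Real.pi : ℂ) ≠ 0 := by exact_mod_cast Real.pi_ne_zero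
  have hc : Complex.cos (Real.pi * s) ≠ 0 := fun h => by
    rw [h, div_zero, mul_eq_zero] at h2
    rcases h2 with h2 | h2
    · exact Complex.Gamma_ne_zero_of_re_pos (by simp; linarith) h2
    · exact Complex.Gamma_ne_zero_of_re_pos (by simp; linarith) h2
  have hsn : Complex.sin (Real.pi * s) ≠ 0 := fun h => by
    rw [h, div_zero, mul_eq_zero] at h1
    rcases h1 with h2 | h2
    · exact Complex.Gamma_ne_zero_of_re_pos hs h2
    · exact Complex.Gamma_ne_zero_of_re_pos (by simp; linarith) h2
  field_simp

/-- The variable `t` has opposite signs in the two arguments, so the upper one is conjugated, which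
does not change `|Γ|`. The arguments then differ by the constant `2σ + 2i Im b`, and
`exists_norm_Gamma_le` gives the decay `|z|^{-2σ}`. -/
theorem exists_norm_Gamma_quotient_le {b : ℂ} {σ : ℝ} (hσ : 0 < σ) (hσb : σ < b.re) :
    ∃ C : ℝ, ∀ t : ℝ, ‖Complex.Gamma (b - (σ + t * Complex.I)) /
      Complex.Gamma (b + (σ + t * Complex.I))‖ ≤ C * (1 + |t|) ^ (-(2 * σ)) := by
  obtain ⟨C, hC0, hC⟩ := exists_norm_Gamma_le (α := b.re - σ) (by linarith)
    (w := ⟨2 * σ, 2 * b.im⟩) (by simp; linarith)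
  set d := b.re - σ with hd
  have hd0 : 0 < d := by linarith
  set M := (1 + |b.im|) / d + 1 with hM
  have hM0 : 0 < M := by positivity
  refine ⟨C * M ^ (2 * σ), fun t => ?_⟩
  set z := (starRingEnd ℂ) (b - (σ + t * Complex.I)) with hz
  have h1 := hC z (by simp [hz, hd])
  have h2 : z + ⟨2 * σ, 2 * b.im⟩ = b + (σ + t * Complex.I) := by
    apply Complex.ext
    · simp [hz]; ring
    · simp [hz]; ring
  rw [h2, hz, Complex.Gamma_conj, RCLike.norm_conj, ← hz] at h1
  have h3 : 1 + |t| ≤ M * ‖z‖ := by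
    have h4 : d ≤ ‖z‖ := by
      refine le_trans (le_of_eq ?_) (Complex.re_le_norm _)
      simp [hz, hd]
    have h5 : |t| - |b.im| ≤ ‖z‖ := by
      refine le_trans ?_ (Complex.abs_im_le_norm _)
      have : z.im = t - b.im := by simp [hz]; ring
      rw [this]
      exact abs_sub_abs_le_abs_sub _ _
    have h6 : 1 + |b.im| ≤ (1 + |b.im|) / d * ‖z‖ := by
      rw [div_mul_eq_mul_div, le_div_iff₀ hd0]
      gcongr
    rw [hM, add_mul, one_mul]
    linarith
  have h7 : 0 < ‖Complex.Gamma (b + (σ + t * Complex.I))‖ :=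
    norm_pos_iff.2 (Complex.Gamma_ne_zero_of_re_pos (by simp; linarith))
  have h8 : (1 + |t|) ^ (2 * σ) ≤ M ^ (2 * σ) * ‖z‖ ^ (2 * σ) := by
    rw [← Real.mul_rpow hM0.le (norm_nonneg _)]
    gcongr
  rw [norm_div, div_le_iff₀ h7, Real.rpow_neg (by positivity), ← div_eq_mul_inv,
    div_mul_eq_mul_div, le_div_iff₀ (by positivity)]
  calc _ ≤ ‖Complex.Gamma (b - (σ + t * Complex.I))‖ * (M ^ (2 * σ) * ‖z‖ ^ (2 * σ)) := by gcongr
    _ = M ^ (2 * σ) * (‖Complex.Gamma (b - (σ + t * Complex.I))‖ * ‖z‖ ^ (2 * σ)) := by ring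
    _ ≤ M ^ (2 * σ) * (C * ‖Complex.Gamma (b + (σ + t * Complex.I))‖) := by gcongr
    _ = _ := by ring

/-! ### Absolute convergence of the integral defining `phi` -/

section Line

variable {μ : ℂ} {ν p : ℝ} {f : ℝ → ℂ}

theorem continuous_phiMellin_line (hν : -1 / 2 < ν) (hν0 : ν < 0) (hν' : ν < -μ.re)
    (hf : MellinConvergent f ((1 - ν : ℝ) : ℂ)) :
    Continuous fun t : ℝ => phiMellin μ f (((ν + 1 / 2 : ℝ) : ℂ) + t * Complex.I) := by
  have h1 := continuous_mellin_one_sub hf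
  have hm (t : ℝ) : mellin f (3 / 2 - (((ν + 1 / 2 : ℝ) : ℂ) + t * Complex.I)) =
      mellin f (1 - (ν + t * Complex.I)) := by
    congr 1
    push_cast
    ring
  simp only [phiMellin, hm]
  simp only [div_eq_mul_inv, mul_inv]
  refine Continuous.mul (Continuous.mul (Continuous.mul (Continuous.mul
    (continuous_Gamma_comp (by fun_prop) fun t => ?_)
    (continuous_Gamma_comp (by fun_prop) fun t => ?_))
    (continuous_Gamma_comp (by fun_prop) fun t => ?_))
    (Continuous.mul (Continuous.mul (continuous_Gamma_inv_comp (by fun_prop))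
      (continuous_Gamma_inv_comp (by fun_prop))) (continuous_Gamma_inv_comp (by fun_prop)))) h1
  all_goals
    simp
    linarith

theorem integrable_phiMellin_line (hp : 1 < p) (hp2 : p ≤ 2) (hν : -(1 / 2) * (1 - 1 / p) < ν)
    (hν0 : ν < 0) (hν' : ν < -μ.re) (hf : MellinConvergent f ((1 - ν : ℝ) : ℂ))
    (hfp : MemLp f (ENNReal.ofReal p) (weightedMeasure (1 - ν) p)) :
    Integrable fun t : ℝ => phiMellin μ f (((ν + 1 / 2 : ℝ) : ℂ) + t * Complex.I) := by
  have hp1 : 0 < 1 / p := by positivity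
  have hν2 : -1 / 2 < ν := by linarith
  set σ := ν + 1 / 2 with hσ
  have hσ0 : 0 < σ := by linarith
  obtain ⟨C, hC⟩ := exists_norm_Gamma_quotient_le (b := 1 / 2 - μ) hσ0 (by simp; linarith)
  -- The hypothesis `β > 1/p` with `β = 2σ = 2ν + 1` is precisely the lower bound on `ν`.
  have h1 := (integrable_rpow_mul_mellin (β := 2 * σ) hp.le hp2 (by linarith) hf hfp).comp_neg
  refine (h1.norm.const_mul (2 / Real.sin (Real.pi * σ) * C)).mono'
    (continuous_phiMellin_line hν2 hν0 hν' hf).aestronglyMeasurable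
    (Eventually.of_forall fun t => ?_)
  rw [phiMellin_eq (by simpa using hσ0) (by simp; linarith), norm_mul, norm_mul]
  have hm : mellin f (3 / 2 - ((σ : ℂ) + t * Complex.I)) =
      mellin f (((1 - ν : ℝ) : ℂ) + ((-t : ℝ) : ℂ) * Complex.I) := by
    congr 1
    rw [hσ]
    push_cast
    ring
  have h2 := hC t
  rw [show (1 / 2 - μ + (σ + t * Complex.I) : ℂ) = 1 / 2 + (σ + t * Complex.I) - μ by ring] at h2
  have h3 := norm_cot_pi_le hσ0 (by linarith) t
  rw [hm, norm_mul, Complex.norm_real, abs_neg, Real.norm_of_nonneg (by positivity)]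
  have h4 := mul_le_mul h3 h2 (norm_nonneg _) ((norm_nonneg _).trans h3)
  refine (mul_le_mul_of_nonneg_right h4 (norm_nonneg _)).trans (le_of_eq ?_)
  ring

end Line

/-! ### Series of integrable functions and of Gamma functions -/

theorem integrable_tsum_of_summable_integral_norm {α : Type*} [MeasurableSpace α] {m : Measure α}
    {F : ℕ → α → ℂ} (hF : ∀ n, Integrable (F n) m) (hs : Summable fun n => ∫ a, ‖F n a‖ ∂m) :
    Integrable (fun a => ∑' n, F n a) m := by
  refine ⟨(AEMeasurable.tsum fun n => (hF n).1.aemeasurable).aestronglyMeasurable, ?_⟩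
  refine (lintegral_mono fun a => enorm_tsum_le_tsum_enorm).trans_lt ?_
  rw [lintegral_tsum fun n => (hF n).1.enorm]
  simp only [← ofReal_integral_norm_eq_lintegral_enorm (hF _)]
  exact hs.tsum_ofReal_lt_top

theorem norm_Gamma_le {s : ℂ} (hs : 0 < s.re) : ‖Complex.Gamma s‖ ≤ Real.Gamma s.re := by
  rw [Complex.Gamma_eq_integral hs, Complex.GammaIntegral, Real.Gamma_eq_integral hs]
  refine (norm_integral_le_integral_norm _).trans (le_of_eq ?_)
  refine setIntegral_congr_fun measurableSet_Ioi fun x (hx : 0 < x) => ?_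
  rw [norm_mul, Complex.norm_cpow_eq_rpow_re_of_pos hx, Complex.norm_real,
    Real.norm_of_nonneg (Real.exp_pos _).le]
  simp

/-- Controls the denominators in the power series of `besselI` for purely imaginary order. -/
theorem factorial_mul_norm_Gamma_le {s : ℂ} (hs : s.re = 0) (n : ℕ) :
    (n.factorial : ℝ) * ‖Complex.Gamma (s + 1)‖ ≤ ‖Complex.Gamma (n + s + 1)‖ := by
  induction n with
  | zero => simp
  | succ n ih =>
    have h0 : (n + s + 1 : ℂ) ≠ 0 := fun h => by
      have := congrArg Complex.re h
      simp [hs] at this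
      linarith [(Nat.cast_nonneg n : (0 : ℝ) ≤ n)]
    have h1 : ((n + 1 : ℕ) : ℂ) + s + 1 = (n + s + 1) + 1 := by push_cast; ring
    rw [h1, Complex.Gamma_add_one _ h0, norm_mul, Nat.factorial_succ, Nat.cast_mul, mul_assoc]
    have h2 : ((n + 1 : ℕ) : ℝ) ≤ ‖(n + s + 1 : ℂ)‖ := by
      refine le_trans (le_of_eq ?_) (Complex.re_le_norm _)
      simp [hs]
    gcongr

/-- Log-convexity of `Γ` gives `Γ(σ + n)/n! ≤ n^{σ-1}` for `n ≥ 1`; the squares are summable because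
`2σ - 2 < -1`. This majorant serves both Gauss's sum and the Bessel product. -/
theorem summable_Gamma_div_factorial_sq {σ : ℝ} (hσ : 0 < σ) (hσ' : σ < 1 / 2) :
    Summable fun n : ℕ => (Real.Gamma (σ + n) / n.factorial) ^ 2 := by
  rw [← summable_nat_add_iff 1]
  have h1 : Summable fun n : ℕ => ((n + 1 : ℕ) : ℝ) ^ (2 * σ - 2) :=
    (summable_nat_add_iff 1).2 (Real.summable_nat_rpow.2 (by linarith))
  refine h1.of_nonneg_of_le (fun n => sq_nonneg _) fun n => ?_
  have hn : (0 : ℝ) < ((n + 1 : ℕ) : ℝ) := by positivity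
  have h2 := Real.Gamma_mul_add_mul_le_rpow_Gamma_mul_rpow_Gamma (s := n + 1) (t := n + 2)
    (a := 1 - σ) (b := σ) (by positivity) (by positivity) (by linarith) hσ (by ring)
  have hf : Real.Gamma ((n : ℝ) + 2) = (n + 1 : ℕ) * n.factorial := by
    have := Real.Gamma_nat_eq_factorial (n + 1)
    rw [Nat.factorial_succ] at this
    push_cast at this ⊢
    rw [← this]
    congr 1
    ring
  have hfp : (0 : ℝ) < n.factorial := by positivity
  rw [Real.Gamma_nat_eq_factorial, hf, Real.mul_rpow hn.le hfp.le] at h2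
  have h3 : Real.Gamma (σ + (n + 1 : ℕ)) / (n + 1).factorial ≤ ((n + 1 : ℕ) : ℝ) ^ (σ - 1) := by
    rw [Nat.factorial_succ, Nat.cast_mul, div_le_iff₀ (by positivity)]
    refine le_trans (le_of_eq (by congr 1; push_cast; ring)) (h2.trans (le_of_eq ?_))
    rw [mul_left_comm, ← Real.rpow_add hfp, ← mul_assoc, Real.rpow_sub_one hn.ne',
      show 1 - σ + σ = 1 by ring, Real.rpow_one]
    field_simp
  have h4 : 0 ≤ Real.Gamma (σ + (n + 1 : ℕ)) / (n + 1).factorial :=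
    div_nonneg (Real.Gamma_pos_of_pos (by positivity)).le (by positivity)
  refine (pow_le_pow_left₀ h4 h3 2).trans (le_of_eq ?_)
  rw [← Real.rpow_natCast, ← Real.rpow_mul hn.le]
  congr 1
  push_cast
  ring

/-- Gauss's summation of `₂F₁(s, s + α; 1 + α; 1)`. -/
theorem hasSum_gauss {s α : ℂ} (hs : 0 < s.re) (hs' : s.re < 1 / 2) (hα : α.re = 0) :
    HasSum (fun n : ℕ => Complex.Gamma (s + n) * Complex.Gamma (s + n + α) /
        (n.factorial * Complex.Gamma (n + α + 1)))
      (Complex.Gamma s * Complex.Gamma (s + α) * Complex.Gamma (1 - 2 * s) /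
        (Complex.Gamma (1 - s) * Complex.Gamma (1 - s + α))) := by
  have hG1 : Complex.Gamma (1 - s) ≠ 0 := Complex.Gamma_ne_zero_of_re_pos (by simp; linarith)
  have hGs : Complex.Gamma s ≠ 0 := Complex.Gamma_ne_zero_of_re_pos hs
  have hb : 0 < (s + α).re := by simp [hα, hs]
  have hcb : 0 < ((1 + α) - (s + α)).re := by simp; linarith
  have hsum : Summable fun n : ℕ => ‖(ascPochhammer ℂ n).eval s / n.factorial *
      ((1 : ℝ) : ℂ) ^ n‖ * ∫ t in Ioo (0 : ℝ) 1, ‖(t : ℂ) ^ ((s + α) + n - 1) *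
        (1 - (t : ℂ)) ^ ((1 + α) - (s + α) - 1)‖ := by
    refine ((summable_Gamma_div_factorial_sq hs hs').mul_left
      (Real.Gamma (1 - s.re) / ‖Complex.Gamma s‖)).of_nonneg_of_le
      (fun n => by positivity) fun n => ?_
    have hsn : 0 < (s + n).re := by simp; positivity
    have hbn : 0 < ((s + α) + n).re := by simp [hα]; positivity
    rw [integral_norm_beta hbn hcb, ProbabilityTheory.beta]
    have h1 : ((s + α) + n).re = s.re + n := by simp [hα]
    have h2 : ((1 + α) - (s + α)).re = 1 - s.re := by simp
    have h3 : s.re + n + (1 - s.re) = n + 1 := by ring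
    rw [h1, h2, h3, Real.Gamma_nat_eq_factorial]
    have h4 : ‖(ascPochhammer ℂ n).eval s‖ ≤ Real.Gamma (s.re + n) / ‖Complex.Gamma s‖ := by
      rw [le_div_iff₀ (norm_pos_iff.2 hGs), ← norm_mul, ← Gamma_add_natCast hs]
      simpa using norm_Gamma_le hsn
    have h5 : 0 ≤ Real.Gamma (s.re + n) := (Real.Gamma_pos_of_pos (by positivity)).le
    have h6 : 0 ≤ Real.Gamma (1 - s.re) := (Real.Gamma_pos_of_pos (by linarith)).le
    rw [Complex.ofReal_one, one_pow, mul_one, norm_div, Complex.norm_natCast]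
    calc _ ≤ Real.Gamma (s.re + n) / ‖Complex.Gamma s‖ / n.factorial *
          (Real.Gamma (s.re + n) * Real.Gamma (1 - s.re) / n.factorial) := by gcongr
      _ = _ := by ring
  have h := hasSum_euler_integral (a := s) (b := s + α) (c := 1 + α) (z := 1) hb hcb zero_le_one
    le_rfl hsum
  -- At `z = 1` the factor `(1 - t)^{-s}` merges with the beta weight, leaving a beta integral with
  -- parameters `s + α` and `1 - 2s`.
  have hint : ∫ t in Ioo (0 : ℝ) 1, (t : ℂ) ^ ((s + α) - 1) *
      (1 - (t : ℂ)) ^ ((1 + α) - (s + α) - 1) * ((1 - 1 * t : ℝ) : ℂ) ^ (-s) =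
      Complex.Gamma (s + α) * Complex.Gamma (1 - 2 * s) / Complex.Gamma (1 - s + α) := by
    have h1 := integral_beta (p := s + α) (q := 1 - 2 * s) hb (by simp; linarith)
    rw [show s + α + (1 - 2 * s) = 1 - s + α by ring] at h1
    rw [← h1]
    refine setIntegral_congr_fun measurableSet_Ioo fun t ht => ?_
    have ht1 : ((1 - t : ℝ) : ℂ) ≠ 0 := by
      have := ht.2
      exact_mod_cast (sub_pos.2 this).ne'
    push_cast at ht1 ⊢
    rw [one_mul, mul_assoc, ← Complex.cpow_add _ _ ht1]
    congr 2
    ring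
  rw [hint] at h
  convert! h.mul_left (Complex.Gamma s / Complex.Gamma (1 - s)) using 1
  · ext n
    rw [Gamma_add_natCast hs, show (1 + α) - (s + α) = 1 - s by ring,
      show s + n + α = s + α + n by ring, show (n + α + 1 : ℂ) = 1 + α + n by ring]
    simp only [Complex.ofReal_one, one_pow, mul_one]
    field_simp
  · field_simp

/-! ### The Mellin transform of the modified Bessel function of the third kind -/

theorem integral_cexp_mul_cosh_cpow {w : ℂ} (hw : 0 < w.re) (τ : ℝ) :
    (Integrable fun t : ℝ => Complex.exp (Complex.I * τ * t) * (Real.cosh t : ℂ) ^ (-w)) ∧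
    ∫ t : ℝ, Complex.exp (Complex.I * τ * t) * (Real.cosh t : ℂ) ^ (-w) =
      2 ^ (w - 1) * (Complex.Gamma ((w + Complex.I * τ) / 2) *
        Complex.Gamma ((w - Complex.I * τ) / 2) / Complex.Gamma w) := by
  have hp : 0 < ((w + Complex.I * τ) / 2).re := by simp; linarith
  have hq : 0 < ((w - Complex.I * τ) / 2).re := by simp; linarith
  have hφ' : ∀ t ∈ (univ : Set ℝ), HasDerivAt (fun t : ℝ => Real.exp (2 * t))
      (2 * Real.exp (2 * t)) t := fun t _ => by
    have := ((hasDerivAt_id t).const_mul 2).exp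
    simpa [mul_comm] using this
  have hφ : MapsTo (fun t : ℝ => Real.exp (2 * t)) univ (Ioi 0) := fun t _ =>
    mem_Ioi.2 (Real.exp_pos _)
  have hψ : MapsTo (fun x : ℝ => Real.log x / 2) (Ioi 0) univ := fun x _ => mem_univ _
  have hl : ∀ t ∈ (univ : Set ℝ), Real.log (Real.exp (2 * t)) / 2 = t := fun t _ => by simp
  have hr : ∀ x ∈ Ioi (0 : ℝ), Real.exp (2 * (Real.log x / 2)) = x := fun x hx => by
    rw [mul_div_cancel₀ _ two_ne_zero, Real.exp_log hx]
  obtain ⟨h1, h2⟩ := integrableOn_beta_Ioi_and_integral hp hq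
  rw [integrableOn_change MeasurableSet.univ hφ' hφ hψ hl hr] at h1
  rw [setIntegral_change MeasurableSet.univ hφ' hφ hψ hl hr] at h2
  -- Under `x = e^{2t}` one has `1 + x = 2 e^t cosh t`, so the beta integral on the half-line
  -- becomes the cosh integral up to the factor `2^{1-w}`.
  have key : ∀ t : ℝ, ((|2 * Real.exp (2 * t)| : ℝ) : ℂ) *
      (((Real.exp (2 * t) : ℝ) : ℂ) ^ ((w + Complex.I * τ) / 2 - 1) *
      ((1 + Real.exp (2 * t) : ℝ) : ℂ) ^
        (-((w + Complex.I * τ) / 2 + (w - Complex.I * τ) / 2))) =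
      2 ^ (1 - w) * (Complex.exp (Complex.I * τ * t) * (Real.cosh t : ℂ) ^ (-w)) := fun t => by
    have hc : 1 + Real.exp (2 * t) = 2 * Real.exp t * Real.cosh t := by
      rw [Real.cosh_eq, two_mul t, Real.exp_add, Real.exp_neg]
      have := (Real.exp_pos t).ne'
      field_simp
      ring
    have hch := Real.cosh_pos t
    rw [hc, abs_of_pos (by positivity), ofReal_cpow_eq_exp (by positivity),
      ofReal_cpow_eq_exp (by positivity), ofReal_cpow_eq_exp hch,
      show (2 : ℂ) = ((2 : ℝ) : ℂ) by norm_num, ofReal_cpow_eq_exp two_pos,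
      ofReal_eq_exp (by positivity : 0 < 2 * Real.exp (2 * t)), Real.log_mul two_ne_zero
      (Real.exp_pos _).ne', Real.log_mul (by positivity) hch.ne', Real.log_mul two_ne_zero
      (Real.exp_pos _).ne', Real.log_exp, Real.log_exp, ← Complex.exp_add, ← Complex.exp_add,
      ← Complex.exp_add, ← Complex.exp_add]
    congr 1
    push_cast
    ring
  have h2w : (2 : ℂ) ^ (w - 1) * 2 ^ (1 - w) = 1 := by
    rw [← Complex.cpow_add _ _ two_ne_zero]
    simp
  simp only [key] at h1 h2
  rw [setIntegral_univ, integral_const_mul] at h2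
  rw [integrableOn_univ] at h1
  refine ⟨?_, ?_⟩
  · refine (h1.const_mul (2 ^ (w - 1))).congr (Eventually.of_forall fun t => ?_)
    simp only
    rw [← mul_assoc, h2w, one_mul]
  · rw [show ((w + Complex.I * τ) / 2 + (w - Complex.I * τ) / 2) = w by ring] at h2
    rw [← h2, ← mul_assoc, h2w, one_mul]

theorem integral_cosh_mul_cosh_cpow {w : ℂ} (hw : 0 < w.re) (τ : ℝ) :
    IntegrableOn (fun t : ℝ => Complex.cosh (Complex.I * τ * t) * (Real.cosh t : ℂ) ^ (-w))
      (Ioi 0) ∧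
    ∫ t in Ioi (0 : ℝ), Complex.cosh (Complex.I * τ * t) * (Real.cosh t : ℂ) ^ (-w) =
      2 ^ (w - 2) * (Complex.Gamma ((w + Complex.I * τ) / 2) *
        Complex.Gamma ((w - Complex.I * τ) / 2) / Complex.Gamma w) := by
  obtain ⟨h1, h2⟩ := integral_cexp_mul_cosh_cpow hw τ
  set E : ℝ → ℂ := fun t => Complex.exp (Complex.I * τ * t) * (Real.cosh t : ℂ) ^ (-w) with hE
  have he (t : ℝ) : Complex.cosh (Complex.I * τ * t) * (Real.cosh t : ℂ) ^ (-w) =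
      1 / 2 * (E t + E (-t)) := by
    simp only [hE, Complex.cosh, Real.cosh_neg, Complex.ofReal_neg]
    rw [mul_neg]
    ring
  have h3 := h1.integrableOn (s := Ioi 0)
  have h4 := h1.comp_neg.integrableOn (s := Ioi 0)
  simp only [he]
  refine ⟨(h3.add h4).const_mul _, ?_⟩
  rw [integral_const_mul, integral_add h3 h4, integral_comp_neg_Ioi (f := E) (c := 0), neg_zero,
    add_comm, intervalIntegral.integral_Iic_add_Ioi h1.integrableOn h1.integrableOn, h2,
    show w - 2 = (w - 1) - 1 by ring, Complex.cpow_sub (w - 1) 1 two_ne_zero, Complex.cpow_one]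
  ring

theorem mellinConvergent_exp_neg {w : ℂ} (hw : 0 < w.re) :
    MellinConvergent (fun x : ℝ => (Real.exp (-x) : ℂ)) w := by
  refine (Complex.GammaIntegral_convergent hw).congr (Eventually.of_forall fun x => ?_)
  simp [mul_comm]

theorem besselK_eq_superposition (α : ℂ) : besselK α = fun x : ℝ => ∫ t in Ioi (0 : ℝ),
    Complex.cosh (α * t) * (Real.exp (-(x * Real.cosh t)) : ℂ) := by
  ext x
  simp only [besselK, neg_mul, mul_comm]

theorem mellinConvergent_besselK {w : ℂ} (hw : 0 < w.re) (τ : ℝ) :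
    MellinConvergent (besselK (Complex.I * τ)) w := by
  rw [besselK_eq_superposition]
  exact mellinConvergent_superposition (h := fun t => Complex.cosh (Complex.I * τ * t))
    (G := fun y : ℝ => (Real.exp (-y) : ℂ)) (l := Real.cosh) measurableSet_Ioi
    (Continuous.aestronglyMeasurable (by fun_prop)) Real.continuous_cosh.measurable
    (fun t _ => Real.cosh_pos t) (mellinConvergent_exp_neg hw) (by fun_prop)
    (integral_cosh_mul_cosh_cpow hw τ).1

theorem mellin_besselK {w : ℂ} (hw : 0 < w.re) (τ : ℝ) :
    mellin (besselK (Complex.I * τ)) w = 2 ^ (w - 2) * (Complex.Gamma ((w + Complex.I * τ) / 2) *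
      Complex.Gamma ((w - Complex.I * τ) / 2)) := by
  have h := mellin_superposition (h := fun t => Complex.cosh (Complex.I * τ * t))
    (G := fun y : ℝ => (Real.exp (-y) : ℂ)) (l := Real.cosh) measurableSet_Ioi
    (Continuous.aestronglyMeasurable (by fun_prop)) Real.continuous_cosh.measurable
    (fun t _ => Real.cosh_pos t) (mellinConvergent_exp_neg hw) (by fun_prop)
    (integral_cosh_mul_cosh_cpow hw τ).1
  rw [besselK_eq_superposition, h, (integral_cosh_mul_cosh_cpow hw τ).2,
    ← Complex.GammaIntegral_eq_mellin, ← Complex.Gamma_eq_integral hw]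
  have := Complex.Gamma_ne_zero_of_re_pos hw
  field_simp

/-! ### The Mellin transform of the Lebedev kernel -/

theorem norm_cosh_I_mul_le (τ t : ℝ) : ‖Complex.cosh (Complex.I * τ * t)‖ ≤ 1 := by
  rw [show Complex.I * τ * t = ((τ * t : ℝ) : ℂ) * Complex.I by push_cast; ring,
    Complex.cosh_mul_I, ← Complex.ofReal_cos, Complex.norm_real]
  exact Real.abs_cos_le_one _

theorem integrableOn_exp_neg_mul_cosh {u : ℝ} (hu : 0 < u) :
    IntegrableOn (fun t : ℝ => Real.exp (-u * Real.cosh t)) (Ioi 0) := by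
  refine (exp_neg_integrableOn_Ioi 0 hu).mono' (Continuous.aestronglyMeasurable (by fun_prop)) ?_
  filter_upwards [ae_restrict_mem measurableSet_Ioi] with t (ht : 0 < t)
  rw [Real.norm_of_nonneg (Real.exp_pos _).le]
  have h1 : t ≤ Real.cosh t := (Real.self_le_sinh_iff.2 ht.le).trans (Real.sinh_lt_cosh t).le
  refine Real.exp_le_exp.2 ?_
  nlinarith

theorem besselK_zero (u : ℝ) :
    besselK (Complex.I * (0 : ℝ)) u = ((∫ t in Ioi (0 : ℝ), Real.exp (-u * Real.cosh t) : ℝ) : ℂ) := by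
  rw [besselK, ← integral_complex_ofReal]
  simp

theorem norm_besselK_le {u : ℝ} (hu : 0 < u) (τ : ℝ) :
    ‖besselK (Complex.I * τ) u‖ ≤ ∫ t in Ioi (0 : ℝ), Real.exp (-u * Real.cosh t) := by
  refine norm_integral_le_of_norm_le (integrableOn_exp_neg_mul_cosh hu)
    (Eventually.of_forall fun t => ?_)
  rw [norm_mul, Complex.norm_real, Real.norm_of_nonneg (Real.exp_pos _).le]
  exact mul_le_of_le_one_right (Real.exp_pos _).le (norm_cosh_I_mul_le τ t)

/-- Since `|K_{iτ}| ≤ K_0` pointwise, the bound is the Mellin transform of `K_0` at `Re w`. -/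
theorem integral_norm_mellin_besselK_le {w : ℂ} (hw : 0 < w.re) (τ : ℝ) :
    ∫ u in Ioi (0 : ℝ), ‖(u : ℂ) ^ (w - 1) * besselK (Complex.I * τ) u‖ ≤
      2 ^ (w.re - 2) * Real.Gamma (w.re / 2) ^ 2 := by
  have hw' : 0 < ((w.re : ℝ) : ℂ).re := by simpa using hw
  have hc := mellinConvergent_besselK hw' 0
  have h1 := mellin_besselK hw' 0
  have hk : ∀ u ∈ Ioi (0 : ℝ), (u : ℂ) ^ (((w.re : ℝ) : ℂ) - 1) • besselK (Complex.I * (0 : ℝ)) u =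
      ((u ^ (w.re - 1) * ∫ t in Ioi (0 : ℝ), Real.exp (-u * Real.cosh t) : ℝ) : ℂ) := by
    intro u (hu : 0 < u)
    rw [besselK_zero, smul_eq_mul, Complex.ofReal_mul, Complex.ofReal_cpow hu.le]
    push_cast
    rfl
  rw [mellin, setIntegral_congr_fun measurableSet_Ioi hk, integral_complex_ofReal] at h1
  rw [MellinConvergent, integrableOn_congr_fun hk measurableSet_Ioi] at hc
  have hcr := hc.re
  simp only [RCLike.re_eq_complex_re, Complex.ofReal_re] at hcr
  have h2 : ∫ u in Ioi (0 : ℝ), u ^ (w.re - 1) * ∫ t in Ioi (0 : ℝ), Real.exp (-u * Real.cosh t) =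
      2 ^ (w.re - 2) * Real.Gamma (w.re / 2) ^ 2 := by
    have h3 : (2 : ℂ) ^ (((w.re : ℝ) : ℂ) - 2) * (Complex.Gamma ((((w.re : ℝ) : ℂ) +
        Complex.I * (0 : ℝ)) / 2) * Complex.Gamma ((((w.re : ℝ) : ℂ) - Complex.I * (0 : ℝ)) / 2)) =
        ((2 ^ (w.re - 2) * Real.Gamma (w.re / 2) ^ 2 : ℝ) : ℂ) := by
      rw [Complex.ofReal_mul, Complex.ofReal_cpow zero_le_two, Complex.ofReal_pow,
        ← Complex.Gamma_ofReal]
      simp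
      ring
    rw [h3] at h1
    exact_mod_cast h1
  rw [← h2]
  refine setIntegral_mono_on ?_ hcr measurableSet_Ioi fun u (hu : 0 < u) => ?_
  · exact (mellinConvergent_besselK hw τ).norm
  · rw [norm_mul, Complex.norm_cpow_eq_rpow_re_of_pos hu]
    simp only [Complex.sub_re, Complex.one_re]
    gcongr
    exact norm_besselK_le hu τ

/-- Each power of `u` in the series of `I_α`, integrated against `K_{iτ}`, gives `Γ(s + n) Γ(s + n +
α)` for either sign of `α`. The powers of `2` cancel in `n`, and `hasSum_gauss` sums the series. -/
theorem mellin_besselK_mul_besselI {s α : ℂ} {τ : ℝ} (hα : α = Complex.I * τ ∨ α = -(Complex.I * τ))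
    (hs : 0 < s.re) (hs' : s.re < 1 / 2) :
    MellinConvergent (fun u => besselK (Complex.I * τ) u * besselI α u) (2 * s) ∧
    mellin (fun u => besselK (Complex.I * τ) u * besselI α u) (2 * s) = 2 ^ (2 * s - 2) *
      (Complex.Gamma s * Complex.Gamma (s + α) * Complex.Gamma (1 - 2 * s) /
        (Complex.Gamma (1 - s) * Complex.Gamma (1 - s + α))) := by
  have hα0 : α.re = 0 := by rcases hα with h | h <;> simp [h]
  have hw (n : ℕ) : 0 < (2 * s + 2 * n + α).re := by
    simp [hα0]
    positivity
  set c : ℕ → ℂ := fun n => (2 : ℂ) ^ (-(2 * n + α)) / (n.factorial * Complex.Gamma (n + α + 1))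
    with hc
  set F : ℕ → ℝ → ℂ := fun n u => c n * ((u : ℂ) ^ (2 * s + 2 * n + α - 1) *
    besselK (Complex.I * τ) u) with hF
  have hFi (n : ℕ) : IntegrableOn (F n) (Ioi 0) := (mellinConvergent_besselK (hw n) τ).const_mul _
  have hGne : Complex.Gamma (α + 1) ≠ 0 := Complex.Gamma_ne_zero_of_re_pos (by simp [hα0])
  -- By the `K_0` bound and `n! |Γ(α + 1)| ≤ |Γ(n + α + 1)|`, the `n`-th integral is at most a
  -- constant times `(Γ(Re s + n)/n!)²`.
  have hFs : Summable fun n => ∫ u in Ioi (0 : ℝ), ‖F n u‖ := by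
    refine ((summable_Gamma_div_factorial_sq hs hs').mul_left
      (2 ^ (2 * s.re - 2) / ‖Complex.Gamma (α + 1)‖)).of_nonneg_of_le
      (fun n => integral_nonneg fun u => norm_nonneg _) fun n => ?_
    simp only [hF]
    simp_rw [norm_mul (c n)]
    rw [integral_const_mul]
    refine (mul_le_mul_of_nonneg_left (integral_norm_mellin_besselK_le (hw n) τ)
      (norm_nonneg _)).trans ?_
    have h1 : (2 * s + 2 * n + α).re = 2 * (s.re + n) := by simp [hα0]; ring
    have h2 : ‖(2 : ℂ) ^ (-(2 * n + α))‖ = 2 ^ (-(2 * n) : ℝ) := by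
      have := Complex.norm_cpow_eq_rpow_re_of_pos (x := (2 : ℝ)) two_pos (-(2 * n + α))
      simpa [hα0] using this
    have h3 := factorial_mul_norm_Gamma_le hα0 n
    have h4 : 0 < ‖Complex.Gamma (α + 1)‖ := norm_pos_iff.2 hGne
    have h5 : (2 : ℝ) ^ (2 * (s.re + n) - 2) = 2 ^ (2 * s.re - 2) * 2 ^ ((2 * n) : ℝ) := by
      rw [← Real.rpow_add two_pos]
      congr 1
      ring
    have h6 : (2 : ℝ) ^ (-(2 * n) : ℝ) * 2 ^ ((2 * n) : ℝ) = 1 := by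
      rw [← Real.rpow_add two_pos]
      simp
    simp only [hc]
    rw [h1, norm_div, norm_mul, h2, h5, mul_div_cancel_left₀ _ two_ne_zero, Complex.norm_natCast]
    have hfac : (0 : ℝ) < n.factorial := by positivity
    calc 2 ^ (-(2 * n) : ℝ) / (n.factorial * ‖Complex.Gamma (n + α + 1)‖) *
          (2 ^ (2 * s.re - 2) * 2 ^ ((2 * n) : ℝ) * Real.Gamma (s.re + n) ^ 2)
        = (2 ^ (-(2 * n) : ℝ) * 2 ^ ((2 * n) : ℝ)) * (2 ^ (2 * s.re - 2) *
          Real.Gamma (s.re + n) ^ 2) / (n.factorial * ‖Complex.Gamma (n + α + 1)‖) := by ring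
      _ ≤ (2 ^ (-(2 * n) : ℝ) * 2 ^ ((2 * n) : ℝ)) * (2 ^ (2 * s.re - 2) *
          Real.Gamma (s.re + n) ^ 2) / (n.factorial * (n.factorial * ‖Complex.Gamma (α + 1)‖)) := by
          gcongr
      _ = _ := by
          rw [h6]
          field_simp
  have hpt : EqOn (fun u : ℝ => (u : ℂ) ^ (2 * s - 1) • (besselK (Complex.I * τ) u * besselI α u))
      (fun u => ∑' n, F n u) (Ioi 0) := fun u (hu : 0 < u) => by
    simp only [besselI, smul_eq_mul, ← tsum_mul_left]
    refine tsum_congr fun n => ?_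
    have hu0 : (u : ℂ) ≠ 0 := by exact_mod_cast hu.ne'
    simp only [hF, hc]
    rw [ofReal_div_cpow hu.le zero_le_two, show 2 * s + 2 * n + α - 1 =
      (2 * s - 1) + (2 * n + α) by ring, Complex.cpow_add (2 * s - 1) (2 * n + α) hu0, Complex.cpow_neg]
    push_cast
    ring
  refine ⟨?_, ?_⟩
  · rw [MellinConvergent, integrableOn_congr_fun hpt measurableSet_Ioi]
    exact integrable_tsum_of_summable_integral_norm hFi hFs
  · rw [mellin, setIntegral_congr_fun measurableSet_Ioi hpt,
      ← (hasSum_integral_of_summable_integral_norm hFi hFs).tsum_eq,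
      ← (hasSum_gauss hs hs' hα0).tsum_eq, ← tsum_mul_left]
    refine tsum_congr fun n => ?_
    have h1 := mellin_besselK (hw n) τ
    simp only [mellin, smul_eq_mul] at h1
    have h2 : Complex.Gamma ((2 * s + 2 * n + α + Complex.I * τ) / 2) *
        Complex.Gamma ((2 * s + 2 * n + α - Complex.I * τ) / 2) =
        Complex.Gamma (s + n) * Complex.Gamma (s + n + α) := by
      rcases hα with h | h
      · rw [h, mul_comm]
        congr 2 <;> ring
      · rw [h]
        congr 2 <;> ring
    simp only [hF, hc]
    rw [integral_const_mul, h1, h2, show 2 * s + 2 * n + α - 2 = (2 * s - 2) + (2 * n + α) by ring,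
      Complex.cpow_add _ _ two_ne_zero, Complex.cpow_neg]
    have h3 : (2 : ℂ) ^ (2 * n + α) ≠ 0 := by simp [Complex.cpow_eq_zero_iff]
    field_simp

/-- By reflection the two quotients have numerators `sin(π(s ∓ a))/π` over the same product of
Gammas; the sines add to `2 sin(πs) cos(πa)`. At `a = iτ` this is the origin of `cosh(πτ)`. -/
theorem Gamma_quotient_add {s a : ℂ} (h1 : Complex.Gamma (1 - s + a) ≠ 0)
    (h2 : Complex.Gamma (1 - s - a) ≠ 0) (h3 : Complex.Gamma (s + a) ≠ 0)
    (h4 : Complex.Gamma (s - a) ≠ 0) :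
    Complex.Gamma (s + a) / Complex.Gamma (1 - s + a) +
      Complex.Gamma (s - a) / Complex.Gamma (1 - s - a) =
    Complex.Gamma (s + a) * Complex.Gamma (s - a) *
      (2 * Complex.sin (Real.pi * s) * Complex.cos (Real.pi * a) / Real.pi) := by
  have hpi : (Real.pi : ℂ) ≠ 0 := by exact_mod_cast Real.pi_ne_zero
  have e1 := Complex.Gamma_mul_Gamma_one_sub (s + a)
  have e2 := Complex.Gamma_mul_Gamma_one_sub (s - a)
  rw [show 1 - (s + a) = 1 - s - a by ring] at e1
  rw [show 1 - (s - a) = 1 - s + a by ring] at e2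
  have s1 : Complex.sin (Real.pi * (s + a)) ≠ 0 := fun h => by
    rw [h, div_zero] at e1; exact mul_ne_zero h3 h2 e1
  have s2 : Complex.sin (Real.pi * (s - a)) ≠ 0 := fun h => by
    rw [h, div_zero] at e2; exact mul_ne_zero h4 h1 e2
  have e3 : 2 * Complex.sin (Real.pi * s) * Complex.cos (Real.pi * a) =
      Complex.sin (Real.pi * (s - a)) + Complex.sin (Real.pi * (s + a)) := by
    rw [mul_sub, mul_add, Complex.sin_sub, Complex.sin_add]
    ring
  have e1' : Complex.sin (Real.pi * (s + a)) / Real.pi =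
      1 / (Complex.Gamma (s + a) * Complex.Gamma (1 - s - a)) := by rw [e1]; field_simp
  have e2' : Complex.sin (Real.pi * (s - a)) / Real.pi =
      1 / (Complex.Gamma (s - a) * Complex.Gamma (1 - s + a)) := by rw [e2]; field_simp
  rw [e3, add_div, e1', e2']
  field_simp

theorem mellin_besselK_mul_besselI_add {s : ℂ} (τ : ℝ) (hs : 0 < s.re) (hs' : s.re < 1 / 2) :
    MellinConvergent (fun u => besselK (Complex.I * τ) u *
      (besselI (Complex.I * τ) u + besselI (-(Complex.I * τ)) u)) (2 * s) ∧
    mellin (fun u => besselK (Complex.I * τ) u *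
      (besselI (Complex.I * τ) u + besselI (-(Complex.I * τ)) u)) (2 * s) =
      (Real.cosh (Real.pi * τ) / (2 * Real.sqrt Real.pi) : ℝ) *
      (Complex.Gamma (s + Complex.I * τ) * Complex.Gamma (s - Complex.I * τ) *
        Complex.Gamma (1 / 2 - s) / Complex.Gamma (1 - s)) := by
  obtain ⟨c1, m1⟩ := mellin_besselK_mul_besselI (τ := τ) (Or.inl rfl) hs hs'
  obtain ⟨c2, m2⟩ := mellin_besselK_mul_besselI (τ := τ) (Or.inr rfl) hs hs'
  simp only [mul_add]
  obtain ⟨c3, m3⟩ := hasMellin_add c1 c2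
  refine ⟨c3, ?_⟩
  rw [m3, m1, m2]
  have g1 : Complex.Gamma (1 - s + Complex.I * τ) ≠ 0 :=
    Complex.Gamma_ne_zero_of_re_pos (by simp; linarith)
  have g2 : Complex.Gamma (1 - s - Complex.I * τ) ≠ 0 :=
    Complex.Gamma_ne_zero_of_re_pos (by simp; linarith)
  have g3 : Complex.Gamma (s + Complex.I * τ) ≠ 0 :=
    Complex.Gamma_ne_zero_of_re_pos (by simp; linarith)
  have g4 : Complex.Gamma (s - Complex.I * τ) ≠ 0 :=
    Complex.Gamma_ne_zero_of_re_pos (by simp; linarith)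
  have g5 : Complex.Gamma (1 - s) ≠ 0 := Complex.Gamma_ne_zero_of_re_pos (by simp; linarith)
  have g6 : Complex.Gamma s ≠ 0 := Complex.Gamma_ne_zero_of_re_pos hs
  have hpi : (Real.pi : ℂ) ≠ 0 := by exact_mod_cast Real.pi_ne_zero
  have hadd := Gamma_quotient_add g1 g2 g3 g4
  have hcos : Complex.cos (Real.pi * (Complex.I * τ)) = Real.cosh (Real.pi * τ) := by
    rw [show Real.pi * (Complex.I * τ) = ((Real.pi * τ : ℝ) : ℂ) * Complex.I by push_cast; ring,
      Complex.cos_mul_I, Complex.ofReal_cosh]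
  have hrefl := Complex.Gamma_mul_Gamma_one_sub s
  have hsn : Complex.sin (Real.pi * s) ≠ 0 := fun h => by
    rw [h, div_zero] at hrefl; exact mul_ne_zero g6 g5 hrefl
  have hsin : Complex.sin (Real.pi * s) / Real.pi =
      1 / (Complex.Gamma s * Complex.Gamma (1 - s)) := by
    rw [hrefl]; field_simp
  have hdup := Complex.Gamma_mul_Gamma_add_half (1 / 2 - s)
  rw [show 1 / 2 - s + 1 / 2 = 1 - s by ring, show 2 * (1 / 2 - s) = 1 - 2 * s by ring,
    show 1 - (1 - 2 * s) = 2 * s by ring] at hdup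
  have hsq : (Real.sqrt Real.pi : ℂ) ≠ 0 := by
    exact_mod_cast (Real.sqrt_pos.2 Real.pi_pos).ne'
  have h2s : (2 : ℂ) ^ (2 * s) = 2 ^ (2 * s - 2) * 4 := by
    rw [Complex.cpow_sub _ _ two_ne_zero]
    norm_num
  rw [h2s] at hdup
  rw [hcos] at hadd
  rw [← mul_add, ← sub_eq_add_neg, ← sub_eq_add_neg]
  have hL : Complex.Gamma s * Complex.Gamma (s + Complex.I * τ) * Complex.Gamma (1 - 2 * s) /
        (Complex.Gamma (1 - s) * Complex.Gamma (1 - s + Complex.I * τ)) +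
      Complex.Gamma s * Complex.Gamma (s - Complex.I * τ) * Complex.Gamma (1 - 2 * s) /
        (Complex.Gamma (1 - s) * Complex.Gamma (1 - s - Complex.I * τ)) =
      Complex.Gamma s * Complex.Gamma (1 - 2 * s) / Complex.Gamma (1 - s) *
      (Complex.Gamma (s + Complex.I * τ) / Complex.Gamma (1 - s + Complex.I * τ) +
        Complex.Gamma (s - Complex.I * τ) / Complex.Gamma (1 - s - Complex.I * τ)) := by
    field_simp
  have hsc : 2 * Complex.sin (Real.pi * s) * (Real.cosh (Real.pi * τ) : ℂ) / Real.pi =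
      2 * (Real.cosh (Real.pi * τ) : ℂ) * (Complex.sin (Real.pi * s) / Real.pi) := by ring
  rw [hL, hadd, hsc, hsin]
  push_cast
  have hG : Complex.Gamma (1 / 2 - s) = Complex.Gamma (1 - 2 * s) * (2 ^ (2 * s - 2) * 4) *
      Real.sqrt Real.pi / Complex.Gamma (1 - s) := by
    rw [← hdup]; field_simp
  rw [hG]
  field_simp
  ring

/-- The kernel is the Bessel product at `x^{-1/2}`, so its Mellin transform at `-s` is twice that of
the product at `2s`; the `2` and the hyperbolic cosine cancel against the prefactor. -/
theorem mellin_lebedevKernel {s : ℂ} (τ : ℝ) (hs : 0 < s.re) (hs' : s.re < 1 / 2) :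
    MellinConvergent (lebedevKernel τ) (-s) ∧
    (Real.sqrt Real.pi / Real.cosh (Real.pi * τ) : ℝ) * mellin (lebedevKernel τ) (-s) =
      Complex.Gamma (s + Complex.I * τ) * Complex.Gamma (s - Complex.I * τ) *
        Complex.Gamma (1 / 2 - s) / Complex.Gamma (1 - s) := by
  obtain ⟨h1, h2⟩ := mellin_besselK_mul_besselI_add τ hs hs'
  set H : ℝ → ℂ := fun u => besselK (Complex.I * τ) u *
      (besselI (Complex.I * τ) u + besselI (-(Complex.I * τ)) u) with hH
  have he : -s / ((-1 / 2 : ℝ) : ℂ) = 2 * s := by push_cast; ring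
  have hpt : ∀ x ∈ Ioi (0 : ℝ), (x : ℂ) ^ (-s - 1) • lebedevKernel τ x =
      (x : ℂ) ^ (-s - 1) • H (x ^ (-1 / 2 : ℝ)) := fun x (hx : 0 < x) => by
    rw [show x ^ (-1 / 2 : ℝ) = 1 / Real.sqrt x by
      rw [Real.sqrt_eq_rpow, one_div, ← Real.rpow_neg hx.le]; norm_num]
    rfl
  refine ⟨?_, ?_⟩
  · rw [MellinConvergent, integrableOn_congr_fun hpt measurableSet_Ioi]
    refine (MellinConvergent.comp_rpow (f := H) (s := -s) (a := -1 / 2) (by norm_num)).2 ?_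
    rwa [he]
  · have h3 := mellin_comp_rpow H (-s) (-1 / 2)
    rw [he, h2] at h3
    rw [mellin, setIntegral_congr_fun measurableSet_Ioi hpt]
    rw [mellin] at h3
    rw [h3]
    have hsq : (Real.sqrt Real.pi : ℂ) ≠ 0 := by
      exact_mod_cast (Real.sqrt_pos.2 Real.pi_pos).ne'
    have hch : (Real.cosh (Real.pi * τ) : ℂ) ≠ 0 := by exact_mod_cast (Real.cosh_pos _).ne'
    rw [show |(-1 / 2 : ℝ)|⁻¹ = 2 by rw [abs_of_neg (by norm_num)]; norm_num, Complex.real_smul,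
      ← mul_assoc, ← mul_assoc, ← Complex.ofReal_mul, ← Complex.ofReal_mul]
    have : Real.sqrt Real.pi / Real.cosh (Real.pi * τ) * 2 *
        (Real.cosh (Real.pi * τ) / (2 * Real.sqrt Real.pi)) = 1 := by
      have := (Real.sqrt_pos.2 Real.pi_pos).ne'
      have := (Real.cosh_pos (Real.pi * τ)).ne'
      field_simp
    rw [this, Complex.ofReal_one, one_mul]

/-! ### The transform as a Lebedev transform -/

section Lebedev

variable {μ : ℂ} {ν p : ℝ} {f : ℝ → ℂ}

/-- By the duplication formula, the Parseval integrand shifted by `1/2` factors as the Mellin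
transform of the normalized Lebedev kernel times `phiMellin`. The Gamma factors in `phiMellin` are
dictated by this quotient. -/
theorem barnes_mul_mellin_eq {s : ℂ} (τ : ℝ) (hs : 0 < s.re) (hs' : s.re < 1 / 2) :
    barnes μ τ (s - 1 / 2) * mellin f (1 - (s - 1 / 2)) =
      Complex.Gamma (s + Complex.I * τ) * Complex.Gamma (s - Complex.I * τ) *
        Complex.Gamma (1 / 2 - s) / Complex.Gamma (1 - s) * phiMellin μ f s := by
  have g1 : Complex.Gamma (1 - s) ≠ 0 := Complex.Gamma_ne_zero_of_re_pos (by simp; linarith)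
  have g2 : Complex.Gamma (1 / 2 - s) ≠ 0 := Complex.Gamma_ne_zero_of_re_pos (by simp; linarith)
  have g3 : Complex.Gamma s ≠ 0 := Complex.Gamma_ne_zero_of_re_pos hs
  have g4 : Complex.Gamma (s + 1 / 2) ≠ 0 := Complex.Gamma_ne_zero_of_re_pos (by simp; linarith)
  have g5 : Complex.Gamma (2 * s) ≠ 0 := Complex.Gamma_ne_zero_of_re_pos (by simpa using hs)
  have hsq : (Real.sqrt Real.pi : ℂ) ≠ 0 := by
    exact_mod_cast (Real.sqrt_pos.2 Real.pi_pos).ne'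
  have hdup := Complex.Gamma_mul_Gamma_add_half s
  have h4 : (4 : ℂ) ^ (s - 1 / 2) * 2 ^ (1 - 2 * s) = 1 := by
    rw [show (4 : ℂ) = ((4 : ℝ) : ℂ) by norm_num, show (2 : ℂ) = ((2 : ℝ) : ℂ) by norm_num,
      ofReal_cpow_eq_exp (by norm_num), ofReal_cpow_eq_exp (by norm_num), ← Complex.exp_add,
      show (4 : ℝ) = 2 ^ 2 by norm_num, Real.log_pow, Complex.exp_eq_one_iff]
    refine ⟨0, ?_⟩
    push_cast
    ring
  have hq : (Real.sqrt Real.pi : ℂ)⁻¹ * 4 ^ (s - 1 / 2) * (Complex.Gamma s / Complex.Gamma (2 * s)) =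
      1 / Complex.Gamma (s + 1 / 2) := by
    have h5 : Complex.Gamma s = Complex.Gamma (2 * s) * 2 ^ (1 - 2 * s) * Real.sqrt Real.pi /
        Complex.Gamma (s + 1 / 2) := by rw [← hdup, mul_div_cancel_right₀ _ g4]
    calc _ = (Real.sqrt Real.pi : ℂ)⁻¹ * 4 ^ (s - 1 / 2) * (Complex.Gamma (2 * s) *
          2 ^ (1 - 2 * s) * Real.sqrt Real.pi / Complex.Gamma (s + 1 / 2) /
          Complex.Gamma (2 * s)) := by rw [← h5]
      _ = (4 : ℂ) ^ (s - 1 / 2) * 2 ^ (1 - 2 * s) / Complex.Gamma (s + 1 / 2) := by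
          generalize Complex.Gamma (s + 1 / 2) = A at g4 ⊢
          generalize Complex.Gamma (2 * s) = B at g5 ⊢
          field_simp
      _ = _ := by rw [h4]
  rw [barnes, boundIntegrand, phiMellin, show s - 1 / 2 + 1 / 2 = s by ring,
    show 2 * (s - 1 / 2) + 1 = 2 * s by ring, show -μ - (s - 1 / 2) = 1 / 2 - μ - s by ring,
    show 1 + (s - 1 / 2) - μ = 1 / 2 + s - μ by ring, show 1 - (s - 1 / 2) = 3 / 2 - s by ring]
  calc _ = ((Real.sqrt Real.pi : ℂ)⁻¹ * 4 ^ (s - 1 / 2) *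
        (Complex.Gamma s / Complex.Gamma (2 * s))) * (Complex.Gamma (s - Complex.I * τ) *
        Complex.Gamma (s + Complex.I * τ) * Complex.Gamma s * Complex.Gamma (1 / 2 - μ - s) /
        Complex.Gamma (1 / 2 + s - μ) * mellin f (3 / 2 - s)) := by ring
    _ = _ := by
        rw [hq]
        generalize Complex.Gamma (1 / 2 - s) = A at g2 ⊢
        field_simp

theorem verticalIntegrable_phiMellin (hp : 1 < p) (hp2 : p ≤ 2)
    (hν : -(1 / 2) * (1 - 1 / p) < ν) (hν0 : ν < 0) (hν' : ν < -μ.re)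
    (hf : MellinConvergent f ((1 - ν : ℝ) : ℂ))
    (hfp : MemLp f (ENNReal.ofReal p) (weightedMeasure (1 - ν) p)) {x : ℝ} (hx : 0 < x) :
    Complex.VerticalIntegrable (fun s => (x : ℂ) ^ (-s) * phiMellin μ f s) (ν + 1 / 2) := by
  have hx0 : (x : ℂ) ≠ 0 := by exact_mod_cast hx.ne'
  refine (integrable_phiMellin_line hp hp2 hν hν0 hν' hf hfp).bdd_mul (c := x ^ (-(ν + 1 / 2)))
    (Continuous.aestronglyMeasurable (Continuous.const_cpow (by fun_prop) (Or.inl hx0)))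
    (Eventually.of_forall fun t => ?_)
  rw [Complex.norm_cpow_eq_rpow_re_of_pos hx]
  simp

theorem integrable_lebedevKernel_mul_phiMellin (hp : 1 < p) (hp2 : p ≤ 2)
    (hν : -(1 / 2) * (1 - 1 / p) < ν) (hν0 : ν < 0) (hν' : ν < -μ.re)
    (hf : MellinConvergent f ((1 - ν : ℝ) : ℂ))
    (hfp : MemLp f (ENNReal.ofReal p) (weightedMeasure (1 - ν) p)) (τ : ℝ) :
    Integrable (fun z : ℝ × ℝ => (z.1 : ℂ) ^ (-(((ν + 1 / 2 : ℝ) : ℂ) + z.2 * Complex.I) - 1) *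
      lebedevKernel τ z.1 * phiMellin μ f (((ν + 1 / 2 : ℝ) : ℂ) + z.2 * Complex.I))
      ((volume.restrict (Ioi 0)).prod volume) := by
  have hp1 : 0 < 1 / p := by positivity
  have h1 := (mellin_lebedevKernel (s := ((ν + 1 / 2 : ℝ) : ℂ)) τ
    (by rw [Complex.ofReal_re]; linarith) (by rw [Complex.ofReal_re]; linarith)).1
  have h2 := integrable_phiMellin_line hp hp2 hν hν0 hν' hf hfp
  have h3 := Integrable.mul_prod h1 h2
  have hm : Measurable fun z : ℝ × ℝ => (z.1 : ℂ) ^ (-(z.2 * Complex.I)) := by fun_prop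
  have h4 := h3.bdd_mul (c := 1) hm.aestronglyMeasurable (by
    have : ∀ᵐ z : ℝ × ℝ ∂((volume.restrict (Ioi 0)).prod volume), z.1 ∈ Ioi (0 : ℝ) :=
      Measure.quasiMeasurePreserving_fst.ae (ae_restrict_mem measurableSet_Ioi)
    filter_upwards [this] with z hz
    rw [Complex.norm_cpow_eq_rpow_re_of_pos hz]
    simp)
  refine h4.congr ?_
  have : ∀ᵐ z : ℝ × ℝ ∂((volume.restrict (Ioi 0)).prod volume), z.1 ∈ Ioi (0 : ℝ) :=
    Measure.quasiMeasurePreserving_fst.ae (ae_restrict_mem measurableSet_Ioi)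
  filter_upwards [this] with z hz
  have hz0 : (z.1 : ℂ) ≠ 0 := by exact_mod_cast (ne_of_gt hz)
  rw [show -(((ν + 1 / 2 : ℝ) : ℂ) + z.2 * Complex.I) - 1 =
    -(z.2 * Complex.I) + (-((ν + 1 / 2 : ℝ) : ℂ) - 1) by ring, Complex.cpow_add _ _ hz0, smul_eq_mul]
  ring

theorem lebedevKernel_mul_phi_eq (τ : ℝ) {x : ℝ} (hx : 0 < x) :
    lebedevKernel τ x * phi μ ν f x / x = (1 / (2 * Real.pi) : ℝ) *
      ∫ t : ℝ, (x : ℂ) ^ (-(((ν + 1 / 2 : ℝ) : ℂ) + t * Complex.I) - 1) *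
        lebedevKernel τ x * phiMellin μ f (((ν + 1 / 2 : ℝ) : ℂ) + t * Complex.I) := by
  have hx0 : (x : ℂ) ≠ 0 := by exact_mod_cast hx.ne'
  rw [phi, mellinInv, Complex.real_smul, mul_left_comm, mul_div_assoc, div_eq_mul_inv _ (x : ℂ),
    ← integral_const_mul, ← integral_mul_const]
  congr 2 with t
  rw [Complex.cpow_sub _ _ hx0, Complex.cpow_one, smul_eq_mul]
  ring

theorem integrableOn_lebedevKernel_mul_phi (hp : 1 < p) (hp2 : p ≤ 2)
    (hν : -(1 / 2) * (1 - 1 / p) < ν) (hν0 : ν < 0) (hν' : ν < -μ.re)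
    (hf : MellinConvergent f ((1 - ν : ℝ) : ℂ))
    (hfp : MemLp f (ENNReal.ofReal p) (weightedMeasure (1 - ν) p)) (τ : ℝ) :
    IntegrableOn (fun x => lebedevKernel τ x * phi μ ν f x / x) (Ioi 0) := by
  have h := (integrable_lebedevKernel_mul_phiMellin hp hp2 hν hν0 hν' hf hfp τ).integral_prod_left
  exact IntegrableOn.congr_fun (h.const_mul _) (fun x hx => (lebedevKernel_mul_phi_eq τ hx).symm)
    measurableSet_Ioi

/-- Parseval's formula in the reverse direction: the `x`-integral of the Lebedev kernel against
`x^{-s-1}` restores the `barnes` integrand on the line `Re s = ν + 1/2`. -/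
theorem transform_eq_lebedev (hμ : μ.re < 1 / 2) (hp : 1 < p) (hp2 : p ≤ 2)
    (hν : -(1 / 2) * (1 - 1 / p) < ν) (hν0 : ν < 0) (hν' : ν < -μ.re)
    (hf : MellinConvergent f ((1 - ν : ℝ) : ℂ))
    (hfp : MemLp f (ENNReal.ofReal p) (weightedMeasure (1 - ν) p)) (τ : ℝ) :
    transform μ f τ = (Real.sqrt Real.pi / Real.cosh (Real.pi * τ) : ℝ) *
      ∫ x in Ioi (0 : ℝ), lebedevKernel τ x * phi μ ν f x / x := by
  have hp1 : 0 < 1 / p := by positivity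
  rw [transform_eq_integral_barnes hμ (by linarith) hν' τ hf,
    setIntegral_congr_fun measurableSet_Ioi (fun x hx => lebedevKernel_mul_phi_eq τ hx),
    integral_const_mul, mul_left_comm]
  congr 1
  rw [integral_integral_swap (integrable_lebedevKernel_mul_phiMellin hp hp2 hν hν0 hν' hf hfp τ),
    ← integral_const_mul]
  congr 1 with t
  set s : ℂ := ((ν + 1 / 2 : ℝ) : ℂ) + t * Complex.I with hs
  have hre : s.re = ν + 1 / 2 := by simp [hs]
  have h1 := barnes_mul_mellin_eq (μ := μ) (f := f) (s := s) τ (by linarith) (by linarith)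
  rw [show s - 1 / 2 = ν + t * Complex.I by rw [hs]; push_cast; ring] at h1
  rw [h1, integral_mul_const, ← mul_assoc, ← (mellin_lebedevKernel τ (by linarith)
    (by linarith)).2]
  rfl

end Lebedev

end IndexTransform

end

/-! ### Assembly of the theorem -/

theorem theorem1 (μ : ℂ) (hμ : μ.re < 1 / 2) (ν : ℝ) (hν : -1 / 2 < ν) (hν' : ν < -μ.re) :
    -- the integral in `C_{μ,ν}` is finite
    MeasureTheory.Integrable
      (fun t : ℝ => IndexTransform.boundIntegrand μ (ν + t * Complex.I)) ∧
    -- `F_μ` is a bounded operator from `L_{1-ν,1}(ℝ₊)` to `C_b(ℝ)`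
    (∃ T : MeasureTheory.Lp ℂ 1 (IndexTransform.weightedMeasure (1 - ν) 1) →L[ℂ]
        BoundedContinuousFunction ℝ ℂ,
      ∀ (f : ℝ → ℂ)
        (hf : MeasureTheory.MemLp f 1 (IndexTransform.weightedMeasure (1 - ν) 1)),
        (∀ τ : ℝ,
          MeasureTheory.IntegrableOn (fun y => IndexTransform.legendreSq μ τ y * f y)
            (Set.Ioi 0) ∧
          T (hf.toLp f) τ = IndexTransform.transform μ f τ) ∧
        ‖T (hf.toLp f)‖ ≤
          IndexTransform.boundConst μ ν * IndexTransform.weightedNorm (1 - ν) 1 f ∧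
        Filter.Tendsto (IndexTransform.transform μ f) (Filter.cocompact ℝ) (nhds 0)) ∧
    -- the representation as a Lebedev transform
    (∀ p q : ℝ, 1 < p → p ≤ 2 → q = p / (p - 1) →
      -(1 / (2 * q)) < ν → ν < min 0 (-μ.re) →
      ∀ f : ℝ → ℂ,
        MeasureTheory.MemLp f 1 (IndexTransform.weightedMeasure (1 - ν) 1) →
        MeasureTheory.MemLp f (ENNReal.ofReal p) (IndexTransform.weightedMeasure (1 - ν) p) →
        (∀ x : ℝ, 0 < x →
          Complex.VerticalIntegrable
            (fun s => (x : ℂ) ^ (-s) * IndexTransform.phiMellin μ f s) (ν + 1 / 2)) ∧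
        ∀ τ : ℝ,
          MeasureTheory.IntegrableOn
            (fun x => IndexTransform.lebedevKernel τ x * IndexTransform.phi μ ν f x / x)
            (Set.Ioi 0) ∧
          IndexTransform.transform μ f τ =
            (Real.sqrt Real.pi / Real.cosh (Real.pi * τ) : ℝ) *
              ∫ x in Set.Ioi (0 : ℝ),
                IndexTransform.lebedevKernel τ x * IndexTransform.phi μ ν f x / x) := by
  refine ⟨IndexTransform.integrable_boundIntegrand hν hν', ?_, ?_⟩
  · obtain ⟨T, hT⟩ := IndexTransform.exists_transform_operator hμ hν hν'
    refine ⟨T, fun f hf => ?_⟩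
    have hf' := IndexTransform.memLp_one_weightedMeasure_iff.1 hf
    exact ⟨fun τ => ⟨IndexTransform.integrableOn_legendreSq_mul hμ hν hν' τ hf', (hT f hf).1 τ⟩,
      (hT f hf).2, IndexTransform.tendsto_transform hμ hν hν' hf'⟩
  · intro p q hp hp2 hq hν1 hν2 f hf hfp
    have hf' := IndexTransform.memLp_one_weightedMeasure_iff.1 hf
    have hν0 : ν < 0 := hν2.trans_le (min_le_left _ _)
    -- From `q = p/(p - 1)` one has `1/q = 1 - 1/p`.
    have hνp : -(1 / 2) * (1 - 1 / p) < ν := by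
      refine lt_of_eq_of_lt ?_ hν1
      have h1 : p ≠ 0 := by linarith
      have h2 : p - 1 ≠ 0 := by linarith
      rw [hq]
      field_simp
    exact ⟨fun x hx =>
        IndexTransform.verticalIntegrable_phiMellin hp hp2 hνp hν0 hν' hf' hfp hx,
      fun τ => ⟨IndexTransform.integrableOn_lebedevKernel_mul_phi hp hp2 hνp hν0 hν' hf' hfp τ,
        IndexTransform.transform_eq_lebedev hμ hp hp2 hνp hν0 hν' hf' hfp τ⟩⟩
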